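/- Let $\Gamma_0^+(3)=\Gamma_0(3)\cup\begin{pmatrix}0&-1/\sqrt3\\ \sqrt3&0\end{pmatrix}\Gamma_0(3)\subset SL_2(\mathbb R)$ and $q=e^{2\pi i z}$ for $z$ in the upper half-plane $\mathbb H$. A weakly holomorphic modular form of weight $k$ for $\Gamma_0^+(3)$ is a holomorphic function $f$ on $\mathbb H$ with $f\left(\frac{az+b}{cz+d}\right)=(cz+d)^kf(z)$ for all $\begin{pmatrix}a&b\\c&d\end{pmatrix}\in\Gamma_0^+(3)$ and $z\in\mathbb H$, and with a $q$-expansion $f(z)=\sum_{n\ge n_f}a_nq^n$ for some $n_f\in\mathbb Z$. Let $k$ be an even integer and write $k=12\ell_k+r_k$ with $\ell_k\in\mathbb Z$ and $r_k\in\{0,4,6,8,10,14\}$. Put $\varepsilon_k=0$ if $r_k\in\{0,4,6\}$ and $\varepsilon_k=1$ if $r_k\in\{8,10,14\}$. For an integer $m\ge-2\ell_k-\varepsilon_k$ let $f_{k,m}$ be the unique weakly holomorphic modular form of weight $k$ for $\Gamma_0^+(3)$ with $q$-expansion $f_{k,m}(z)=q^{-m}+O(q^{2\ell_k+\varepsilon_k+1})$.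 (a) If $m\ge 9|\ell_k|-2\ell_k+18$, then for all $\theta\in\left[\frac{\pi}{2},\frac{23}{10}\right]$, $$\left|e^{-\frac{2\pi m}{\sqrt3}\sin\theta}\,e^{\frac{ik\theta}{2}}f_{k,m}\left(\tfrac{1}{\sqrt3}e^{i\theta}\right)-2\cos\left(\tfrac{k\theta}{2}-\tfrac{2\pi m}{\sqrt3}\cos\theta\right)\right|<1.9674.$$ (b) If $m\ge 18|\ell_k|+23$, then for all $\theta\in\left[\frac{23}{10},\frac{5\pi}{6}-\frac{12}{25m}\right]$, $$\left|e^{-\frac{2\pi m}{\sqrt3}\sin\theta}\,e^{\frac{ik\theta}{2}}f_{k,m}\left(\tfrac{1}{\sqrt3}e^{i\theta}\right)-2\cos\left(\tfrac{k\theta}{2}-\tfrac{2\pi m}{\sqrt3}\cos\theta\right)\right|<0.99728.$$ -/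

import Mathlib

open scoped UpperHalfPlane MatrixGroups Manifold

namespace FrickeThree

noncomputable section

/-- The matrix with rows `(0, -1/√3)` and `(√3, 0)`; it acts on `ℍ` by `z ↦ -1/(3z)`. -/
def frickeMatrix : SL(2, ℝ) :=
  ⟨!![0, -(1 / √3); √3, 0], by
    rw [Matrix.det_fin_two_of]
    have h : √(3 : ℝ) ≠ 0 := by positivity
    field_simp
    norm_num⟩

/-- `Γ₀⁺(3) = Γ₀(3) ∪ W Γ₀(3)`, with `W = frickeMatrix`, as a set of real matrices. -/
def Gamma0Plus : Set SL(2, ℝ) :=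
  {g | ∃ γ ∈ CongruenceSubgroup.Gamma0 3,
    g = Matrix.SpecialLinearGroup.map (Int.castRingHom ℝ) γ ∨
    g = frickeMatrix * Matrix.SpecialLinearGroup.map (Int.castRingHom ℝ) γ}

/-- `q = e^{2πiz}`. -/
def q (z : ℍ) : ℂ := Complex.exp (2 * Real.pi * Complex.I * (z : ℂ))

/-- Weakly holomorphic modular forms of weight `k` for `Γ₀⁺(3)`, as functions on `ℍ`. -/
structure IsWeaklyHolomorphic (k : ℤ) (f : ℍ → ℂ) : Prop where
  holo : MDifferentiable 𝓘(ℂ) 𝓘(ℂ) f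
  modular : ∀ g ∈ Gamma0Plus, ∀ z : ℍ,
    f (g • z) = (((g 1 0 : ℝ) : ℂ) * (z : ℂ) + ((g 1 1 : ℝ) : ℂ)) ^ k * f z
  qExpansion : ∃ (n₀ : ℤ) (a : ℕ → ℂ), ∀ z : ℍ,
    HasSum (fun n : ℕ => a n * q z ^ (n₀ + (n : ℤ))) (f z)

/-- `ε = dim S_r(Γ₀⁺(3))` for `r ∈ {0, 4, 6, 8, 10, 14}`: it is `0` for `r = 0, 4, 6`
and `1` for `r = 8, 10, 14`. -/
def eps (r : ℤ) : ℤ := if r = 8 ∨ r = 10 ∨ r = 14 then 1 else 0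

/-- For `k = 12ℓ + r` with `r ∈ {0, 4, 6, 8, 10, 14}`, this characterizes the basis element
`f_{k,m}`: the weakly holomorphic form of weight `k` for `Γ₀⁺(3)` with
`f = q^{-m} + O(q^{2ℓ+ε+1})`. -/
def IsBasisForm (ℓ r m : ℤ) (f : ℍ → ℂ) : Prop :=
  IsWeaklyHolomorphic (12 * ℓ + r) f ∧
    ∃ a : ℕ → ℂ, ∀ z : ℍ,
      HasSum (fun n : ℕ => a n * q z ^ (2 * ℓ + eps r + 1 + (n : ℤ))) (f z - q z ^ (-m))

/-- The point `e^{iθ}/√3` of `ℍ` (used only where `sin θ > 0`, see `coe_arcPoint`). -/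
def arcPoint (θ : ℝ) : ℍ :=
  UpperHalfPlane.ofComplex (Complex.exp (Complex.I * θ) / (√3 : ℝ))

theorem coe_arcPoint {θ : ℝ} (h : 0 < Real.sin θ) :
    (arcPoint θ : ℂ) = Complex.exp (Complex.I * θ) / (√3 : ℝ) := by
  have him : 0 < (Complex.exp (Complex.I * θ) / (√3 : ℝ)).im := by
    rw [Complex.div_ofReal_im, mul_comm, Complex.exp_ofReal_mul_I_im]
    positivity
  rw [arcPoint, UpperHalfPlane.ofComplex_apply_of_im_pos him]

/-- `h(θ) = e^{-2πm sin θ/√3} e^{ikθ/2} f(e^{iθ}/√3)`. -/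
def normalized (k m : ℤ) (f : ℍ → ℂ) (θ : ℝ) : ℂ :=
  (Real.exp (-(2 * Real.pi * m * (1 / √3) * Real.sin θ)) : ℝ) *
    Complex.exp (Complex.I * k * θ / 2) * f (arcPoint θ)

/-- `α(θ) = kθ/2 - 2πm cos θ/√3`. -/
def phase (k m : ℤ) (θ : ℝ) : ℝ :=
  k * θ / 2 - 2 * Real.pi * m * (1 / √3) * Real.cos θ

end

end FrickeThree

namespace FrickeThree

noncomputable section

open Complex Metric Filter Topology

/-! Write `W` for the Fricke involution `τ ↦ -1/(3τ)`. Only invariance under `τ ↦ τ + 1` (built into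
the `q`-expansion) and under `W` is used. Let `t` be the Hauptmodul of `Γ₀(3)`, `j = t + 54 +
729/t`, and let `A`, `D`, `S` be forms of weights 2, 4, 6 with `A³ = jS` and `D² = AS(j - 108)`.

Exact formula. Multiplying `f` by a complementary monomial in `A`, `D`, `S` gives a form of weight
two, which must be `-Q(j) q dj/dq` for a polynomial `Q` (`exists_polynomial_leading`). Hence `f(z)`
is an explicit base form times `Q(j(z))`. The condition `f = q^{-m} + O(q^{2ℓ+ε+1})` says precisely
that `Q(c)` is an integral over a small circle in which only the term `q^{-m}` of `f` survives
(`circleIntegral_kern`). Enlarging the circle to radius `R < 1` crosses simple poles at the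
`q`-values of the orbit of `z` (`leading_eq_sum_add_integral`). For `z = e^{iθ}/√3`, the residues at
`z` and `Wz = -z̄` add up, after normalization, to `2 cos` of the phase (`main_terms`). The error
thus consists of the other residues inside the circle and one integral.

Which poles occur. The argument of `t` increases strictly along the arc, so `j` separates orbits
(`orb_of_jInv_eq`), and orbit heights are `Im z` divided by values of `u² - puv + 3v²` with `p =
-2√3 cos θ`. For `θ ≤ 23/10` a gap in the heights contains the circle `|q| = 0.17`, and no further
residue enters. As `θ → 5π/6`, `p → 3` and six points modulo translation approach one common height.
The circle `|q| = 0.45` then encloses four further points (`lowPoint`). Their residues are at most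
`0.8546` in total, because `θ` keeps the distance `12/(25m)` from `5π/6`.

Size of the integral. Decay in `m` absorbs the power `2ℓ` of the ratio of values of `S`. The
denominator `j - c`, with `c = j(z)`, is bounded below by a maximum principle with Blaschke factors
(`mul_blaschke_le_of_fundDom`), and `c` itself by a differential inequality along the arc
(`jInv_arc_ge`). Since the kernel costs only a factor `c^{-1/6}`, closeness to the elliptic point
costs only a factor linear in `m`. The resulting errors are at most `1` and `0.95`. -/

/-- The nome `e^{2πiτ}`. -/
def nome (τ : ℂ) : ℂ := cexp (2 * Real.pi * I * τ)

/-- The Fricke involution `τ ↦ -1/(3τ)`. -/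
def fricke (τ : ℂ) : ℂ := -1 / (3 * τ)

/-- Euler's product `∏ (1 - q^n)`. -/
def eulerProd (q : ℂ) : ℂ := ∏' n : ℕ, (1 - q ^ (n + 1))

/-- `(∏ (1 - q^n) / ∏ (1 - q^{3n}))^12`. -/
def unitT (q : ℂ) : ℂ := (eulerProd q / eulerProd (q ^ 3)) ^ 12

/-- `(∏ (1 - q^n) ∏ (1 - q^{3n}))^6`. -/
def unitS (q : ℂ) : ℂ := (eulerProd q * eulerProd (q ^ 3)) ^ 6

/-- The Hauptmodul `(η(τ)/η(3τ))^12` of `Γ₀(3)`. -/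
def haupt (q : ℂ) : ℂ := unitT q / q

/-- The weight six form `(η(τ)η(3τ))^6`. -/
def formS (q : ℂ) : ℂ := q * unitS q

/-- The Hauptmodul of `Γ₀⁺(3)`. -/
def jInv (q : ℂ) : ℂ := haupt q + 54 + 729 / haupt q

/-- `q` times the Hauptmodul of `Γ₀⁺(3)`. -/
def jNum (q : ℂ) : ℂ := unitT q + 54 * q + 729 * q ^ 2 / unitT q

/-- The weight two form `-θt/t` for `t = haupt` and `θ = q d/dq`. -/
def formA (q : ℂ) : ℂ := 1 - q * logDeriv unitT q

/-- The logarithmic derivative of `formS`, a quasimodular form of weight two. -/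
def quasiE (q : ℂ) : ℂ := 1 + q * logDeriv unitS q

/-- A weight four form obtained as a Serre derivative of `formA`. -/
def formD (q : ℂ) : ℂ := formA q * quasiE q - 3 * q * deriv formA q

/-! ### The nome and the Fricke involution. -/

lemma nome_ne_zero (τ : ℂ) : nome τ ≠ 0 := exp_ne_zero _

lemma norm_nome (τ : ℂ) : ‖nome τ‖ = Real.exp (-(2 * Real.pi * τ.im)) := by
  simp [nome, norm_exp]

lemma norm_nome_lt_one {τ : ℂ} (h : 0 < τ.im) : ‖nome τ‖ < 1 := by
  rw [norm_nome, Real.exp_lt_one_iff]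
  have := Real.pi_pos
  nlinarith [mul_pos this h]

lemma nome_mem_ball {τ : ℂ} (h : 0 < τ.im) : nome τ ∈ ball (0 : ℂ) 1 := by
  simpa using norm_nome_lt_one h

lemma nome_add_int (τ : ℂ) (n : ℤ) : nome (τ + n) = nome τ := by
  unfold nome
  rw [mul_add, Complex.exp_add, show 2 * (Real.pi : ℂ) * I * n = n * (2 * Real.pi * I) by ring,
    exp_int_mul_two_pi_mul_I, mul_one]

lemma nome_add_one (τ : ℂ) : nome (τ + 1) = nome τ := by
  simpa using nome_add_int τ 1

lemma nome_three_mul (τ : ℂ) : nome (3 * τ) = nome τ ^ 3 := by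
  simp only [nome, ← Complex.exp_nat_mul]; congr 1; push_cast; ring

lemma hasDerivAt_nome (τ : ℂ) : HasDerivAt nome (2 * Real.pi * I * nome τ) τ := by
  have : HasDerivAt (fun τ : ℂ => 2 * Real.pi * I * τ) (2 * Real.pi * I) τ := by
    simpa using (hasDerivAt_id τ).const_mul (2 * Real.pi * I)
  refine this.cexp.congr_deriv ?_
  rw [nome]; ring

lemma exists_nome_eq {q : ℂ} (h0 : q ≠ 0) (h1 : ‖q‖ < 1) : ∃ τ : ℂ, 0 < τ.im ∧ nome τ = q := by
  have hpi := Real.pi_pos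
  have h2 : (2 * Real.pi * I : ℂ) ≠ 0 := by simp [hpi.ne']
  have he : nome (Complex.log q / (2 * Real.pi * I)) = q := by
    rw [nome, mul_div_cancel₀ _ h2, exp_log h0]
  refine ⟨_, ?_, he⟩
  by_contra hc
  push Not at hc
  rw [← he, norm_nome, Real.exp_lt_one_iff] at h1
  nlinarith [mul_nonneg hpi.le (neg_nonneg.2 hc)]

lemma fricke_im (τ : ℂ) : (fricke τ).im = τ.im / (3 * normSq τ) := by
  rw [fricke, neg_div, one_div, neg_im, inv_im]
  simp [normSq_mul]
  rw [show 3 * 3 * normSq τ = 3 * (3 * normSq τ) by ring, neg_div, neg_neg,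
    mul_div_mul_left _ _ (by norm_num)]

lemma normSq_pos_of_im_pos {τ : ℂ} (h : 0 < τ.im) : 0 < normSq τ :=
  normSq_pos.2 fun h0 => by simp [h0] at h

lemma ne_zero_of_im_pos {τ : ℂ} (h : 0 < τ.im) : τ ≠ 0 := fun h0 => by simp [h0] at h

lemma fricke_im_pos {τ : ℂ} (h : 0 < τ.im) : 0 < (fricke τ).im := by
  rw [fricke_im]; have := normSq_pos_of_im_pos h; positivity

lemma fricke_fricke {τ : ℂ} (h : τ ≠ 0) : fricke (fricke τ) = τ := by
  unfold fricke; field_simp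

lemma hasDerivAt_fricke {τ : ℂ} (h : τ ≠ 0) : HasDerivAt fricke (1 / (3 * τ ^ 2)) τ := by
  have h1 : HasDerivAt (fun τ : ℂ => 3 * τ) 3 τ := by simpa using (hasDerivAt_id τ).const_mul 3
  have := (hasDerivAt_const τ (-1 : ℂ)).fun_div h1 (by simpa using h)
  refine this.congr_deriv ?_
  field_simp; ring

/-! ### Analyticity on the unit disc -/

lemma pow_three_mem_ball {q : ℂ} (hq : q ∈ ball (0 : ℂ) 1) : q ^ 3 ∈ ball (0 : ℂ) 1 := by
  simp only [mem_ball_zero_iff, norm_pow] at *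
  exact pow_lt_one₀ (norm_nonneg _) hq (by norm_num)

lemma eulerProd_ne_zero {q : ℂ} (hq : q ∈ ball (0 : ℂ) 1) : eulerProd q ≠ 0 := by
  have hq' : ‖q‖ < 1 := by simpa using hq
  have h := tprod_one_add_ne_zero_of_summable (f := fun n : ℕ => -q ^ (n + 1)) ?_ ?_
  · simpa [eulerProd, sub_eq_add_neg] using h
  · intro n h0
    have h1 : ‖q ^ (n + 1)‖ = 1 := by
      rw [show q ^ (n + 1) = 1 by linear_combination -h0]; simp
    rw [norm_pow] at h1
    exact (pow_lt_one₀ (norm_nonneg _) hq' (Nat.succ_ne_zero n)).ne h1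
  · simpa using (summable_nat_add_iff 1).mpr (summable_geometric_of_lt_one (norm_nonneg _) hq')

lemma differentiableOn_eulerProd : DifferentiableOn ℂ eulerProd (ball 0 1) :=
  ModularForm.differentiableOn_tprod_one_sub_pow

lemma differentiableOn_eulerProd_cube :
    DifferentiableOn ℂ (fun q => eulerProd (q ^ 3)) (ball 0 1) :=
  differentiableOn_eulerProd.comp (by fun_prop) fun _ hq => pow_three_mem_ball hq

lemma eulerProd_zero : eulerProd 0 = 1 := by simp [eulerProd]

lemma differentiableOn_unitT : DifferentiableOn ℂ unitT (ball 0 1) :=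
  (differentiableOn_eulerProd.div differentiableOn_eulerProd_cube
    fun _ hq => eulerProd_ne_zero (pow_three_mem_ball hq)).pow 12

lemma differentiableOn_unitS : DifferentiableOn ℂ unitS (ball 0 1) :=
  (differentiableOn_eulerProd.mul differentiableOn_eulerProd_cube).pow 6

lemma unitT_ne_zero {q : ℂ} (hq : q ∈ ball (0 : ℂ) 1) : unitT q ≠ 0 :=
  pow_ne_zero _ (div_ne_zero (eulerProd_ne_zero hq) (eulerProd_ne_zero (pow_three_mem_ball hq)))

lemma unitS_ne_zero {q : ℂ} (hq : q ∈ ball (0 : ℂ) 1) : unitS q ≠ 0 :=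
  pow_ne_zero _ (mul_ne_zero (eulerProd_ne_zero hq) (eulerProd_ne_zero (pow_three_mem_ball hq)))

lemma unitT_zero : unitT 0 = 1 := by simp [unitT, eulerProd_zero]

lemma unitS_zero : unitS 0 = 1 := by simp [unitS, eulerProd_zero]

lemma haupt_ne_zero {q : ℂ} (hq : q ∈ ball (0 : ℂ) 1) (h0 : q ≠ 0) : haupt q ≠ 0 :=
  div_ne_zero (unitT_ne_zero hq) h0

lemma formS_ne_zero {q : ℂ} (hq : q ∈ ball (0 : ℂ) 1) (h0 : q ≠ 0) : formS q ≠ 0 :=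
  mul_ne_zero h0 (unitS_ne_zero hq)

lemma differentiableOn_jNum : DifferentiableOn ℂ jNum (ball 0 1) := by
  unfold jNum
  exact (differentiableOn_unitT.add (by fun_prop)).add
    ((by fun_prop : DifferentiableOn ℂ (fun q : ℂ => 729 * q ^ 2) (ball 0 1)).div
      differentiableOn_unitT fun _ hq => unitT_ne_zero hq)

lemma jNum_zero : jNum 0 = 1 := by simp [jNum, unitT_zero]

lemma jInv_eq {q : ℂ} (hq : q ∈ ball (0 : ℂ) 1) (h0 : q ≠ 0) : jInv q = jNum q / q := by
  have := unitT_ne_zero hq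
  unfold jInv jNum haupt
  field_simp

lemma differentiableOn_deriv {f : ℂ → ℂ} (hf : DifferentiableOn ℂ f (ball 0 1)) :
    DifferentiableOn ℂ (deriv f) (ball 0 1) := hf.deriv isOpen_ball

lemma differentiableOn_formA : DifferentiableOn ℂ formA (ball 0 1) := by
  unfold formA
  exact (differentiableOn_const _).sub (differentiableOn_id.mul
    ((differentiableOn_deriv differentiableOn_unitT).div differentiableOn_unitT
      fun _ hq => unitT_ne_zero hq))

lemma differentiableOn_quasiE : DifferentiableOn ℂ quasiE (ball 0 1) := by
  unfold quasiE
  exact (differentiableOn_const _).add (differentiableOn_id.mul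
    ((differentiableOn_deriv differentiableOn_unitS).div differentiableOn_unitS
      fun _ hq => unitS_ne_zero hq))

lemma differentiableOn_formD : DifferentiableOn ℂ formD (ball 0 1) := by
  unfold formD
  exact (differentiableOn_formA.mul differentiableOn_quasiE).sub
    ((by fun_prop : DifferentiableOn ℂ (fun q : ℂ => 3 * q) (ball 0 1)).mul
      (differentiableOn_deriv differentiableOn_formA))

lemma differentiableOn_formS : DifferentiableOn ℂ formS (ball 0 1) :=
  differentiableOn_id.mul differentiableOn_unitS

lemma formA_zero : formA 0 = 1 := by simp [formA]

lemma formD_zero : formD 0 = 1 := by simp [formD, formA_zero, quasiE]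

lemma hasDerivAt_of_ball {f : ℂ → ℂ} (hf : DifferentiableOn ℂ f (ball 0 1)) {q : ℂ}
    (hq : q ∈ ball (0 : ℂ) 1) : HasDerivAt f (deriv f q) q :=
  (hf.differentiableAt (isOpen_ball.mem_nhds hq)).hasDerivAt

lemma hasDerivAt_haupt {q : ℂ} (hq : q ∈ ball (0 : ℂ) 1) (h0 : q ≠ 0) :
    HasDerivAt haupt (-(formA q * haupt q) / q) q := by
  have := (hasDerivAt_of_ball differentiableOn_unitT hq).div (hasDerivAt_id q) h0
  refine this.congr_deriv ?_
  have h1 := unitT_ne_zero hq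
  simp only [formA, haupt, logDeriv_apply, id]
  field_simp; ring

lemma hasDerivAt_formS {q : ℂ} (hq : q ∈ ball (0 : ℂ) 1) :
    HasDerivAt formS (quasiE q * unitS q) q := by
  have := (hasDerivAt_id q).mul (hasDerivAt_of_ball differentiableOn_unitS hq)
  refine this.congr_deriv ?_
  have h1 := unitS_ne_zero hq
  simp only [quasiE, logDeriv_apply, id]
  field_simp

/-- With `A D = (t - 729/t) S` this reads `q dj/dq = -A² D / S`, the identity that later recognizes
a weight two form as an exact differential. -/
lemma hasDerivAt_jInv {q : ℂ} (hq : q ∈ ball (0 : ℂ) 1) (h0 : q ≠ 0) :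
    HasDerivAt jInv (-(formA q * (haupt q - 729 / haupt q)) / q) q := by
  have ht := haupt_ne_zero hq h0
  have h := hasDerivAt_haupt hq h0
  have := (h.add_const 54).add ((hasDerivAt_const q (729 : ℂ)).fun_div h ht)
  refine this.congr_deriv ?_
  field_simp; ring

/-! ### Behaviour under the Fricke involution -/

lemma eulerProd_nome (τ : ℂ) : ∏' n, (1 - ModularForm.eta_q n τ) = eulerProd (nome τ) := by
  simp [eulerProd, ModularForm.eta_q_eq_pow, nome]

lemma eta_eq (τ : ℂ) :
    ModularForm.eta τ = cexp (2 * Real.pi * I * τ / 24) * eulerProd (nome τ) := by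
  rw [ModularForm.eta, eulerProd_nome]
  simp [Function.Periodic.qParam]

lemma haupt_nome {τ : ℂ} (h : 0 < τ.im) :
    haupt (nome τ) = (ModularForm.eta τ / ModularForm.eta (3 * τ)) ^ 12 := by
  have h1 := eulerProd_ne_zero (nome_mem_ball h)
  have h2 := eulerProd_ne_zero (pow_three_mem_ball (nome_mem_ball h))
  rw [eta_eq, eta_eq, nome_three_mul, haupt, unitT, mul_div_mul_comm, mul_pow,
    div_eq_mul_inv _ (nome τ), mul_comm]
  congr 1
  rw [← Complex.exp_sub, nome, ← Complex.exp_neg, ← Complex.exp_nat_mul]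
  congr 1; push_cast; ring

lemma formS_nome (τ : ℂ) :
    formS (nome τ) = (ModularForm.eta τ * ModularForm.eta (3 * τ)) ^ 6 := by
  rw [eta_eq, eta_eq, nome_three_mul, formS, unitS, mul_mul_mul_comm, mul_pow (_ * _) (_ * _) 6]
  congr 1
  rw [← Complex.exp_add, ← Complex.exp_nat_mul, nome]
  congr 1; push_cast; ring

lemma sqrt_sq (z : ℂ) : Complex.sqrt z ^ 2 = z := by
  rw [Complex.sqrt, ← cpow_nat_inv_pow z (two_ne_zero)]; simp

lemma eta_neg_one_div {τ : ℂ} (h : 0 < τ.im) :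
    ModularForm.eta (-1 / τ) = (Complex.sqrt I)⁻¹ * (Complex.sqrt τ * ModularForm.eta τ) := by
  simpa using ModularForm.eta_comp_eq_csqrt_I_inv (x := τ) h

lemma three_mul_im_pos {τ : ℂ} (h : 0 < τ.im) : 0 < (3 * τ).im := by simpa using h

lemma eta_fricke {τ : ℂ} (h : 0 < τ.im) : ModularForm.eta (fricke τ) =
    (Complex.sqrt I)⁻¹ * (Complex.sqrt (3 * τ) * ModularForm.eta (3 * τ)) :=
  eta_neg_one_div (three_mul_im_pos h)

lemma eta_three_mul_fricke {τ : ℂ} (h : 0 < τ.im) : ModularForm.eta (3 * fricke τ) =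
    (Complex.sqrt I)⁻¹ * (Complex.sqrt τ * ModularForm.eta τ) := by
  rw [← eta_neg_one_div h, fricke]
  have := ne_zero_of_im_pos h
  congr 1; field_simp

/-- The inversion formula of `η` exchanges `η(τ)` and `η(3τ)`; the constant `729 = 3⁶` is
`(√(3τ)/√τ)^12`. -/
lemma haupt_fricke {τ : ℂ} (h : 0 < τ.im) :
    haupt (nome (fricke τ)) = 729 / haupt (nome τ) := by
  have h0 := ne_zero_of_im_pos h
  have e1 : ModularForm.eta τ ≠ 0 := ModularForm.eta_ne_zero h
  have e2 : ModularForm.eta (3 * τ) ≠ 0 := ModularForm.eta_ne_zero (three_mul_im_pos h)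
  rw [haupt_nome h, haupt_nome (fricke_im_pos h), eta_fricke h, eta_three_mul_fricke h]
  have a1 : Complex.sqrt (3 * τ) ^ 12 = (3 * τ) ^ 6 := by
    rw [show 12 = 2 * 6 by norm_num, pow_mul, sqrt_sq]
  have a2 : Complex.sqrt τ ^ 12 = τ ^ 6 := by rw [show 12 = 2 * 6 by norm_num, pow_mul, sqrt_sq]
  have a3 : Complex.sqrt I ≠ 0 := fun h => by
    have := sqrt_sq I; rw [h] at this; simp at this; exact I_ne_zero this.symm
  have a4 : Complex.sqrt τ ≠ 0 := fun h => by
    have := sqrt_sq τ; rw [h] at this; exact h0 (by simpa using this.symm)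
  simp only [div_pow, mul_pow, a1, a2]
  field_simp; ring

/-- The twelve factors `(√i)⁻¹` multiply to `-1`, so relative to `(√3 τ)⁶` the form `S` is
anti-invariant. The same sign occurs for `A` and `D`, whence the parity conditions further on. -/
lemma formS_fricke {τ : ℂ} (h : 0 < τ.im) :
    formS (nome (fricke τ)) = -27 * τ ^ 6 * formS (nome τ) := by
  rw [formS_nome, formS_nome, eta_fricke h, eta_three_mul_fricke h]
  have a1 : Complex.sqrt (3 * τ) ^ 6 = (3 * τ) ^ 3 := by
    rw [show 6 = 2 * 3 by norm_num, pow_mul, sqrt_sq]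
  have a2 : Complex.sqrt τ ^ 6 = τ ^ 3 := by rw [show 6 = 2 * 3 by norm_num, pow_mul, sqrt_sq]
  have a3 : (Complex.sqrt I)⁻¹ ^ 6 * (Complex.sqrt I)⁻¹ ^ 6 = -1 := by
    rw [← pow_add, inv_pow, show 6 + 6 = 2 * 6 by norm_num, pow_mul, sqrt_sq]
    rw [show I ^ 6 = I ^ 4 * I ^ 2 by ring]; simp
  simp only [mul_pow, a1, a2]
  linear_combination (3 ^ 3 * τ ^ 6 * ModularForm.eta (3 * τ) ^ 6 * ModularForm.eta τ ^ 6) * a3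

lemma jInv_fricke {τ : ℂ} (h : 0 < τ.im) : jInv (nome (fricke τ)) = jInv (nome τ) := by
  have := haupt_ne_zero (nome_mem_ball h) (nome_ne_zero τ)
  rw [jInv, haupt_fricke h, jInv]
  field_simp; ring

lemma eventually_im_pos {τ : ℂ} (h : 0 < τ.im) : ∀ᶠ w in nhds τ, 0 < w.im :=
  (isOpen_lt continuous_const continuous_im).mem_nhds h

lemma hasDerivAt_comp_nome {f : ℂ → ℂ} {f' τ : ℂ} (hf : HasDerivAt f f' (nome τ)) :
    HasDerivAt (fun w => f (nome w)) (f' * (2 * Real.pi * I * nome τ)) τ :=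
  hf.comp τ (hasDerivAt_nome τ)

lemma hasDerivAt_comp_nome_fricke {f : ℂ → ℂ} {f' τ : ℂ} (h : 0 < τ.im)
    (hf : HasDerivAt f f' (nome (fricke τ))) :
    HasDerivAt (fun w => f (nome (fricke w)))
      (f' * (2 * Real.pi * I * nome (fricke τ)) * (1 / (3 * τ ^ 2))) τ :=
  (hasDerivAt_comp_nome hf).comp τ (hasDerivAt_fricke (ne_zero_of_im_pos h))

lemma two_pi_I_ne_zero' : (2 * Real.pi * I : ℂ) ≠ 0 := by simp [Real.pi_ne_zero]

/-- Logarithmic derivative of `t ∘ W = 729 / t`. -/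
lemma formA_fricke {τ : ℂ} (h : 0 < τ.im) :
    formA (nome (fricke τ)) = -3 * τ ^ 2 * formA (nome τ) := by
  have h0 := ne_zero_of_im_pos h
  have hW := fricke_im_pos h
  have ht := haupt_ne_zero (nome_mem_ball h) (nome_ne_zero τ)
  have htW := haupt_ne_zero (nome_mem_ball hW) (nome_ne_zero (fricke τ))
  have d1 := hasDerivAt_comp_nome_fricke h (hasDerivAt_haupt (nome_mem_ball hW) (nome_ne_zero _))
  have d2 := (hasDerivAt_const τ (729 : ℂ)).fun_div
    (hasDerivAt_comp_nome (hasDerivAt_haupt (nome_mem_ball h) (nome_ne_zero _))) ht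
  have d3 := d2.congr_of_eventuallyEq (f₁ := fun w => haupt (nome (fricke w)))
    ((eventually_im_pos h).mono fun w hw => haupt_fricke hw)
  have key := d1.unique d3
  rw [haupt_fricke h] at key
  have n1 := nome_ne_zero τ
  have n2 := nome_ne_zero (fricke τ)
  have n3 := two_pi_I_ne_zero'
  have hpi : (Real.pi : ℂ) ≠ 0 := by exact_mod_cast Real.pi_ne_zero
  have hI := I_ne_zero
  have hk : (1458 * Real.pi * I : ℂ) ≠ 0 := by simp [Real.pi_ne_zero]
  field_simp at key
  apply mul_left_cancel₀ hk
  linear_combination -key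

/-- Logarithmic derivative of the transformation law of `S`; the automorphy factor `τ⁶` is
responsible for the anomaly `18 τ`. -/
lemma quasiE_fricke {τ : ℂ} (h : 0 < τ.im) : 2 * Real.pi * I * quasiE (nome (fricke τ)) =
    2 * Real.pi * I * (3 * τ ^ 2 * quasiE (nome τ)) + 18 * τ := by
  have h0 := ne_zero_of_im_pos h
  have hW := fricke_im_pos h
  have d1 := hasDerivAt_comp_nome_fricke h (hasDerivAt_formS (nome_mem_ball hW))
  have d2 := ((((hasDerivAt_id τ).fun_pow 6).const_mul (-27 : ℂ)).fun_mul
    (hasDerivAt_comp_nome (hasDerivAt_formS (nome_mem_ball h))))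
  have d3 := d2.congr_of_eventuallyEq (f₁ := fun w => formS (nome (fricke w)))
    ((eventually_im_pos h).mono fun w hw => formS_fricke hw)
  have key := d1.unique d3
  have hS := formS_fricke h
  have n0 := unitS_ne_zero (nome_mem_ball h)
  have n1 := nome_ne_zero τ
  simp only [formS, id] at key hS
  have e : quasiE (nome (fricke τ)) * unitS (nome (fricke τ)) *
      (2 * Real.pi * I * nome (fricke τ)) * (1 / (3 * τ ^ 2)) =
      quasiE (nome (fricke τ)) * (-27 * τ ^ 6 * (nome τ * unitS (nome τ))) * (2 * Real.pi * I) *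
        (1 / (3 * τ ^ 2)) := by
    rw [← hS]; ring
  rw [e] at key
  field_simp at key
  push_cast at key
  apply mul_left_cancel₀ (pow_ne_zero 4 h0)
  linear_combination (-1) * key

lemma deriv_formA_fricke {τ : ℂ} (h : 0 < τ.im) :
    2 * Real.pi * I * (nome (fricke τ) * deriv formA (nome (fricke τ))) =
    2 * Real.pi * I * (-9 * τ ^ 4 * (nome τ * deriv formA (nome τ))) - 18 * τ ^ 3 * formA (nome τ) := by
  have h0 := ne_zero_of_im_pos h
  have hW := fricke_im_pos h
  have d1 := hasDerivAt_comp_nome_fricke h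
    (hasDerivAt_of_ball differentiableOn_formA (nome_mem_ball hW))
  have d2 := ((((hasDerivAt_id τ).fun_pow 2).const_mul (-3 : ℂ)).fun_mul
    (hasDerivAt_comp_nome (hasDerivAt_of_ball differentiableOn_formA (nome_mem_ball h))))
  have d3 := d2.congr_of_eventuallyEq (f₁ := fun w => formA (nome (fricke w)))
    ((eventually_im_pos h).mono fun w hw => formA_fricke hw)
  have key := d1.unique d3
  simp only [id] at key
  field_simp at key
  push_cast at key
  linear_combination key

/-- The coefficient `3` in the definition of `D` is the one for which the anomalies of `E` and of
the derivative of `A` cancel. -/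
lemma formD_fricke {τ : ℂ} (h : 0 < τ.im) :
    formD (nome (fricke τ)) = -9 * τ ^ 4 * formD (nome τ) := by
  have h1 := formA_fricke h
  have h2 := quasiE_fricke h
  have h3 := deriv_formA_fricke h
  apply mul_left_cancel₀ two_pi_I_ne_zero'
  simp only [formD, h1]
  linear_combination (-3 * τ ^ 2 * formA (nome τ)) * h2 - 3 * h3

/-! ### Orbits of the group generated by `τ ↦ τ + 1` and `τ ↦ -1/(3τ)` -/

/-- The orbit of `z` under the group generated by the unit translation and the Fricke involution. -/
inductive Orb (z : ℂ) : ℂ → Prop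
  | refl : Orb z z
  | add_one {τ : ℂ} : Orb z τ → Orb z (τ + 1)
  | sub_one {τ : ℂ} : Orb z τ → Orb z (τ - 1)
  | fricke {τ : ℂ} : Orb z τ → Orb z (FrickeThree.fricke τ)

lemma Orb.im_pos {z τ : ℂ} (hz : 0 < z.im) (h : Orb z τ) : 0 < τ.im := by
  induction h with
  | refl => exact hz
  | add_one _ ih => simpa using ih
  | sub_one _ ih => simpa using ih
  | fricke _ ih => exact fricke_im_pos ih

lemma Orb.trans {z τ w : ℂ} (h : Orb z τ) (h' : Orb τ w) : Orb z w := by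
  induction h' with
  | refl => exact h
  | add_one _ ih => exact ih.add_one
  | sub_one _ ih => exact ih.sub_one
  | fricke _ ih => exact ih.fricke

lemma Orb.symm {z τ : ℂ} (hz : 0 < z.im) (h : Orb z τ) : Orb τ z := by
  induction h with
  | refl => exact .refl
  | @add_one τ _ ih =>
    refine Orb.trans ?_ ih
    simpa using (Orb.refl (z := τ + 1)).sub_one
  | @sub_one τ _ ih =>
    refine Orb.trans ?_ ih
    simpa using (Orb.refl (z := τ - 1)).add_one
  | @fricke τ h ih =>
    refine Orb.trans ?_ ih
    simpa [fricke_fricke (ne_zero_of_im_pos (h.im_pos hz))] using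
      (Orb.refl (z := FrickeThree.fricke τ)).fricke

lemma Orb.add_int {z τ : ℂ} (h : Orb z τ) (n : ℤ) : Orb z (τ + n) := by
  induction n using Int.induction_on with
  | zero => simpa using h
  | succ n ih => push_cast at ih ⊢; simpa [add_assoc] using ih.add_one
  | pred n ih => push_cast at ih ⊢; simpa [add_sub_assoc] using ih.sub_one

lemma Orb.apply_eq {α : Type*} {g : ℂ → α} (h1 : ∀ τ, 0 < τ.im → g (τ + 1) = g τ)
    (hW : ∀ τ, 0 < τ.im → g (FrickeThree.fricke τ) = g τ) {z τ : ℂ} (hz : 0 < z.im)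
    (h : Orb z τ) : g τ = g z := by
  induction h with
  | refl => rfl
  | add_one h ih => rw [h1 _ (h.im_pos hz), ih]
  | @sub_one τ h ih =>
    have := h1 (τ - 1) (by simpa using h.im_pos hz)
    rw [← this, sub_add_cancel, ih]
  | fricke h ih => rw [hW _ (h.im_pos hz), ih]

lemma Orb.jInv_eq {z τ : ℂ} (hz : 0 < z.im) (h : Orb z τ) : jInv (nome τ) = jInv (nome z) :=
  h.apply_eq (g := fun τ => jInv (nome τ)) (fun τ _ => by rw [nome_add_one])
    (fun _ h => jInv_fricke h) hz

lemma linear_ne_zero {z : ℂ} (hz : 0 < z.im) {c d : ℝ} (h : c ≠ 0 ∨ d ≠ 0) :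
    (c : ℂ) * z + d ≠ 0 := by
  intro h0
  have h1 := congrArg im h0
  have h2 := congrArg re h0
  simp at h1 h2
  rcases h1 with h1 | h1
  · subst h1; simp at h2; simp [h2] at h
  · exact hz.ne' h1

lemma im_mul_normSq {z τ : ℂ} {a b c d : ℝ} (h : τ * ((c : ℂ) * z + d) = (a : ℂ) * z + b) :
    τ.im * normSq ((c : ℂ) * z + d) = (a * d - b * c) * z.im := by
  have h1 : τ * (normSq ((c : ℂ) * z + d) : ℂ) =
      ((a : ℂ) * z + b) * (starRingEnd ℂ) ((c : ℂ) * z + d) := by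
    rw [← mul_conj, ← mul_assoc, h]
  have h2 := congrArg im h1
  rw [im_mul_ofReal] at h2
  rw [h2]
  simp
  ring

/-- Elements of the orbit are images of `z` under matrices of `Γ₀⁺(3)`. -/
lemma Orb.exists_matrix {z τ : ℂ} (hz : 0 < z.im) (h : Orb z τ) : ∃ a b c d : ℤ,
    (a * d - 3 * b * c = 1 ∧ τ * (3 * c * z + d) = a * z + b) ∨
    (3 * a * d - b * c = 1 ∧ τ * (3 * (c * z + d)) = 3 * a * z + b) := by
  induction h with
  | refl => exact ⟨1, 0, 0, 1, by simp⟩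
  | add_one _ ih =>
    obtain ⟨a, b, c, d, ⟨h1, h2⟩ | ⟨h1, h2⟩⟩ := ih
    · exact ⟨a + 3 * c, b + d, c, d, .inl ⟨by linear_combination h1,
        by push_cast; linear_combination h2⟩⟩
    · exact ⟨a + c, b + 3 * d, c, d, .inr ⟨by linear_combination h1,
        by push_cast; linear_combination h2⟩⟩
  | sub_one _ ih =>
    obtain ⟨a, b, c, d, ⟨h1, h2⟩ | ⟨h1, h2⟩⟩ := ih
    · exact ⟨a - 3 * c, b - d, c, d, .inl ⟨by linear_combination h1,
        by push_cast; linear_combination h2⟩⟩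
    · exact ⟨a - c, b - 3 * d, c, d, .inr ⟨by linear_combination h1,
        by push_cast; linear_combination h2⟩⟩
  | @fricke τ h ih =>
    have h0 := ne_zero_of_im_pos (h.im_pos hz)
    obtain ⟨a, b, c, d, ⟨h1, h2⟩ | ⟨h1, h2⟩⟩ := ih
    · refine ⟨-c, -d, a, b, .inr ⟨by linear_combination h1, ?_⟩⟩
      push_cast
      rw [← h2, FrickeThree.fricke]
      field_simp; ring
    · refine ⟨-c, -d, a, b, .inl ⟨by linear_combination h1, ?_⟩⟩
      push_cast
      rw [← h2, FrickeThree.fricke]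
      field_simp; ring

/-- The factor by which an element of the orbit with lower row `(p 0, p 1)` decreases heights. -/
def heightFactor (z : ℂ) (p : Fin 2 → ℤ) : ℝ :=
  normSq ((p 0 : ℂ) * z + p 1) * if (3 : ℤ) ∣ p 0 then 1 else 3

lemma Orb.exists_heightFactor {z τ : ℂ} (hz : 0 < z.im) (h : Orb z τ) :
    ∃ p : Fin 2 → ℤ, τ.im * heightFactor z p = z.im := by
  obtain ⟨a, b, c, d, ⟨h1, h2⟩ | ⟨h1, h2⟩⟩ := h.exists_matrix hz
  · refine ⟨![3 * c, d], ?_⟩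
    have := im_mul_normSq (z := z) (τ := τ) (a := a) (b := b) (c := 3 * c) (d := d)
      (by push_cast; exact h2)
    push_cast at this
    have h1' : (a * d - b * (3 * c) : ℝ) = 1 := by
      have : ((a * d - 3 * b * c : ℤ) : ℝ) = 1 := by rw [h1]; simp
      push_cast at this; linarith
    simp [heightFactor, this, h1']
  · refine ⟨![c, d], ?_⟩
    have := im_mul_normSq (z := z) (τ := 3 * τ) (a := 3 * a) (b := b) (c := c) (d := d)
      (by push_cast; rw [← h2]; ring)
    have h1' : (3 * a * d - b * c : ℝ) = 1 := by exact_mod_cast h1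
    rw [h1'] at this
    have h3 : ¬ (3 : ℤ) ∣ c := by
      rintro ⟨e, rfl⟩
      have h4 : 3 * (a * d - b * e) = 1 := by linear_combination h1
      omega
    simp [heightFactor, h3]
    simp at this
    linarith

/-- Only finitely many lower rows have height factor below a given bound, so every orbit contains a
point of maximal height. -/
lemma tendsto_heightFactor {z : ℂ} (hz : 0 < z.im) :
    Filter.Tendsto (heightFactor z) Filter.cofinite Filter.atTop := by
  refine Filter.tendsto_atTop_mono (fun p => ?_) (ModularGroup.tendsto_normSq_coprime_pair ⟨z, hz⟩)
  have := normSq_nonneg ((p 0 : ℂ) * z + p 1)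
  simp only [heightFactor]
  split_ifs
  · simp
  · simp; linarith

/-- Every point of the upper half plane can be moved to the fundamental domain. -/
lemma exists_orb_mem_fd {z : ℂ} (hz : 0 < z.im) :
    ∃ τ, Orb z τ ∧ |τ.re| ≤ 1 / 2 ∧ 1 ≤ 3 * normSq τ := by
  let s : Set (Fin 2 → ℤ) := {p | ∃ τ, Orb z τ ∧ τ.im * heightFactor z p = z.im}
  obtain ⟨p₀, hp₀⟩ := (Orb.refl (z := z)).exists_heightFactor hz
  obtain ⟨p, ⟨τ, hτ, hp⟩, hmin⟩ :=
    Filter.Tendsto.exists_within_forall_le (s := s) ⟨p₀, z, .refl, hp₀⟩ (tendsto_heightFactor hz)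
  have hpos : 0 < heightFactor z p := by
    have := hτ.im_pos hz
    by_contra h
    nlinarith [mul_nonneg this.le (neg_nonneg.2 (not_lt.1 h))]
  have hmax : ∀ w, Orb z w → w.im ≤ τ.im := by
    intro w hw
    obtain ⟨p', hp'⟩ := hw.exists_heightFactor hz
    have h1 := hmin p' ⟨w, hw, hp'⟩
    have h2 := hw.im_pos hz
    by_contra hc
    push Not at hc
    nlinarith [mul_lt_mul_of_pos_right hc hpos, mul_le_mul_of_nonneg_left h1 h2.le]
  refine ⟨τ + ((-round τ.re : ℤ) : ℂ), hτ.add_int _, ?_, ?_⟩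
  · have := abs_sub_round τ.re
    simpa [sub_eq_add_neg] using this
  · have h1 := hτ.add_int (-round τ.re)
    have h2 := h1.im_pos hz
    -- Maximality of the height, tested against the Fricke image, forces `3|τ|² ≥ 1`; the
    -- translation has already brought the real part into range.
    have h3 := hmax _ h1.fricke
    rw [fricke_im] at h3
    have h4 := normSq_pos_of_im_pos h2
    have h5 : (τ + ((-round τ.re : ℤ) : ℂ)).im = τ.im := by simp
    rw [div_le_iff₀ (by positivity), h5] at h3
    rw [h5] at h2
    nlinarith

lemma im_ge_of_mem_fd {τ : ℂ} (h : 0 < τ.im) (h1 : |τ.re| ≤ 1 / 2) (h2 : 1 ≤ 3 * normSq τ) :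
    √3 / 6 ≤ τ.im := by
  rw [normSq_apply] at h2
  have h3 : τ.re * τ.re ≤ 1 / 4 := by nlinarith [abs_le.1 h1]
  have h4 : √3 ^ 2 = 3 := Real.sq_sqrt (by norm_num)
  have h5 : 0 < √3 := by positivity
  by_contra hc
  push Not at hc
  nlinarith [mul_pos h5 h]

/-- A holomorphic function on the disc which is invariant under the Fricke involution is
constant. -/
lemma eq_const_of_fricke_invariant {g : ℂ → ℂ} (hg : DifferentiableOn ℂ g (ball 0 1))
    (hW : ∀ τ : ℂ, 0 < τ.im → g (nome (fricke τ)) = g (nome τ)) {q : ℂ} (hq : q ∈ ball (0 : ℂ) 1) :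
    g q = g 0 := by
  set R : ℝ := Real.exp (-(2 * Real.pi * (√3 / 6))) with hR
  have hR1 : R < 1 := by
    rw [hR, Real.exp_lt_one_iff]
    have := Real.pi_pos
    have : 0 < 2 * Real.pi * (√3 / 6) := by positivity
    linarith
  have hR0 : 0 < R := Real.exp_pos _
  have hsub : closedBall (0 : ℂ) R ⊆ ball 0 1 := closedBall_subset_ball hR1
  obtain ⟨p, hp, hmax⟩ := (isCompact_closedBall (0 : ℂ) R).exists_isMaxOn
    ⟨0, by simp [hR0.le]⟩ (hg.continuousOn.mono hsub).norm
  -- Each point of the punctured disc is equivalent to one with `Im τ ≥ √3/6`, hence with nome in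
  -- the closed disc of radius `R`. A maximum over that compact disc is therefore a maximum over the
  -- whole open disc.
  have key : IsMaxOn (norm ∘ g) (ball 0 1) p := by
    intro w hw
    by_cases h0 : w = 0
    · subst h0
      exact hmax (by simp [hR0.le])
    · obtain ⟨τ, hτ, rfl⟩ := exists_nome_eq h0 (by simpa using hw)
      obtain ⟨τ', ho, h1, h2⟩ := exists_orb_mem_fd hτ
      have h3 := im_ge_of_mem_fd (ho.im_pos hτ) h1 h2
      have h4 : g (nome τ') = g (nome τ) :=
        ho.apply_eq (g := fun τ => g (nome τ)) (fun τ _ => by rw [nome_add_one]) hW hτ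
      have h5 : nome τ' ∈ closedBall (0 : ℂ) R := by
        rw [mem_closedBall_zero_iff, norm_nome, hR]
        apply Real.exp_le_exp.2
        have := Real.pi_pos
        nlinarith
      have h6 : ‖g (nome τ')‖ ≤ ‖g p‖ := hmax h5
      rw [h4] at h6
      exact h6
  have hc := Complex.eqOn_of_isPreconnected_of_isMaxOn_norm (convex_ball (0 : ℂ) 1).isPreconnected
    isOpen_ball hg (hsub hp) key
  exact (hc hq).trans (hc (mem_ball_self one_pos)).symm

/-- A Fricke-invariant function with a pole of finite order at the cusp is a polynomial in the
Hauptmodul. -/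
lemma exists_polynomial_of_fricke_invariant (N : ℕ) : ∀ g : ℂ → ℂ,
    DifferentiableOn ℂ g (ball 0 1) →
    (∀ τ : ℂ, 0 < τ.im → g (nome (fricke τ)) / nome (fricke τ) ^ N = g (nome τ) / nome τ ^ N) →
    ∃ P : Polynomial ℂ, ∀ q ∈ ball (0 : ℂ) 1, q ≠ 0 → g q / q ^ N = P.eval (jInv q) := by
  induction N with
  | zero =>
    intro g hg hW
    refine ⟨Polynomial.C (g 0), fun q hq _ => ?_⟩
    simpa using eq_const_of_fricke_invariant hg (fun τ h => by simpa using hW τ h) hq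
  | succ N ih =>
    intro g hg hW
    -- Subtracting `g(0) j^{N+1}` removes the leading pole, and `dslope` divides out the factor `q`
    -- that this frees.
    set h : ℂ → ℂ := fun q => g q - g 0 * jNum q ^ (N + 1) with hh
    have hd : DifferentiableOn ℂ h (ball 0 1) :=
      hg.sub ((differentiableOn_const _).mul (differentiableOn_jNum.pow _))
    have h0 : h 0 = 0 := by simp [hh, jNum_zero]
    have hd' : DifferentiableOn ℂ (dslope h 0) (ball 0 1) :=
      (Complex.differentiableOn_dslope (isOpen_ball.mem_nhds (by simp))).2 hd
    have hs : ∀ q ∈ ball (0 : ℂ) 1, q ≠ 0 →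
        dslope h 0 q / q ^ N = g q / q ^ (N + 1) - g 0 * jInv q ^ (N + 1) := by
      intro q hq hq0
      rw [dslope_of_ne _ hq0, slope_def_field, h0, jInv_eq hq hq0, hh, div_pow]
      field_simp
      ring
    obtain ⟨P, hP⟩ := ih (dslope h 0) hd' (fun τ hτ => by
      rw [hs _ (nome_mem_ball hτ) (nome_ne_zero _),
        hs _ (nome_mem_ball (fricke_im_pos hτ)) (nome_ne_zero _), hW τ hτ, jInv_fricke hτ])
    refine ⟨P + Polynomial.C (g 0) * Polynomial.X ^ (N + 1), fun q hq hq0 => ?_⟩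
    simp [← hP q hq hq0, hs q hq hq0]

/-! ### Special points and algebraic relations -/

/-- The elliptic point `e^{5πi/6}/√3`. -/
def rho : ℂ := ⟨-1 / 2, √3 / 6⟩

/-- The elliptic point `i/√3`. -/
def iThree : ℂ := ⟨0, √3 / 3⟩

lemma sqrt_three_sq : √(3 : ℝ) ^ 2 = 3 := Real.sq_sqrt (by norm_num)

lemma rho_im_pos : 0 < rho.im := by simp [rho]

lemma iThree_im_pos : 0 < iThree.im := by simp [iThree]

lemma rho_sq : 3 * rho ^ 2 + 3 * rho + 1 = 0 := by
  have := sqrt_three_sq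
  apply Complex.ext
  · simp [rho, pow_two]; nlinarith
  · simp [rho, pow_two]; ring

lemma iThree_sq : 3 * iThree ^ 2 = -1 := by
  have := sqrt_three_sq
  apply Complex.ext
  · simp [iThree, pow_two]; nlinarith
  · simp [iThree, pow_two]

lemma fricke_rho : fricke rho = rho + 1 := by
  have h := ne_zero_of_im_pos rho_im_pos
  rw [fricke, div_eq_iff (by simpa using h)]
  linear_combination -rho_sq

lemma fricke_iThree : fricke iThree = iThree := by
  have h := ne_zero_of_im_pos iThree_im_pos
  rw [fricke, div_eq_iff (by simpa using h)]
  linear_combination -iThree_sq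

/-- `W` maps `ρ` to `ρ + 1`, which has the same nome, so the transformation law reads `A = -3ρ² A`
at `ρ`, with factor different from `1`. The zeros of `D` at `ρ` and at `i/√3` arise in the same way.
-/
lemma formA_rho : formA (nome rho) = 0 := by
  have h := formA_fricke rho_im_pos
  rw [fricke_rho, nome_add_one] at h
  have h1 : (1 + 3 * rho ^ 2) * formA (nome rho) = 0 := by linear_combination h
  have h2 : 1 + 3 * rho ^ 2 ≠ 0 := by
    rw [show 1 + 3 * rho ^ 2 = -3 * rho by linear_combination rho_sq]
    have h := ne_zero_of_im_pos rho_im_pos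
    simpa using h
  exact (mul_eq_zero.1 h1).resolve_left h2

lemma formD_rho : formD (nome rho) = 0 := by
  have h := formD_fricke rho_im_pos
  rw [fricke_rho, nome_add_one] at h
  have h1 : (1 + 9 * rho ^ 4) * formD (nome rho) = 0 := by linear_combination h
  have h2 : 1 + 9 * rho ^ 4 ≠ 0 := by
    rw [show 1 + 9 * rho ^ 4 = 3 * rho ^ 2 by
      linear_combination (3 * rho ^ 2 - 3 * rho + 1) * rho_sq]
    have h := ne_zero_of_im_pos rho_im_pos
    simpa using h
  exact (mul_eq_zero.1 h1).resolve_left h2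

lemma formD_iThree : formD (nome iThree) = 0 := by
  have h := formD_fricke iThree_im_pos
  rw [fricke_iThree] at h
  have h4 : 9 * iThree ^ 4 = 1 := by
    linear_combination (3 * iThree ^ 2 - 1) * iThree_sq
  have h5 : 2 * formD (nome iThree) = 0 := by
    linear_combination h - formD (nome iThree) * h4
  simpa using h5

/-! ### Complex conjugation -/

lemma eulerProd_conj {q : ℂ} (hq : q ∈ ball (0 : ℂ) 1) :
    eulerProd ((starRingEnd ℂ) q) = (starRingEnd ℂ) (eulerProd q) := by
  rw [eulerProd, eulerProd,
    (ModularForm.multipliable_one_sub_pow (by simpa using hq)).map_tprod (starRingEnd ℂ)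
      continuous_conj]
  simp

lemma unitT_conj {q : ℂ} (hq : q ∈ ball (0 : ℂ) 1) :
    unitT ((starRingEnd ℂ) q) = (starRingEnd ℂ) (unitT q) := by
  rw [unitT, ← map_pow, eulerProd_conj hq, eulerProd_conj (pow_three_mem_ball hq), unitT, map_pow,
    map_div₀]

lemma haupt_conj {q : ℂ} (hq : q ∈ ball (0 : ℂ) 1) :
    haupt ((starRingEnd ℂ) q) = (starRingEnd ℂ) (haupt q) := by
  simp [haupt, unitT_conj hq]

lemma nome_neg_conj (τ : ℂ) : nome (-(starRingEnd ℂ) τ) = (starRingEnd ℂ) (nome τ) := by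
  rw [nome, nome, ← exp_conj]
  simp [map_ofNat]

/-- On the real diameter of the disc, `unitT` is real and positive. -/
lemma unitT_ofReal {x : ℝ} (hx : |x| < 1) : ∃ r : ℝ, 0 < r ∧ unitT x = r := by
  have hq : (x : ℂ) ∈ ball (0 : ℂ) 1 := by simpa using hx
  have hq3 := pow_three_mem_ball hq
  have h1 := eulerProd_conj hq
  have h2 := eulerProd_conj hq3
  simp only [map_pow, conj_ofReal] at h1 h2
  obtain ⟨a, ha⟩ := conj_eq_iff_real.1 h1.symm
  obtain ⟨b, hb⟩ := conj_eq_iff_real.1 h2.symm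
  refine ⟨(a / b) ^ 12, ?_, by simp [unitT, ha, hb]⟩
  have ha0 : a ≠ 0 := fun h => eulerProd_ne_zero hq (by simp [ha, h])
  have hb0 : b ≠ 0 := fun h => eulerProd_ne_zero hq3 (by simp [hb, h])
  have : 0 < (a / b) ^ 2 := by positivity
  rw [show (12 : ℕ) = 2 * 6 by norm_num, pow_mul]
  positivity

/-- If `Re τ = ±1/2`, then the Hauptmodul of `Γ₀(3)` is negative. -/
lemma haupt_neg_of_re {τ : ℂ} (h : 0 < τ.im) (hre : |τ.re| = 1 / 2) :
    ∃ r : ℝ, r < 0 ∧ haupt (nome τ) = r := by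
  have hn : nome τ = ((-Real.exp (-(2 * Real.pi * τ.im)) : ℝ) : ℂ) := by
    have h1 : nome τ = nome (⟨1 / 2, τ.im⟩ : ℂ) := by
      rcases eq_or_eq_neg_of_abs_eq hre with h2 | h2
      · congr 1; exact Complex.ext h2 rfl
      · rw [← nome_add_one]; congr 1; apply Complex.ext
        · simp [h2]; norm_num
        · simp
    rw [h1, nome, show 2 * (Real.pi : ℂ) * I * (⟨1 / 2, τ.im⟩ : ℂ) =
      ((-(2 * Real.pi * τ.im) : ℝ) : ℂ) + Real.pi * I by
        apply Complex.ext <;> simp <;> ring, Complex.exp_add, exp_pi_mul_I]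
    push_cast; ring
  have hlt : |-Real.exp (-(2 * Real.pi * τ.im))| < 1 := by
    have := norm_nome_lt_one h
    rw [norm_nome] at this
    rwa [abs_neg, abs_of_pos (Real.exp_pos _)]
  obtain ⟨r, hr, hu⟩ := unitT_ofReal hlt
  refine ⟨r / -Real.exp (-(2 * Real.pi * τ.im)), ?_, ?_⟩
  · exact div_neg_of_pos_of_neg hr (neg_lt_zero.2 (Real.exp_pos _))
  · rw [haupt, hn, hu]; push_cast; rfl

/-- If `Re τ = ±1/2`, then the Hauptmodul of `Γ₀⁺(3)` is real and nonpositive. -/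
lemma jInv_nonpos_of_re {τ : ℂ} (h : 0 < τ.im) (hre : |τ.re| = 1 / 2) :
    ∃ r : ℝ, r ≤ 0 ∧ jInv (nome τ) = r := by
  obtain ⟨r, hr, h1⟩ := haupt_neg_of_re h hre
  refine ⟨r + 54 + 729 / r, ?_, by rw [jInv, h1]; push_cast; rfl⟩
  have : r + 54 + 729 / r = (r + 27) ^ 2 / r := by field_simp [hr.ne]; ring
  rw [this]
  exact div_nonpos_of_nonneg_of_nonpos (sq_nonneg _) hr.le

/-- On the arc the involution is the reflection in the imaginary axis, so `t(Wτ) = 729/t(τ)` becomes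
a statement about `|t|`. -/
lemma fricke_of_normSq {τ : ℂ} (h : 3 * normSq τ = 1) : fricke τ = -(starRingEnd ℂ) τ := by
  have h0 : τ ≠ 0 := fun h0 => by simp [h0] at h
  have h1 : 3 * (τ * (starRingEnd ℂ) τ) = 1 := by rw [mul_conj]; exact_mod_cast h
  rw [fricke, div_eq_iff (by simpa using h0)]
  linear_combination h1

/-- On the arc `|τ| = 1/√3` the Hauptmodul of `Γ₀(3)` has modulus `27`. -/
lemma norm_haupt_of_normSq {τ : ℂ} (h : 0 < τ.im) (h1 : 3 * normSq τ = 1) :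
    ‖haupt (nome τ)‖ = 27 := by
  have h2 := haupt_fricke h
  rw [fricke_of_normSq h1, nome_neg_conj, haupt_conj (nome_mem_ball h)] at h2
  have h3 := haupt_ne_zero (nome_mem_ball h) (nome_ne_zero τ)
  rw [eq_div_iff h3, mul_comm, mul_conj, normSq_eq_norm_sq] at h2
  have h4 : ‖haupt (nome τ)‖ ^ 2 = 27 ^ 2 := by norm_num; exact_mod_cast h2
  exact (pow_left_inj₀ (norm_nonneg _) (by norm_num) two_ne_zero).1 h4

lemma rho_normSq : 3 * normSq rho = 1 := by
  have := sqrt_three_sq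
  simp [rho, normSq_apply]; nlinarith

lemma iThree_normSq : 3 * normSq iThree = 1 := by
  have := sqrt_three_sq
  simp [iThree, normSq_apply]; nlinarith

/-- `ρ` lies both on `Re τ = -1/2`, where `t < 0`, and on the arc, where `|t| = 27`. For `i/√3` the
imaginary axis plays the role of the line, with `t > 0`. -/
lemma haupt_rho : haupt (nome rho) = -27 := by
  obtain ⟨r, hr, h⟩ := haupt_neg_of_re rho_im_pos (by norm_num [rho, abs_of_neg])
  have h1 := norm_haupt_of_normSq rho_im_pos rho_normSq
  rw [h, norm_real, Real.norm_eq_abs, abs_of_neg hr] at h1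
  rw [h, show r = -27 by linarith]; norm_num

lemma jInv_rho : jInv (nome rho) = 0 := by rw [jInv, haupt_rho]; norm_num

lemma haupt_iThree : haupt (nome iThree) = 27 := by
  have hn : nome iThree = ((Real.exp (-(2 * Real.pi * (√3 / 3))) : ℝ) : ℂ) := by
    rw [nome, ofReal_exp]; congr 1
    apply Complex.ext <;> simp [iThree]
  have hlt : |Real.exp (-(2 * Real.pi * (√3 / 3)))| < 1 := by
    have := norm_nome_lt_one iThree_im_pos
    rw [hn, norm_real] at this; exact this
  obtain ⟨r, hr, hu⟩ := unitT_ofReal hlt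
  have h1 := norm_haupt_of_normSq iThree_im_pos iThree_normSq
  have hpos : 0 < r / Real.exp (-(2 * Real.pi * (√3 / 3))) := div_pos hr (Real.exp_pos _)
  have h2 : haupt (nome iThree) = ((r / Real.exp (-(2 * Real.pi * (√3 / 3))) : ℝ) : ℂ) := by
    rw [haupt, hn, hu]; push_cast; rfl
  rw [h2, norm_real, Real.norm_eq_abs, abs_of_pos hpos] at h1
  rw [h2, h1]; norm_num

lemma jInv_iThree : jInv (nome iThree) = 108 := by rw [jInv, haupt_iThree]; norm_num

/-! ### Relations between the forms -/

lemma jInv_mul_sub {q : ℂ} (hq : q ∈ ball (0 : ℂ) 1) (h0 : q ≠ 0) :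
    jInv q * (jInv q - 108) = (haupt q - 729 / haupt q) ^ 2 := by
  have := haupt_ne_zero hq h0
  rw [jInv]; field_simp; ring

/-- `A³/S - j` is invariant under `W`, and its pole at the cusp cancels since both terms begin with
`1/q`. It is therefore constant, and both terms vanish at `ρ`. -/
lemma jNum_mul_unitS {q : ℂ} (hq : q ∈ ball (0 : ℂ) 1) : jNum q * unitS q = formA q ^ 3 := by
  set g : ℂ → ℂ := fun q => formA q ^ 3 / unitS q - jNum q with hg
  have hd : DifferentiableOn ℂ g (ball 0 1) :=
    ((differentiableOn_formA.pow 3).div differentiableOn_unitS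
      fun _ hq => unitS_ne_zero hq).sub differentiableOn_jNum
  have hval : ∀ τ : ℂ, 0 < τ.im →
      g (nome τ) / nome τ = formA (nome τ) ^ 3 / formS (nome τ) - jInv (nome τ) := by
    intro τ h
    have h1 := unitS_ne_zero (nome_mem_ball h)
    have h2 := nome_ne_zero τ
    rw [hg, jInv_eq (nome_mem_ball h) h2, formS]
    field_simp
  have hW : ∀ τ : ℂ, 0 < τ.im → g (nome (fricke τ)) / nome (fricke τ) = g (nome τ) / nome τ := by
    intro τ h
    have h1 := formS_ne_zero (nome_mem_ball h) (nome_ne_zero τ)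
    have h2 := ne_zero_of_im_pos h
    rw [hval τ h, hval _ (fricke_im_pos h), jInv_fricke h, formA_fricke h, formS_fricke h]
    field_simp; ring
  have hd0 : DifferentiableOn ℂ (dslope g 0) (ball 0 1) :=
    (Complex.differentiableOn_dslope (isOpen_ball.mem_nhds (by simp))).2 hd
  have hg0 : g 0 = 0 := by simp [hg, formA_zero, unitS_zero, jNum_zero]
  have hs : ∀ q : ℂ, q ≠ 0 → dslope g 0 q = g q / q := by
    intro q h0
    rw [dslope_of_ne _ h0, slope_def_field, hg0]; simp
  have hc := fun {q : ℂ} (hq : q ∈ ball (0 : ℂ) 1) =>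
    eq_const_of_fricke_invariant (q := q) hd0 (fun τ h => by
      rw [hs _ (nome_ne_zero _), hs _ (nome_ne_zero _), hW τ h]) hq
  have hr := hc (nome_mem_ball rho_im_pos)
  rw [hs _ (nome_ne_zero _), hval _ rho_im_pos, formA_rho, jInv_rho] at hr
  have hz : g q = 0 := by
    by_cases h0 : q = 0
    · rw [h0, hg0]
    · have := hc hq
      rw [← hr, hs _ h0] at this
      simpa [h0] using this
  have h1 := unitS_ne_zero hq
  have h2 : formA q ^ 3 / unitS q = jNum q := by linear_combination hz
  rw [← h2]; field_simp

lemma formA_pow_three {q : ℂ} (hq : q ∈ ball (0 : ℂ) 1) (h0 : q ≠ 0) :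
    formA q ^ 3 = jInv q * formS q := by
  rw [← jNum_mul_unitS hq, jInv_eq hq h0, formS]; field_simp

/-- Differentiating `A³ = jS` gives the identity multiplied by `A`. Since `A(0) = 1`, the factor can
be cancelled near `q = 0`, and the identity theorem does the rest. -/
lemma formA_mul_formD {q : ℂ} (hq : q ∈ ball (0 : ℂ) 1) (h0 : q ≠ 0) :
    formA q * formD q = (haupt q - 729 / haupt q) * formS q := by
  set g : ℂ → ℂ := fun q => formA q * formD q - (unitT q - 729 * q ^ 2 / unitT q) * unitS q with hg
  have hd : DifferentiableOn ℂ g (ball 0 1) :=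
    (differentiableOn_formA.mul differentiableOn_formD).sub ((differentiableOn_unitT.sub
      ((by fun_prop : DifferentiableOn ℂ (fun q : ℂ => 729 * q ^ 2) (ball 0 1)).div
      differentiableOn_unitT fun _ hq => unitT_ne_zero hq)).mul differentiableOn_unitS)
  have hgq : ∀ q : ℂ, q ∈ ball (0 : ℂ) 1 → q ≠ 0 →
      g q = formA q * formD q - (haupt q - 729 / haupt q) * formS q := by
    intro q hq h0
    have := unitT_ne_zero hq
    rw [hg, haupt, formS]; field_simp
  have key : ∀ q : ℂ, q ∈ ball (0 : ℂ) 1 → formA q * g q = 0 := by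
    intro q hq
    by_cases h0 : q = 0
    · subst h0; simp [hg, formA_zero, formD_zero, unitT_zero, unitS_zero]
    have d1 := (hasDerivAt_of_ball differentiableOn_formA hq).fun_pow 3
    have d2 := (hasDerivAt_jInv hq h0).fun_mul (hasDerivAt_formS hq)
    have d3 := d2.congr_of_eventuallyEq (f₁ := fun q => formA q ^ 3) (by
      filter_upwards [isOpen_ball.mem_nhds hq, isOpen_ne.mem_nhds h0] with w hw hw0
      exact formA_pow_three hw hw0)
    have h1 := d1.unique d3
    have h2 := formA_pow_three hq h0
    rw [hgq q hq h0, formD]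
    have h3 : 3 * formA q ^ 2 * (q * deriv formA q) =
      -(formA q * (haupt q - 729 / haupt q)) * formS q + jInv q * formS q * quasiE q := by
      have : 3 * formA q ^ 2 * (q * deriv formA q) =
        q * (-(formA q * (haupt q - 729 / haupt q)) / q * formS q +
          jInv q * (quasiE q * unitS q)) := by
        rw [← h1]; push_cast; ring
      rw [this, formS]; field_simp
    rw [← h2] at h3
    linear_combination -h3
  have han : AnalyticOnNhd ℂ g (ball 0 1) := hd.analyticOnNhd isOpen_ball
  have hz : Set.EqOn g 0 (ball 0 1) := by
    refine han.eqOn_of_preconnected_of_eventuallyEq (g := 0) analyticOnNhd_const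
      (convex_ball (0 : ℂ) 1).isPreconnected (z₀ := 0) (by simp) ?_
    have hA : ContinuousAt formA 0 :=
      (differentiableOn_formA.differentiableAt (isOpen_ball.mem_nhds (by simp))).continuousAt
    filter_upwards [hA.eventually_ne (by rw [formA_zero]; exact one_ne_zero),
      isOpen_ball.mem_nhds (by simp : (0 : ℂ) ∈ ball (0 : ℂ) 1)] with w hw hw1
    exact (mul_eq_zero.1 (key w hw1)).resolve_left hw
  have := hz hq
  rw [hgq q hq h0] at this
  exact sub_eq_zero.1 this

/-! ### Monomials in the basic forms -/

/-- The monomial `A^a D^b S^e`, of weight `2a + 4b + 6e`. -/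
def formF (a b e : ℕ) (q : ℂ) : ℂ := formA q ^ a * formD q ^ b * formS q ^ e

lemma differentiableOn_formF (a b e : ℕ) : DifferentiableOn ℂ (formF a b e) (ball 0 1) :=
  ((differentiableOn_formA.pow a).mul (differentiableOn_formD.pow b)).mul
    (differentiableOn_formS.pow e)

lemma sqrt_three_sq' : ((√3 : ℝ) : ℂ) ^ 2 = 3 := by exact_mod_cast sqrt_three_sq

lemma sqrt_three_ne_zero : ((√3 : ℝ) : ℂ) ≠ 0 := by
  exact_mod_cast (Real.sqrt_pos.2 (by norm_num : (0 : ℝ) < 3)).ne'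

/-- Each of `A`, `D`, `S` contributes a sign `-1`, so the monomial transforms without sign when the
number of factors is even. -/
lemma formF_fricke {a b e : ℕ} (hpar : Even (a + b + e)) {τ : ℂ} (h : 0 < τ.im) :
    formF a b e (nome (fricke τ)) =
      ((√3 : ℝ) * τ) ^ (2 * a + 4 * b + 6 * e) * formF a b e (nome τ) := by
  rw [formF, formA_fricke h, formD_fricke h, formS_fricke h, formF]
  set x : ℂ := ((√3 : ℝ) : ℂ) * τ with hx
  have h2 : x ^ 2 = 3 * τ ^ 2 := by rw [hx, mul_pow, sqrt_three_sq']
  rw [show -3 * τ ^ 2 = -1 * x ^ 2 by rw [h2]; ring,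
    show -9 * τ ^ 4 = -1 * x ^ 4 by rw [show x ^ 4 = (x ^ 2) ^ 2 by ring, h2]; ring,
    show -27 * τ ^ 6 = -1 * x ^ 6 by rw [show x ^ 6 = (x ^ 2) ^ 3 by ring, h2]; ring]
  have h3 : (-1 : ℂ) ^ a * (-1) ^ b * (-1) ^ e = 1 := by
    rw [← pow_add, ← pow_add, hpar.neg_one_pow]
  simp only [mul_pow]
  rw [pow_add, pow_add, pow_mul, pow_mul, pow_mul]
  linear_combination ((x ^ 2) ^ a * (x ^ 4) ^ b * (x ^ 6) ^ e * formA (nome τ) ^ a *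
    formD (nome τ) ^ b * formS (nome τ) ^ e) * h3

lemma formS_zpow_fricke (n : ℤ) {τ : ℂ} (h : 0 < τ.im) :
    formS (nome (fricke τ)) ^ (2 * n) =
      ((√3 : ℝ) * τ) ^ (12 * n) * formS (nome τ) ^ (2 * n) := by
  rw [formS_fricke h, mul_zpow (-27 * τ ^ 6)]
  congr 1
  rw [zpow_mul, zpow_mul]
  congr 1
  rw [show (2 : ℤ) = ((2 : ℕ) : ℤ) by rfl, show (12 : ℤ) = ((12 : ℕ) : ℤ) by rfl,
    zpow_natCast, zpow_natCast, mul_pow ((√3 : ℝ) : ℂ),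
    show ((√3 : ℝ) : ℂ) ^ 12 = (((√3 : ℝ) : ℂ) ^ 2) ^ 6 by ring, sqrt_three_sq']
  ring

/-! ### Power series on the punctured disc -/

/-- Convergence at the points with real nome `r < 1` already gives absolute convergence on the disc
of radius `r`. -/
lemma exists_differentiableOn_of_hasSum {g : ℍ → ℂ} {N : ℤ} {a : ℕ → ℂ}
    (h : ∀ z : ℍ, HasSum (fun n : ℕ => a n * q z ^ (N + (n : ℤ))) (g z)) :
    ∃ F : ℂ → ℂ, DifferentiableOn ℂ F (ball 0 1) ∧
      ∀ z : ℍ, g z = nome z ^ N * F (nome z) := by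
  have hs : ∀ z : ℍ, HasSum (fun n : ℕ => a n * nome z ^ n) (g z / nome z ^ N) := by
    intro z
    have h1 := (h z).div_const (nome z ^ N)
    refine h1.congr_fun fun n => ?_
    have h2 : q z = nome z := rfl
    rw [h2, zpow_add₀ (nome_ne_zero _), zpow_natCast]
    have := zpow_ne_zero N (nome_ne_zero (z : ℂ))
    field_simp
  have hsr : ∀ r : ℝ, 0 < r → r < 1 → Summable fun n : ℕ => ‖a n‖ * r ^ n := by
    intro r h0 h1
    obtain ⟨τ, hτ, he⟩ := exists_nome_eq (q := (r : ℂ)) (by exact_mod_cast h0.ne')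
      (by rw [norm_real, Real.norm_eq_abs, abs_of_pos h0]; exact h1)
    have := (hs ⟨τ, hτ⟩).summable.norm
    refine this.congr fun n => ?_
    have : nome ((⟨τ, hτ⟩ : ℍ) : ℂ) = r := he
    rw [this, norm_mul, norm_pow, norm_real, Real.norm_eq_abs, abs_of_pos h0]
  refine ⟨fun w => ∑' n : ℕ, a n * w ^ n, ?_, fun z => ?_⟩
  · intro w hw
    obtain ⟨r, hr1, hr2⟩ := exists_between (show ‖w‖ < 1 by simpa using hw)
    have hr0 : 0 < r := (norm_nonneg _).trans_lt hr1
    have hd := differentiableOn_tsum_of_summable_norm (F := fun (n : ℕ) (w : ℂ) => a n * w ^ n)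
      (U := ball 0 r) (hsr r hr0 hr2) (fun n => by fun_prop) isOpen_ball (fun n w hw => by
        rw [norm_mul, norm_pow]
        have : ‖w‖ ≤ r := by simpa using (mem_ball_zero_iff.1 hw).le
        gcongr)
    exact (hd.differentiableAt (isOpen_ball.mem_nhds (by simpa using hr1))).differentiableWithinAt
  · have h1 : ∑' n : ℕ, a n * nome z ^ n = g z / nome z ^ N := (hs z).tsum_eq
    have h2 := zpow_ne_zero N (nome_ne_zero (z : ℂ))
    simp only [h1]
    field_simp

/-! ### The weight two form attached to a basis element -/

lemma polynomial_factor {P : Polynomial ℂ} {x y : ℂ} (hxy : x ≠ y) (hx : P.eval x = 0)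
    (hy : P.eval y = 0) :
    ∃ Q : Polynomial ℂ, ∀ w, P.eval w = (w - x) * (w - y) * Q.eval w := by
  obtain ⟨P₁, rfl⟩ := Polynomial.dvd_iff_isRoot.2 hx
  have h1 : P₁.IsRoot y := by
    rw [Polynomial.eval_mul] at hy
    refine (mul_eq_zero.1 hy).resolve_left ?_
    simpa [sub_eq_zero] using hxy.symm
  obtain ⟨Q, rfl⟩ := Polynomial.dvd_iff_isRoot.2 h1
  exact ⟨Q, fun w => by simp [mul_assoc]⟩

/-- The function `q^{-m} + q^{2ℓ+e+1} h(q)`. -/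
def leading (m ℓ : ℤ) (e : ℕ) (h : ℂ → ℂ) (q : ℂ) : ℂ := q ^ (-m) + q ^ (2 * ℓ + e + 1) * h q

/-- The left side has weight `(12ℓ + r) + (14 - r) - 12(ℓ + 1) = 2`, where `r = 2a + 4b + 6e`.
Multiplied by `D/S` it is invariant with a pole of finite order at the cusp, hence a polynomial in
`j`. This polynomial vanishes at `j = 0` and `j = 108`, because `D` vanishes at `ρ` and `i/√3`, so
it is divisible by `j(j - 108) = (AD/S)²`. Dividing by `D/S` again requires `D ≠ 0`. -/
lemma exists_polynomial_leading {m ℓ : ℤ} {a b e : ℕ} {h : ℂ → ℂ} (ha : a ≤ 2) (hb : b ≤ 1)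
    (he : e ≤ 1) (hpar : Even (a + b + e)) (hN : 1 ≤ m + 2 * ℓ + 2 + e)
    (hh : DifferentiableOn ℂ h (ball 0 1))
    (hW : ∀ τ : ℂ, 0 < τ.im → leading m ℓ e h (nome (fricke τ)) =
      ((√3 : ℝ) * τ) ^ (12 * ℓ + (2 * a + 4 * b + 6 * e : ℕ)) * leading m ℓ e h (nome τ)) :
    ∃ Q : Polynomial ℂ, ∀ q ∈ ball (0 : ℂ) 1, q ≠ 0 → formD q ≠ 0 →
      leading m ℓ e h q * formF (2 - a) (1 - b) (1 - e) q * formS q ^ (2 * (-ℓ - 1)) =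
        formA q ^ 2 * formD q / formS q * Q.eval (jInv q) := by
  -- `N` is the gap between the exponents `-m` and `2ℓ + e + 1` in `leading`; the pole of the
  -- invariant function has order at most `N + 1`.
  obtain ⟨N, hN'⟩ := Int.eq_ofNat_of_zero_le (show 0 ≤ m + 2 * ℓ + 1 + e by omega)
  set v : ℂ → ℂ := fun q => formA q ^ (2 - a) * formD q ^ (1 - b) * unitS q ^ (1 - e) *
    unitS q ^ (2 * (-ℓ - 1)) * formD q / unitS q with hv
  have hvd : DifferentiableOn ℂ v (ball 0 1) := by
    refine DifferentiableOn.div ?_ differentiableOn_unitS fun _ hq => unitS_ne_zero hq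
    refine DifferentiableOn.mul (DifferentiableOn.mul ?_ ?_) differentiableOn_formD
    · exact ((differentiableOn_formA.pow _).mul (differentiableOn_formD.pow _)).mul
        (differentiableOn_unitS.pow _)
    · exact differentiableOn_unitS.zpow (.inl fun _ hq => unitS_ne_zero hq)
  set g : ℂ → ℂ := fun q => v q + q ^ N * h q * v q with hg
  have hgd : DifferentiableOn ℂ g (ball 0 1) :=
    hvd.add (((differentiableOn_id.pow N).mul hh).mul hvd)
  have hval : ∀ q : ℂ, q ∈ ball (0 : ℂ) 1 → q ≠ 0 → g q / q ^ (N + 1) =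
      leading m ℓ e h q * formF (2 - a) (1 - b) (1 - e) q * formS q ^ (2 * (-ℓ - 1)) *
        (formD q / formS q) := by
    intro q hq h0
    have hS := unitS_ne_zero hq
    have e1 : q ^ (-m) = q ^ (2 * (ℓ + 1) : ℤ) * q ^ e / q ^ (N + 1) := by
      rw [eq_div_iff (pow_ne_zero _ h0), ← zpow_natCast, ← zpow_natCast, ← zpow_add₀ h0,
        ← zpow_add₀ h0]
      congr 1; push_cast; omega
    have e2 : q ^ (2 * ℓ + e + 1 : ℤ) = q ^ (2 * (ℓ + 1) : ℤ) * q ^ e / q := by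
      rw [eq_div_iff h0, ← zpow_natCast, ← zpow_add₀ h0, ← zpow_add_one₀ h0]
      congr 1; ring
    have e3 : q ^ (1 - e) * q ^ e = q := by rw [← pow_add]; simp [Nat.sub_add_cancel he]
    have e4 : q ^ (2 * (-ℓ - 1) : ℤ) * q ^ (2 * (ℓ + 1) : ℤ) = 1 := by
      rw [← zpow_add₀ h0, show 2 * (-ℓ - 1) + 2 * (ℓ + 1) = 0 by ring, zpow_zero]
    rw [leading, e1, e2, formF, formS, mul_zpow, mul_pow, hg, hv]
    set X := q ^ (2 * (ℓ + 1) : ℤ)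
    set Y := q ^ (2 * (-ℓ - 1) : ℤ)
    field_simp
    linear_combination (-(formA q ^ (2 - a) * formD q ^ (1 - b) *
      formD q * (1 + q ^ N * h q)) * q * (q ^ (1 - e) * q ^ e)) * e4 -
      (formA q ^ (2 - a) * formD q ^ (1 - b) *
      formD q * (1 + q ^ N * h q)) * q * e3
  obtain ⟨P, hP⟩ := exists_polynomial_of_fricke_invariant (N + 1) g hgd (by
    intro τ hτ
    have hS := formS_ne_zero (nome_mem_ball hτ) (nome_ne_zero τ)
    have hτ0 := ne_zero_of_im_pos hτ
    have hx : ((√3 : ℝ) : ℂ) * τ ≠ 0 := mul_ne_zero sqrt_three_ne_zero hτ0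
    rw [hval _ (nome_mem_ball hτ) (nome_ne_zero _),
      hval _ (nome_mem_ball (fricke_im_pos hτ)) (nome_ne_zero _), hW τ hτ,
      formF_fricke (by rw [Nat.even_iff] at *; omega) hτ, formS_zpow_fricke _ hτ,
      formD_fricke hτ, formS_fricke hτ]
    set x : ℂ := ((√3 : ℝ) : ℂ) * τ with hxd
    have hx2 : x ^ 2 = 3 * τ ^ 2 := by rw [hxd, mul_pow, sqrt_three_sq']
    have e1 : x ^ (12 * ℓ + (2 * a + 4 * b + 6 * e : ℕ)) *
        x ^ (2 * (2 - a) + 4 * (1 - b) + 6 * (1 - e)) * x ^ (12 * (-ℓ - 1)) = x ^ 2 := by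
      rw [← zpow_natCast x (2 * (2 - a) + 4 * (1 - b) + 6 * (1 - e)), ← zpow_add₀ hx,
        ← zpow_add₀ hx, ← zpow_natCast x 2]
      congr 1
      push_cast [Nat.cast_sub ha, Nat.cast_sub hb, Nat.cast_sub he]
      ring
    have e2 : -9 * τ ^ 4 * formD (nome τ) / (-27 * τ ^ 6 * formS (nome τ)) =
        formD (nome τ) / formS (nome τ) / x ^ 2 := by
      rw [hx2]; field_simp; ring
    rw [e2]
    generalize formF (2 - a) (1 - b) (1 - e) (nome τ) = F at *
    generalize formD (nome τ) / formS (nome τ) = G at *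
    have hx3 : x ^ 2 ≠ 0 := pow_ne_zero 2 hx
    rw [← mul_div_assoc, div_eq_iff hx3]
    linear_combination (leading m ℓ e h (nome τ) * F * formS (nome τ) ^ (2 * (-ℓ - 1)) * G) * e1)
  have hroot : ∀ τ : ℂ, 0 < τ.im → formD (nome τ) = 0 → P.eval (jInv (nome τ)) = 0 := by
    intro τ hτ h0
    rw [← hP _ (nome_mem_ball hτ) (nome_ne_zero _), hval _ (nome_mem_ball hτ) (nome_ne_zero _), h0]
    simp
  have r1 := hroot _ rho_im_pos formD_rho
  have r2 := hroot _ iThree_im_pos formD_iThree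
  rw [jInv_rho] at r1
  rw [jInv_iThree] at r2
  obtain ⟨Q, hQ⟩ := polynomial_factor (by norm_num) r1 r2
  refine ⟨Q, fun q hq h0 hD => ?_⟩
  have hS := formS_ne_zero hq h0
  have h1 := hval q hq h0
  rw [hP q hq h0, hQ, sub_zero, jInv_mul_sub hq h0] at h1
  have h2 := formA_mul_formD hq h0
  have h3 : haupt q - 729 / haupt q = formA q * formD q / formS q := by
    rw [h2]; field_simp
  rw [h3] at h1
  have h4 : formD q / formS q ≠ 0 := div_ne_zero hD hS
  apply mul_right_cancel₀ h4
  rw [← h1]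
  field_simp

/-! ### The integral formula on a small circle -/

/-- The integrand of the contour integral representing a basis element. -/
def kern (m ℓ : ℤ) (a b e : ℕ) (c q : ℂ) : ℂ :=
  q ^ (-m - 1) * formF (2 - a) (1 - b) (1 - e) q * formS q ^ (2 * (-ℓ - 1)) / (jInv q - c)

lemma exists_polynomial_derivative (Q : Polynomial ℂ) :
    ∃ R : Polynomial ℂ, Polynomial.derivative R = Q := by
  induction Q using Polynomial.induction_on' with
  | add p q hp hq =>
    obtain ⟨P, rfl⟩ := hp
    obtain ⟨R, rfl⟩ := hq
    exact ⟨P + R, by simp⟩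
  | monomial n a =>
    refine ⟨Polynomial.monomial (n + 1) (a / (n + 1)), ?_⟩
    have : (n : ℂ) + 1 ≠ 0 := by exact_mod_cast Nat.succ_ne_zero n
    rw [Polynomial.derivative_monomial]
    push_cast
    rw [div_mul_cancel₀ _ this]

/-- On a small circle the kernel equals `-Q(j) j'/(j - c)` up to a holomorphic function coming from
the tail `q^{2ℓ+e+1} h`. Split `Q(j) = Q(c) + (j - c) Q₁(j)`. The second summand gives an exact
derivative, the first gives `-Q(c)` times the logarithmic derivative of `j - c`, which has a simple
pole at `q = 0`. -/
lemma circleIntegral_kern {m ℓ : ℤ} {a b e : ℕ} {h : ℂ → ℂ} {Q : Polynomial ℂ} (he : e ≤ 1)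
    (hh : DifferentiableOn ℂ h (ball 0 1))
    (hQ : ∀ q ∈ ball (0 : ℂ) 1, q ≠ 0 → formD q ≠ 0 →
      leading m ℓ e h q * formF (2 - a) (1 - b) (1 - e) q * formS q ^ (2 * (-ℓ - 1)) =
        formA q ^ 2 * formD q / formS q * Q.eval (jInv q)) (c : ℂ) :
    ∃ r₁ : ℝ, 0 < r₁ ∧ r₁ ≤ 1 ∧ (∀ q ∈ ball (0 : ℂ) r₁, q ≠ 0 → jInv q ≠ c) ∧ ∀ r : ℝ, 0 < r →
      r < r₁ → ∮ q in C(0, r), kern m ℓ a b e c q = 2 * Real.pi * I * Q.eval c := by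
  set K : ℂ → ℂ := fun q => jNum q - c * q with hK
  have hKd : DifferentiableOn ℂ K (ball 0 1) := differentiableOn_jNum.sub (by fun_prop)
  have h0mem : (0 : ℂ) ∈ ball (0 : ℂ) 1 := by simp
  have hK0 : ∀ᶠ q in nhds (0 : ℂ), K q ≠ 0 :=
    (hKd.differentiableAt (isOpen_ball.mem_nhds h0mem)).continuousAt.eventually_ne
      (by simp [hK, jNum_zero])
  have hD0 : ∀ᶠ q in nhds (0 : ℂ), formD q ≠ 0 :=
    (differentiableOn_formD.differentiableAt (isOpen_ball.mem_nhds h0mem)).continuousAt.eventually_ne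
      (by simp [formD_zero])
  obtain ⟨r₁, hr₁, hball⟩ := Metric.eventually_nhds_iff_ball.1
    (hK0.and (hD0.and (isOpen_ball.mem_nhds h0mem)))
  have hsub : ball (0 : ℂ) (min r₁ 1) ⊆ ball 0 r₁ := ball_subset_ball (min_le_left _ _)
  have hjc : ∀ q ∈ ball (0 : ℂ) (min r₁ 1), q ≠ 0 → jInv q - c = K q / q := by
    intro q hq h0
    rw [jInv_eq (hball q (hsub hq)).2.2 h0, hK]; field_simp
  refine ⟨min r₁ 1, by positivity, min_le_right _ _, fun q hq h0 hj => ?_, fun r hr hr1 => ?_⟩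
  · have := hjc q hq h0
    rw [hj, sub_self] at this
    exact div_ne_zero (hball q (hsub hq)).1 h0 this.symm
  have hcl : closedBall (0 : ℂ) r ⊆ ball 0 (min r₁ 1) := closedBall_subset_ball hr1
  have hcl1 : closedBall (0 : ℂ) r ⊆ ball 0 1 :=
    hcl.trans (ball_subset_ball (min_le_right _ _))
  have hsp : ∀ q ∈ sphere (0 : ℂ) r, q ∈ ball (0 : ℂ) (min r₁ 1) ∧ q ∈ ball (0 : ℂ) 1 ∧ q ≠ 0 := by
    intro q hq
    refine ⟨hcl (sphere_subset_closedBall hq), hcl1 (sphere_subset_closedBall hq), fun h0 => ?_⟩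
    simp [h0] at hq; exact hr.ne' hq.symm
  obtain ⟨Q₁, hQ₁⟩ : ∃ Q₁ : Polynomial ℂ, ∀ w, Q.eval w = Q.eval c + (w - c) * Q₁.eval w := by
    obtain ⟨Q₁, h1⟩ := Polynomial.X_sub_C_dvd_sub_C_eval (a := c) (p := Q)
    refine ⟨Q₁, fun w => ?_⟩
    have := congrArg (Polynomial.eval w) h1
    simp at this
    linear_combination this
  obtain ⟨R, hR⟩ := exists_polynomial_derivative Q₁
  set v : ℂ → ℂ := fun q => h q * (formA q ^ (2 - a) * formD q ^ (1 - b) * unitS q ^ (1 - e)) *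
    unitS q ^ (2 * (-ℓ - 1)) / K q with hv
  have hvd : DifferentiableOn ℂ v (ball 0 (min r₁ 1)) := by
    have hs : ball (0 : ℂ) (min r₁ 1) ⊆ ball 0 1 := ball_subset_ball (min_le_right _ _)
    refine DifferentiableOn.div ?_ (hKd.mono hs) fun q hq => (hball q (hsub hq)).1
    refine DifferentiableOn.mono ?_ hs
    exact (hh.mul (((differentiableOn_formA.pow _).mul (differentiableOn_formD.pow _)).mul
      (differentiableOn_unitS.pow _))).mul
      (differentiableOn_unitS.zpow (.inl fun _ hq => unitS_ne_zero hq))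
  have hLd : DifferentiableOn ℂ (logDeriv K) (ball 0 (min r₁ 1)) := by
    have hs : ball (0 : ℂ) (min r₁ 1) ⊆ ball 0 1 := ball_subset_ball (min_le_right _ _)
    exact ((differentiableOn_deriv hKd).mono hs).div (hKd.mono hs)
      fun q hq => (hball q (hsub hq)).1
  have hzero : ∀ {g : ℂ → ℂ}, DifferentiableOn ℂ g (ball 0 (min r₁ 1)) →
      ∮ q in C(0, r), g q = 0 := by
    intro g hg
    exact circleIntegral_eq_zero_of_differentiable_on_off_countable hr.le Set.countable_empty
      (hg.mono hcl).continuousOn fun z hz =>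
        hg.differentiableAt (isOpen_ball.mem_nhds (hcl (ball_subset_closedBall hz.1)))
  have hprim : ∮ q in C(0, r), Q₁.eval (jInv q) *
      (-(formA q * (haupt q - 729 / haupt q)) / q) = 0 := by
    refine circleIntegral.integral_eq_zero_of_hasDerivWithinAt (f := fun q => R.eval (jInv q)) hr.le
      fun q hq => ?_
    have := (R.hasDerivAt (jInv q)).comp q (hasDerivAt_jInv (hsp q hq).2.1 (hsp q hq).2.2)
    rw [hR] at this
    exact this.hasDerivWithinAt
  have hexp : ∀ q ∈ sphere (0 : ℂ) r, kern m ℓ a b e c q =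
      (Q.eval c * ((q - 0)⁻¹ - logDeriv K q) - v q) -
        (Q₁.eval (jInv q) * (-(formA q * (haupt q - 729 / haupt q)) / q)) := by
    intro q hq
    obtain ⟨hq1, hq2, h0⟩ := hsp q hq
    have hKq := (hball q (hsub hq1)).1
    have hS := unitS_ne_zero hq2
    have hSS := formS_ne_zero hq2 h0
    have e0 := hjc q hq1 h0
    have hKd' : HasDerivAt K (deriv K q) q :=
      (hKd.differentiableAt (isOpen_ball.mem_nhds hq2)).hasDerivAt
    have e1 : -(formA q * (haupt q - 729 / haupt q)) / q = deriv K q / q - K q / q ^ 2 := by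
      refine (hasDerivAt_jInv hq2 h0).unique ?_
      have h1 : HasDerivAt (fun x => K x / x + c) ((deriv K q * q - K q * 1) / q ^ 2) q :=
        (hKd'.div (hasDerivAt_id q) h0).add_const c
      have h2 : (deriv K q * q - K q * 1) / q ^ 2 = deriv K q / q - K q / q ^ 2 := by field_simp
      rw [h2] at h1
      refine h1.congr_of_eventuallyEq ?_
      filter_upwards [isOpen_ball.mem_nhds hq1, isOpen_ne.mem_nhds h0] with x hx hx0
      rw [← hjc x hx hx0]; ring
    have e2 : formA q ^ 2 * formD q / formS q = formA q * (haupt q - 729 / haupt q) := by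
      rw [div_eq_iff hSS]; linear_combination formA q * formA_mul_formD hq2 h0
    have e3 := hQ q hq2 h0 (hball q (hsub hq1)).2.1
    rw [e2, hQ₁ (jInv q), leading, e0] at e3
    have e5 : q ^ (1 - e) * q ^ e = q := by rw [← pow_add]; simp [Nat.sub_add_cancel he]
    -- The exponent `2ℓ + e + 1` of the tail exactly cancels the powers of `q` in the complementary
    -- monomial and in `S^{-2ℓ-2}`; this is why `v` has no pole.
    have e6 : q ^ (2 * ℓ + e + 1 : ℤ) * (q ^ (1 - e) * q ^ (2 * (-ℓ - 1) : ℤ)) = 1 := by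
      rw [show (2 * ℓ + e + 1 : ℤ) = 2 * (ℓ + 1) + e - 1 by ring, zpow_sub_one₀ h0, zpow_add₀ h0,
        show 2 * (-ℓ - 1) = -(2 * (ℓ + 1)) by ring, zpow_neg, zpow_natCast]
      have := zpow_ne_zero (2 * (ℓ + 1)) h0
      field_simp
      linear_combination e5
    have e7 : q ^ (2 * ℓ + e + 1 : ℤ) * h q * formF (2 - a) (1 - b) (1 - e) q *
        formS q ^ (2 * (-ℓ - 1)) = v q * K q := by
      rw [hv]
      simp only [formF, formS, mul_pow, mul_zpow]
      rw [div_mul_cancel₀ _ hKq]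
      linear_combination (h q * (formA q ^ (2 - a) * formD q ^ (1 - b) * unitS q ^ (1 - e)) *
        unitS q ^ (2 * (-ℓ - 1))) * e6
    have e8 : formA q * (haupt q - 729 / haupt q) = K q / q - deriv K q := by
      field_simp at e1 ⊢
      linear_combination -e1
    rw [kern, e0, zpow_sub_one₀ h0, e1, logDeriv_apply, sub_zero]
    rw [e8] at e3
    have e9 : q ^ (-m) * formF (2 - a) (1 - b) (1 - e) q * formS q ^ (2 * (-ℓ - 1)) =
        (K q / q - deriv K q) * (Q.eval c + K q / q * Q₁.eval (jInv q)) - v q * K q := by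
      linear_combination e3 - e7
    rw [show q ^ (-m) * q⁻¹ * formF (2 - a) (1 - b) (1 - e) q * formS q ^ (2 * (-ℓ - 1)) =
      (q ^ (-m) * formF (2 - a) (1 - b) (1 - e) q * formS q ^ (2 * (-ℓ - 1))) * q⁻¹ by ring, e9]
    field_simp
    ring
  have hci : ∀ {g : ℂ → ℂ}, DifferentiableOn ℂ g (ball 0 (min r₁ 1) \ {0}) →
      CircleIntegrable g 0 r := fun {g} hg =>
    ContinuousOn.circleIntegrable hr.le (hg.mono fun q hq => ⟨(hsp q hq).1, (hsp q hq).2.2⟩).continuousOn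
  have hsb : ball (0 : ℂ) (min r₁ 1) \ {0} ⊆ ball 0 (min r₁ 1) := Set.sdiff_subset
  have i1 : CircleIntegrable (fun q => Q₁.eval (jInv q) *
      (-(formA q * (haupt q - 729 / haupt q)) / q)) 0 r := by
    refine ContinuousOn.circleIntegrable hr.le fun q hq => ContinuousAt.continuousWithinAt ?_
    obtain ⟨-, hq2, h0⟩ := hsp q hq
    have c1 : ContinuousAt jInv q := (hasDerivAt_jInv hq2 h0).continuousAt
    have c2 : ContinuousAt haupt q := (hasDerivAt_haupt hq2 h0).continuousAt
    have c3 : ContinuousAt formA q :=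
      (differentiableOn_formA.differentiableAt (isOpen_ball.mem_nhds hq2)).continuousAt
    exact (Q₁.continuous.continuousAt.comp c1).mul
      (((c3.mul (c2.sub (continuousAt_const.div c2 (haupt_ne_zero hq2 h0)))).neg).div
        continuousAt_id h0)
  have i2 : CircleIntegrable (fun q : ℂ => (q - 0)⁻¹) 0 r := by
    refine hci fun q hq => ?_
    have : q - 0 ≠ 0 := by simpa using hq.2
    fun_prop (disch := assumption)
  have i3 : CircleIntegrable (logDeriv K) 0 r := hci (hLd.mono hsb)
  have i4 : CircleIntegrable v 0 r := hci (hvd.mono hsb)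
  have i5 : CircleIntegrable (fun q : ℂ => (q - 0)⁻¹ - logDeriv K q) 0 r := i2.sub i3
  have i6 : CircleIntegrable (fun q : ℂ => Q.eval c * ((q - 0)⁻¹ - logDeriv K q)) 0 r :=
    i5.const_fun_smul
  have i7 : CircleIntegrable (fun q : ℂ => Q.eval c * ((q - 0)⁻¹ - logDeriv K q) - v q) 0 r :=
    i6.sub i4
  rw [circleIntegral.integral_congr hr.le hexp, circleIntegral.integral_sub i7 i1, hprim,
    circleIntegral.integral_sub i6 i4, circleIntegral.integral_const_mul,
    circleIntegral.integral_sub i2 i3, hzero hvd, hzero hLd,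
    circleIntegral.integral_sub_center_inv 0 hr.ne']
  ring

/-! ### Residues on an annulus -/

/-- Induction on the simple poles. Subtracting `ρ(p)/(q - p)` makes the singularity at `p`
removable, and this term integrates to `2πi ρ(p)` over the outer circle and to `0` over the inner
one. -/
theorem circleIntegral_sub_circleIntegral_eq_sum {U : Set ℂ} (hU : IsOpen U) {r R : ℝ} (hr : 0 < r)
    (hrR : r < R) (hAnn : ∀ q : ℂ, r ≤ ‖q‖ → ‖q‖ ≤ R → q ∈ U) (ρ : ℂ → ℂ) (Z : Finset ℂ) :
    ∀ Ψ : ℂ → ℂ, (∀ q ∈ U, q ∉ Z → DifferentiableAt ℂ Ψ q) →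
      (∀ p ∈ Z, r < ‖p‖ ∧ ‖p‖ < R ∧ Tendsto (fun q => (q - p) * Ψ q) (𝓝[≠] p) (𝓝 (ρ p))) →
      (∮ q in C(0, R), Ψ q) - ∮ q in C(0, r), Ψ q = 2 * Real.pi * I * ∑ p ∈ Z, ρ p := by
  classical
  induction Z using Finset.induction_on with
  | empty =>
    intro Ψ hΨ _
    have hd : ∀ q : ℂ, r ≤ ‖q‖ → ‖q‖ ≤ R → DifferentiableAt ℂ Ψ q := fun q h1 h2 =>
      hΨ q (hAnn q h1 h2) (by simp)
    rw [circleIntegral_eq_of_differentiable_on_annulus_off_countable hr hrR.le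
      Set.countable_empty (f := Ψ) (c := 0)]
    · simp
    · intro q hq
      exact (hd q (by simpa using hq.2) (by simpa using hq.1)).continuousAt.continuousWithinAt
    · rintro q ⟨⟨hq1, hq2⟩, -⟩
      simp only [mem_ball, mem_closedBall, dist_zero_right, not_le] at hq1 hq2
      exact hd q hq2.le hq1.le
  | insert p Z hp ih =>
    intro Ψ hΨ hZ
    obtain ⟨hp1, hp2, hp3⟩ := hZ p (Finset.mem_insert_self _ _)
    have hpU : p ∈ U := hAnn p hp1.le hp2.le
    set g : ℂ → ℂ := fun q => Ψ q - ρ p * (q - p)⁻¹ with hg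
    have hgd : ∀ q ∈ U, q ∉ Z → q ≠ p → DifferentiableAt ℂ g q := by
      intro q hq hqZ hqp
      have h1 := hΨ q hq (by simp [hqp, hqZ])
      have h2 : q - p ≠ 0 := sub_ne_zero.2 hqp
      exact h1.sub (by fun_prop (disch := assumption))
    set G : ℂ → ℂ := Function.update g p (limUnder (𝓝[≠] p) g) with hG
    have hGg : ∀ q, q ≠ p → G q = g q := fun q hq => Function.update_of_ne hq _ _
    have hVo : IsOpen (U ∩ (Z : Set ℂ)ᶜ) := hU.inter (Z.finite_toSet.isClosed.isOpen_compl)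
    have hGd : DifferentiableOn ℂ G (U ∩ (Z : Set ℂ)ᶜ) := by
      refine differentiableOn_update_limUnder_of_isLittleO (hVo.mem_nhds ⟨hpU, by simpa using hp⟩)
        (fun q hq => (hgd q hq.1.1 (by simpa using hq.1.2) hq.2).differentiableWithinAt) ?_
      rw [Asymptotics.isLittleO_iff_tendsto' ?_]
      · have h1 : Tendsto (fun q => (q - p) * Ψ q - ρ p - g p * (q - p)) (𝓝[≠] p) (𝓝 0) := by
          have h2 : Tendsto (fun q : ℂ => g p * (q - p)) (𝓝[≠] p) (𝓝 (g p * (p - p))) :=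
            (Continuous.tendsto (by fun_prop) p).mono_left nhdsWithin_le_nhds
          simpa using (hp3.sub_const (ρ p)).sub h2
        refine h1.congr' ?_
        filter_upwards [self_mem_nhdsWithin] with q hq
        have h2 : q - p ≠ 0 := sub_ne_zero.2 hq
        simp only [hg]
        field_simp
      · filter_upwards [self_mem_nhdsWithin] with q hq h0
        exact absurd h0 (inv_ne_zero (sub_ne_zero.2 hq))
    have key := ih G (fun q hq hqZ => hGd.differentiableAt (hVo.mem_nhds ⟨hq, by simpa using hqZ⟩))
      (fun p' hp' => by
        obtain ⟨h1, h2, h3⟩ := hZ p' (Finset.mem_insert_of_mem hp')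
        refine ⟨h1, h2, ?_⟩
        have hne : p' ≠ p := fun h => hp (h ▸ hp')
        have h4 : Tendsto (fun q => (q - p') * (ρ p * (q - p)⁻¹)) (𝓝[≠] p') (𝓝 0) := by
          have h5 : ContinuousAt (fun q => (q - p') * (ρ p * (q - p)⁻¹)) p' := by
            have : p' - p ≠ 0 := sub_ne_zero.2 hne
            fun_prop (disch := assumption)
          have h6 := h5.tendsto.mono_left (nhdsWithin_le_nhds (s := {p'}ᶜ))
          simpa using h6
        have h7 := h3.sub h4
        rw [sub_zero] at h7
        refine h7.congr' ?_
        filter_upwards [(isOpen_ne.mem_nhds hne : {x | x ≠ p} ∈ 𝓝 p') |> mem_nhdsWithin_of_mem_nhds]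
          with q hq
        rw [hGg q hq, hg]
        ring)
    have hnotp : ∀ x : ℝ, x ≠ ‖p‖ → ∀ q ∈ sphere (0 : ℂ) x, q ≠ p := by
      rintro x hx q hq rfl
      exact hx (by simpa using hq.symm)
    have hci : ∀ x : ℝ, 0 < x → (∀ q ∈ sphere (0 : ℂ) x, q ∈ U ∧ q ∉ insert p Z) →
        x ≠ ‖p‖ → ∮ q in C(0, x), G q = (∮ q in C(0, x), Ψ q) -
          ρ p * ∮ q in C(0, x), (q - p)⁻¹ := by
      intro x hx h1 h2
      have i1 : CircleIntegrable Ψ 0 x := ContinuousOn.circleIntegrable hx.le fun q hq =>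
        (hΨ q (h1 q hq).1 (h1 q hq).2).continuousAt.continuousWithinAt
      have i2 : CircleIntegrable (fun q => ρ p * (q - p)⁻¹) 0 x :=
        ContinuousOn.circleIntegrable hx.le fun q hq => by
          have : q - p ≠ 0 := sub_ne_zero.2 (hnotp x h2 q hq)
          exact ContinuousAt.continuousWithinAt (by fun_prop (disch := assumption))
      rw [circleIntegral.integral_congr hx.le (fun q hq => hGg q (hnotp x h2 q hq)), hg,
        circleIntegral.integral_sub i1 i2, circleIntegral.integral_const_mul]
    have hsph : ∀ x : ℝ, (x = r ∨ x = R) → ∀ q ∈ sphere (0 : ℂ) x, q ∈ U ∧ q ∉ insert p Z := by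
      intro x hx q hq
      have hqn : ‖q‖ = x := by simpa using hq
      refine ⟨hAnn q (by rcases hx with h | h <;> linarith) (by rcases hx with h | h <;> linarith),
        fun h => ?_⟩
      obtain ⟨h1, h2, -⟩ := hZ q h
      rcases hx with h | h <;> linarith
    rw [hci R (hr.trans hrR) (hsph R (.inr rfl)) hp2.ne',
      hci r hr (hsph r (.inl rfl)) hp1.ne,
      circleIntegral.integral_sub_inv_of_mem_ball (by simpa using hp2)] at key
    have h0 : ∮ q in C(0, r), (q - p)⁻¹ = 0 := by
      refine circleIntegral_eq_zero_of_differentiable_on_off_countable hr.le Set.countable_empty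
        (fun q hq => ?_) (fun q hq => ?_)
      · have : q - p ≠ 0 := sub_ne_zero.2 (by rintro rfl; simp at hq; linarith)
        exact ContinuousAt.continuousWithinAt (by fun_prop (disch := assumption))
      · have : q - p ≠ 0 := sub_ne_zero.2 (by
          rintro rfl; have := hq.1; simp at this; linarith)
        fun_prop (disch := assumption)
    rw [h0] at key
    rw [Finset.sum_insert hp]
    linear_combination key

/-! ### The residue expansion of a basis element -/

lemma formA_ne_zero {q : ℂ} (hq : q ∈ ball (0 : ℂ) 1) (h0 : q ≠ 0) (h1 : jInv q ≠ 0) :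
    formA q ≠ 0 := by
  intro h
  have := formA_pow_three hq h0
  rw [h] at this
  exact mul_ne_zero h1 (formS_ne_zero hq h0) (by rw [← this]; simp)

lemma formD_ne_zero {q : ℂ} (hq : q ∈ ball (0 : ℂ) 1) (h0 : q ≠ 0) (h1 : jInv q ≠ 0)
    (h2 : jInv q ≠ 108) : formD q ≠ 0 := by
  intro h
  have h3 := formA_mul_formD hq h0
  have h4 := jInv_mul_sub hq h0
  rw [h, mul_zero, eq_comm, mul_eq_zero, or_iff_left (formS_ne_zero hq h0)] at h3
  rw [h3] at h4
  exact mul_ne_zero h1 (sub_ne_zero.2 h2) (by rw [h4]; simp)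

/-- The form `S^{2ℓ} A^a D^b S^e`. -/
def baseForm (ℓ : ℤ) (a b e : ℕ) (q : ℂ) : ℂ := formS q ^ (2 * ℓ) * formF a b e q

lemma formF_mul_formF {a b e : ℕ} (ha : a ≤ 2) (hb : b ≤ 1) (he : e ≤ 1) (q : ℂ) :
    formF (2 - a) (1 - b) (1 - e) q * formF a b e q = formA q ^ 2 * formD q * formS q := by
  have h1 : formA q ^ (2 - a) * formA q ^ a = formA q ^ 2 := by
    rw [← pow_add, Nat.sub_add_cancel ha]
  have h2 : formD q ^ (1 - b) * formD q ^ b = formD q := by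
    rw [← pow_add, Nat.sub_add_cancel hb, pow_one]
  have h3 : formS q ^ (1 - e) * formS q ^ e = formS q := by
    rw [← pow_add, Nat.sub_add_cancel he, pow_one]
  calc _ = (formA q ^ (2 - a) * formA q ^ a) * (formD q ^ (1 - b) * formD q ^ b) *
        (formS q ^ (1 - e) * formS q ^ e) := by rw [formF, formF]; ring
    _ = _ := by rw [h1, h2, h3]

lemma baseForm_ne_zero (ℓ : ℤ) (a b e : ℕ) {q : ℂ} (hq : q ∈ ball (0 : ℂ) 1) (h0 : q ≠ 0)
    (h1 : jInv q ≠ 0) (h2 : jInv q ≠ 108) : baseForm ℓ a b e q ≠ 0 :=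
  mul_ne_zero (zpow_ne_zero _ (formS_ne_zero hq h0)) (mul_ne_zero (mul_ne_zero
    (pow_ne_zero _ (formA_ne_zero hq h0 h1)) (pow_ne_zero _ (formD_ne_zero hq h0 h1 h2)))
    (pow_ne_zero _ (formS_ne_zero hq h0)))

lemma formF_eq {ℓ : ℤ} {a b e : ℕ} (ha : a ≤ 2) (hb : b ≤ 1) (he : e ≤ 1) {q : ℂ}
    (hq : q ∈ ball (0 : ℂ) 1) (h0 : q ≠ 0) (h1 : jInv q ≠ 0) (h2 : jInv q ≠ 108) :
    formF (2 - a) (1 - b) (1 - e) q * formS q ^ (2 * (-ℓ - 1)) =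
      formA q ^ 2 * formD q / formS q / baseForm ℓ a b e q := by
  have hS := formS_ne_zero hq h0
  have hb0 := baseForm_ne_zero ℓ a b e hq h0 h1 h2
  rw [eq_div_iff hb0, eq_div_iff hS, baseForm]
  have h3 : formS q ^ (2 * (-ℓ - 1)) * formS q ^ (2 * ℓ) * formS q ^ 2 = 1 := by
    rw [← zpow_natCast (formS q) 2, ← zpow_add₀ hS, ← zpow_add₀ hS,
      show 2 * (-ℓ - 1) + 2 * ℓ + ((2 : ℕ) : ℤ) = 0 by push_cast; ring, zpow_zero]
  have h4 := formF_mul_formF ha hb he q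
  apply mul_right_cancel₀ hS
  linear_combination h4 * (formS q ^ (2 * (-ℓ - 1)) * formS q ^ (2 * ℓ) * formS q ^ 2) +
    formA q ^ 2 * formD q * formS q * h3

/-- With `c = j(w)` the function equals `baseForm(w) Q(c)`. The small-circle integral for `Q(c)` is
moved to radius `R`. At a solution `p` of `j = c` the zero is simple, with `q dj/dq = -A²D/S`, and
the kernel has residue `-p^{-m}/baseForm(p)`. -/
theorem leading_eq_sum_add_integral {m ℓ : ℤ} {a b e : ℕ} {h : ℂ → ℂ} (ha : a ≤ 2) (hb : b ≤ 1)
    (he : e ≤ 1) (hpar : Even (a + b + e)) (hN : 1 ≤ m + 2 * ℓ + 2 + e)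
    (hh : DifferentiableOn ℂ h (ball 0 1))
    (hW : ∀ τ : ℂ, 0 < τ.im → leading m ℓ e h (nome (fricke τ)) =
      ((√3 : ℝ) * τ) ^ (12 * ℓ + (2 * a + 4 * b + 6 * e : ℕ)) * leading m ℓ e h (nome τ))
    {w : ℂ} (hw : w ∈ ball (0 : ℂ) 1) (hw0 : w ≠ 0) (hc0 : jInv w ≠ 0) (hc1 : jInv w ≠ 108)
    {R : ℝ} (hR : 0 < R) (hR1 : R < 1) {Z : Finset ℂ}
    (hZ : ∀ q ∈ Z, q ≠ 0 ∧ ‖q‖ < R ∧ jInv q = jInv w)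
    (hZ' : ∀ q : ℂ, q ≠ 0 → ‖q‖ ≤ R → jInv q = jInv w → q ∈ Z) :
    leading m ℓ e h w = ∑ p ∈ Z, p ^ (-m) * (baseForm ℓ a b e w / baseForm ℓ a b e p) +
      (2 * Real.pi * I)⁻¹ * ∮ q in C(0, R), baseForm ℓ a b e w * kern m ℓ a b e (jInv w) q := by
  set c := jInv w with hc
  obtain ⟨Q, hQ⟩ := exists_polynomial_leading ha hb he hpar hN hh hW
  obtain ⟨r₁, hr₁, hr₁', hne, hcirc⟩ := circleIntegral_kern he hh hQ c
  obtain ⟨r, hr0, hr⟩ := exists_between (show 0 < min r₁ R from lt_min hr₁ hR)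
  have hAD : formA w ^ 2 * formD w / formS w ≠ 0 :=
    div_ne_zero (mul_ne_zero (pow_ne_zero _ (formA_ne_zero hw hw0 hc0))
      (formD_ne_zero hw hw0 hc0 hc1)) (formS_ne_zero hw hw0)
  have hbw := baseForm_ne_zero ℓ a b e hw hw0 hc0 hc1
  have hlead : leading m ℓ e h w = baseForm ℓ a b e w * Q.eval c := by
    have h1 := hQ w hw hw0 (formD_ne_zero hw hw0 hc0 hc1)
    rw [mul_assoc, formF_eq ha hb he hw hw0 hc0 hc1] at h1
    generalize formA w ^ 2 * formD w / formS w = X at *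
    field_simp at h1
    rw [h1]
  have hres : ∀ p ∈ Z, r < ‖p‖ ∧ ‖p‖ < R ∧
      Tendsto (fun q => (q - p) * kern m ℓ a b e c q) (𝓝[≠] p)
        (𝓝 (-(p ^ (-m) / baseForm ℓ a b e p))) := by
    intro p hp
    obtain ⟨hp0, hpR, hpc⟩ := hZ p hp
    have hpb : p ∈ ball (0 : ℂ) 1 := by simpa using hpR.trans hR1
    refine ⟨?_, hpR, ?_⟩
    · by_contra hlt
      refine hne p ?_ hp0 hpc
      simpa using lt_of_le_of_lt (not_lt.1 hlt) (hr.trans_le (min_le_left _ _))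
    have hj := hasDerivAt_jInv hpb hp0
    have hbp := baseForm_ne_zero ℓ a b e hpb hp0 (hpc ▸ hc0) (hpc ▸ hc1)
    have hGA : formA p * (haupt p - 729 / haupt p) = formA p ^ 2 * formD p / formS p := by
      rw [eq_div_iff (formS_ne_zero hpb hp0)]
      linear_combination (-formA p) * formA_mul_formD hpb hp0
    have hADp : formA p ^ 2 * formD p / formS p ≠ 0 :=
      div_ne_zero (mul_ne_zero (pow_ne_zero _ (formA_ne_zero hpb hp0 (hpc ▸ hc0)))
        (formD_ne_zero hpb hp0 (hpc ▸ hc0) (hpc ▸ hc1))) (formS_ne_zero hpb hp0)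
    rw [hGA] at hj
    have h1 := hj.tendsto_slope
    have hnum : ContinuousAt (fun q => q ^ (-m - 1) * formF (2 - a) (1 - b) (1 - e) q *
        formS q ^ (2 * (-ℓ - 1))) p := by
      have hn := isOpen_ball.mem_nhds hpb
      exact ((continuousAt_zpow₀ _ _ (.inl hp0)).mul
        ((differentiableOn_formF _ _ _).differentiableAt hn).continuousAt).mul
        (ContinuousAt.zpow₀ (differentiableOn_formS.differentiableAt hn).continuousAt _
          (.inl (formS_ne_zero hpb hp0)))
    have h2 := (hnum.tendsto.mono_left (nhdsWithin_le_nhds (s := {p}ᶜ))).div h1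
      (div_ne_zero (neg_ne_zero.2 hADp) hp0)
    have h3 : p ^ (-m - 1) * formF (2 - a) (1 - b) (1 - e) p * formS p ^ (2 * (-ℓ - 1)) /
        (-(formA p ^ 2 * formD p / formS p) / p) = -(p ^ (-m) / baseForm ℓ a b e p) := by
      rw [mul_assoc, formF_eq ha hb he hpb hp0 (hpc ▸ hc0) (hpc ▸ hc1), zpow_sub_one₀ hp0]
      generalize formA p ^ 2 * formD p / formS p = X at *
      field_simp
    rw [h3] at h2
    refine h2.congr' ?_
    filter_upwards [self_mem_nhdsWithin] with q hq
    have hqp : q - p ≠ 0 := sub_ne_zero.2 hq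
    rw [Pi.div_apply, slope_def_field, hpc, kern, div_div_eq_mul_div]
    ring
  have hjcont : ContinuousOn jInv (ball 0 1 \ {0}) := fun q hq =>
    (hasDerivAt_jInv hq.1 hq.2).continuousAt.continuousWithinAt
  have hVo : IsOpen (ball (0 : ℂ) 1 \ {0}) := isOpen_ball.sdiff isClosed_singleton
  -- The domain has to contain the circle `|q| = R` itself. Off the open disc of radius `R` only
  -- points with `j ≠ c` are admitted, so inside it `Z` accounts for every pole.
  have hUo : IsOpen ((ball (0 : ℂ) 1 \ {0}) ∩ jInv ⁻¹' {c}ᶜ ∪ ball 0 R \ {0}) :=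
    (hjcont.isOpen_inter_preimage hVo isOpen_compl_singleton).union
      (isOpen_ball.sdiff isClosed_singleton)
  have hmain := circleIntegral_sub_circleIntegral_eq_sum hUo hr0 (hr.trans_le (min_le_right _ _))
    (fun q h1 h2 => by
      have hq0 : q ≠ 0 := by
        rintro rfl
        simp at h1
        linarith
      rcases h2.lt_or_eq with h3 | h3
      · exact .inr ⟨by simpa using h3, hq0⟩
      · refine .inl ⟨⟨by simpa using h2.trans_lt hR1, hq0⟩, fun hj => ?_⟩
        exact (hZ q (hZ' q hq0 h2 hj)).2.1.ne h3)
    (fun p => -(p ^ (-m) / baseForm ℓ a b e p)) Z (kern m ℓ a b e c)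
    (fun q hq hqZ => by
      have hq' : q ∈ ball (0 : ℂ) 1 ∧ q ≠ 0 ∧ jInv q ≠ c := by
        rcases hq with hq | hq
        · exact ⟨hq.1.1, hq.1.2, hq.2⟩
        · exact ⟨ball_subset_ball hR1.le hq.1, hq.2,
            fun hj => hqZ (hZ' q hq.2 (by simpa using (mem_ball_zero_iff.1 hq.1).le) hj)⟩
      obtain ⟨hqb, hq0, hqc⟩ := hq'
      have hn := isOpen_ball.mem_nhds hqb
      exact (((differentiableAt_zpow.2 (.inl hq0)).mul
        ((differentiableOn_formF _ _ _).differentiableAt hn)).mul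
        ((differentiableOn_formS.differentiableAt hn).zpow (.inl (formS_ne_zero hqb hq0)))).div
        ((hasDerivAt_jInv hqb hq0).differentiableAt.sub_const c) (sub_ne_zero.2 hqc)) hres
  rw [hcirc r hr0 (hr.trans_le (min_le_left _ _)), Finset.sum_neg_distrib] at hmain
  have hQc : Q.eval c = ∑ p ∈ Z, p ^ (-m) / baseForm ℓ a b e p +
      (2 * Real.pi * I)⁻¹ * ∮ q in C(0, R), kern m ℓ a b e c q := by
    have hpi := two_pi_I_ne_zero
    field_simp
    linear_combination -hmain
  rw [hlead, hQc, circleIntegral.integral_const_mul, mul_add, Finset.mul_sum]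
  congr 1
  · refine Finset.sum_congr rfl fun p _ => by ring
  · ring

/-! ### The Hauptmodul on the fundamental domain -/

/-- The fundamental domain `|Re τ| ≤ 1/2`, `|τ|² ≥ 1/3` of `Γ₀⁺(3)`. -/
def fundDom : Set ℂ := {τ | 0 < τ.im ∧ |τ.re| ≤ 1 / 2 ∧ 1 ≤ 3 * normSq τ}

lemma differentiableOn_inv_haupt_nome :
    DifferentiableOn ℂ (fun τ => (haupt (nome τ))⁻¹) {τ : ℂ | 0 < τ.im} := fun τ hτ =>
  ((hasDerivAt_comp_nome (hasDerivAt_haupt (nome_mem_ball hτ)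
    (nome_ne_zero τ))).differentiableAt.inv
      (haupt_ne_zero (nome_mem_ball hτ) (nome_ne_zero τ))).differentiableWithinAt

lemma isOpen_im_pos : IsOpen {τ : ℂ | 0 < τ.im} := isOpen_lt continuous_const continuous_im

/-- By the maximum principle `1/t` would be constant, but `t` takes the values `27` and `-27`. -/
lemma not_isLocalMax_inv_haupt {τ₀ : ℂ} (h : 0 < τ₀.im) :
    ¬ IsLocalMax (norm ∘ fun τ => (haupt (nome τ))⁻¹) τ₀ := by
  intro hmax
  have hd : ∀ᶠ τ in 𝓝 τ₀, DifferentiableAt ℂ (fun τ => (haupt (nome τ))⁻¹) τ := by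
    filter_upwards [isOpen_im_pos.mem_nhds h] with τ hτ
    exact differentiableOn_inv_haupt_nome.differentiableAt (isOpen_im_pos.mem_nhds hτ)
  have h1 := eventually_eq_of_isLocalMax_norm hd hmax
  have hconn : IsPreconnected {τ : ℂ | 0 < τ.im} := (convex_halfSpace_im_gt 0).isPreconnected
  have h2 := (differentiableOn_inv_haupt_nome.analyticOnNhd isOpen_im_pos).eqOn_of_preconnected_of_eventuallyEq
    (analyticOnNhd_const (v := (haupt (nome τ₀))⁻¹)) hconn h h1
  have h3 := h2 rho_im_pos
  have h4 := h2 iThree_im_pos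
  simp only [haupt_rho] at h3
  simp only [haupt_iThree] at h4
  rw [← h4] at h3
  norm_num at h3

/-- Off the arc, a neighbourhood of a point of the fundamental domain is covered by the domain and
its translates by `±1`, so a maximum over the domain would be a local maximum. -/
lemma not_isMaxOn_inv_haupt {τ₀ : ℂ} (h : τ₀ ∈ fundDom) (h1 : 1 < 3 * normSq τ₀) :
    ¬ ∀ τ ∈ fundDom, ‖(haupt (nome τ))⁻¹‖ ≤ ‖(haupt (nome τ₀))⁻¹‖ := by
  intro hmax
  refine not_isLocalMax_inv_haupt h.1 ?_
  have hn : Continuous fun τ : ℂ => 3 * normSq τ := continuous_const.mul continuous_normSq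
  have o1 : ∀ᶠ τ in 𝓝 τ₀, 1 < 3 * normSq τ := (isOpen_lt continuous_const hn).mem_nhds h1
  have key : ∀ s : ℝ, (s = 1 ∨ s = -1) → ∀ᶠ τ : ℂ in 𝓝 τ₀, 1 / 2 < s * τ.re →
      τ - (s : ℂ) ∈ fundDom := by
    intro s hs
    by_cases hre : s * τ₀.re < 1 / 2
    · have : ∀ᶠ τ : ℂ in 𝓝 τ₀, s * τ.re < 1 / 2 :=
        (isOpen_lt (continuous_const.mul continuous_re) continuous_const).mem_nhds hre
      filter_upwards [this] with τ h2 h3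
      linarith
    · have hre' : s * τ₀.re = 1 / 2 := by
        refine le_antisymm ?_ (not_lt.1 hre)
        have := abs_le.1 h.2.1
        rcases hs with rfl | rfl <;> linarith
      have e1 : 1 < 3 * normSq (τ₀ - s) := by
        have : normSq (τ₀ - s) = normSq τ₀ := by
          simp only [normSq_apply, sub_re, ofReal_re, sub_im, ofReal_im]
          rcases hs with rfl | rfl <;> nlinarith
        rwa [this]
      have o2 : ∀ᶠ τ : ℂ in 𝓝 τ₀, 1 < 3 * normSq (τ - s) :=
        (isOpen_lt continuous_const (hn.comp (continuous_id.sub continuous_const))).mem_nhds e1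
      have o3 : ∀ᶠ τ : ℂ in 𝓝 τ₀, s * τ.re < 1 :=
        (isOpen_lt (continuous_const.mul continuous_re) continuous_const).mem_nhds (by
          show s * τ₀.re < 1
          linarith)
      filter_upwards [o2, o3, isOpen_im_pos.mem_nhds h.1] with τ h2 h3 h4 h5
      refine ⟨by simpa using h4, ?_, h2.le⟩
      rw [abs_le]
      simp only [sub_re, ofReal_re]
      rcases hs with rfl | rfl <;> constructor <;> linarith
  filter_upwards [o1, key 1 (.inl rfl), key (-1) (.inr rfl), isOpen_im_pos.mem_nhds h.1]
    with τ h2 h3 h4 h5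
  simp only [Function.comp_apply]
  rcases lt_or_ge (1 / 2) τ.re with h6 | h6
  · have := hmax _ (h3 (by linarith))
    rwa [show nome (τ - (1 : ℝ)) = nome τ by simpa [sub_eq_add_neg] using nome_add_int τ (-1)] at this
  · rcases lt_or_ge τ.re (-(1 / 2)) with h7 | h7
    · have := hmax _ (h4 (by linarith))
      rwa [show nome (τ - (-1 : ℝ)) = nome τ by simpa using nome_add_int τ 1] at this
    · exact hmax _ ⟨h5, abs_le.2 ⟨h7, h6⟩, h2.le⟩

lemma exists_im_haupt_gt : ∃ Y : ℝ, 0 < Y ∧ ∀ τ : ℂ, Y ≤ τ.im → 27 < ‖haupt (nome τ)‖ := by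
  have h1 : ContinuousAt unitT 0 :=
    (differentiableOn_unitT.differentiableAt (isOpen_ball.mem_nhds (by simp))).continuousAt
  have h2 : ∀ᶠ q in 𝓝 (0 : ℂ), 1 / 2 < ‖unitT q‖ := by
    refine (isOpen_lt continuous_const continuous_id).mem_nhds ?_ |> h1.norm.eventually
    simp [unitT_zero]; norm_num
  obtain ⟨δ, hδ, hb⟩ := Metric.eventually_nhds_iff_ball.1 h2
  set d := min δ (1 / 54) with hd
  have hd0 : 0 < d := by positivity
  refine ⟨max 1 (-Real.log d), by positivity, fun τ hτ => ?_⟩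
  have hq : ‖nome τ‖ < d := by
    rw [norm_nome, ← Real.lt_log_iff_exp_lt hd0]
    have h3 := (le_max_left _ _).trans hτ
    have h4 := (le_max_right _ _).trans hτ
    nlinarith [Real.pi_gt_three]
  have h3 := hb _ (by simpa using hq.trans_le (min_le_left _ _))
  have h4 : 0 < ‖nome τ‖ := norm_pos_iff.2 (nome_ne_zero τ)
  rw [haupt, norm_div, lt_div_iff₀ h4]
  have := hq.trans_le (min_le_right δ (1 / 54))
  linarith

/-- Since `1/t` is small at the cusp, a value of `|t|` below `27` would force `|1/t|` to attain its
maximum over the domain. The maximum cannot lie off the arc, and on the arc `|t| = 27`. -/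
lemma norm_haupt_ge {τ : ℂ} (h : τ ∈ fundDom) : 27 ≤ ‖haupt (nome τ)‖ := by
  by_contra hlt
  push Not at hlt
  obtain ⟨Y, hY, hbig⟩ := exists_im_haupt_gt
  set C : Set ℂ := {τ | √3 / 6 ≤ τ.im ∧ |τ.re| ≤ 1 / 2 ∧ 1 ≤ 3 * normSq τ ∧ τ.im ≤ Y} with hC
  have hs : 0 < √3 / 6 := by positivity
  have hCF : C ⊆ fundDom := fun τ h => ⟨hs.trans_le h.1, h.2.1, h.2.2.1⟩
  have hFC : ∀ τ ∈ fundDom, τ.im ≤ Y → τ ∈ C := fun τ h h' =>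
    ⟨im_ge_of_mem_fd h.1 h.2.1 h.2.2, h.2.1, h.2.2, h'⟩
  have hCc : IsCompact C := by
    refine Metric.isCompact_of_isClosed_isBounded ?_ ?_
    · exact (isClosed_le continuous_const continuous_im).inter
        ((isClosed_le (continuous_abs.comp continuous_re) continuous_const).inter
        ((isClosed_le continuous_const (continuous_const.mul continuous_normSq)).inter
        (isClosed_le continuous_im continuous_const)))
    · refine (isBounded_iff_forall_norm_le).2 ⟨1 / 2 + Y, fun τ h => ?_⟩
      refine (norm_le_abs_re_add_abs_im τ).trans (add_le_add h.2.1 ?_)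
      rw [abs_of_pos (hCF h).1]; exact h.2.2.2
  have hτY : τ.im ≤ Y := by
    by_contra hY'
    exact absurd (hbig τ (not_le.1 hY').le) (not_lt.2 hlt.le)
  obtain ⟨τ₀, hτ₀, hmax⟩ := hCc.exists_isMaxOn ⟨τ, hFC τ h hτY⟩
    ((differentiableOn_inv_haupt_nome.continuousOn.mono fun τ h => (hCF h).1).norm)
  have hpos : ∀ τ ∈ fundDom, 0 < ‖haupt (nome τ)‖ := fun τ h =>
    norm_pos_iff.2 (haupt_ne_zero (nome_mem_ball h.1) (nome_ne_zero τ))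
  have hlt0 : ‖haupt (nome τ₀)‖ < 27 := by
    have := hmax (hFC τ h hτY)
    simp only [norm_inv, Set.mem_ofPred_eq] at this
    rw [inv_le_inv₀ (hpos _ h) (hpos _ (hCF hτ₀))] at this
    linarith
  refine not_isMaxOn_inv_haupt (hCF hτ₀) ?_ fun w hw => ?_
  · refine lt_of_le_of_ne hτ₀.2.2.1 fun h1 => ?_
    rw [norm_haupt_of_normSq (hCF hτ₀).1 h1.symm] at hlt0
    exact lt_irrefl _ hlt0
  · rcases le_or_gt w.im Y with h1 | h1
    · exact hmax (hFC w hw h1)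
    · rw [norm_inv, norm_inv, inv_le_inv₀ (hpos _ hw) (hpos _ (hCF hτ₀))]
      linarith [hbig w h1.le]

lemma norm_haupt_gt {τ : ℂ} (h : τ ∈ fundDom) (h1 : 1 < 3 * normSq τ) :
    27 < ‖haupt (nome τ)‖ := by
  refine lt_of_le_of_ne (norm_haupt_ge h) fun h2 => not_isMaxOn_inv_haupt h h1 fun w hw => ?_
  rw [norm_inv, norm_inv, ← h2]
  exact inv_anti₀ (by norm_num) (norm_haupt_ge hw)

/-! ### A logarithm of the Hauptmodul -/

/-- Reality of the logarithm on the real diameter fixes the branch; it later yields the exact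
arguments `0` and `π` of `t` at the two ends of the arc. -/
lemma exists_log_unitT : ∃ G : ℂ → ℂ, (∀ q ∈ ball (0 : ℂ) 1, HasDerivAt G (logDeriv unitT q) q) ∧
    (∀ q ∈ ball (0 : ℂ) 1, cexp (G q) = unitT q) ∧ ∀ x : ℝ, |x| < 1 → (G x).im = 0 := by
  have hd : DifferentiableOn ℂ (logDeriv unitT) (ball 0 1) :=
    (differentiableOn_deriv differentiableOn_unitT).div differentiableOn_unitT
      fun _ hq => unitT_ne_zero hq
  obtain ⟨G, hG0, hG⟩ := hd.isExactOn_ball.with_val_at (0 : ℂ) (0 : ℂ)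
  have hb : ∀ x : ℝ, |x| < 1 → (x : ℂ) ∈ ball (0 : ℂ) 1 := fun x hx => by simpa using hx
  refine ⟨G, hG, fun q hq => ?_, fun x hx => ?_⟩
  · have h1 : ∀ q ∈ ball (0 : ℂ) 1, HasDerivAt (fun q => unitT q * cexp (-G q)) 0 q := by
      intro q hq
      refine ((hasDerivAt_of_ball differentiableOn_unitT hq).mul (hG q hq).neg.cexp).congr_deriv ?_
      have := unitT_ne_zero hq
      rw [logDeriv_apply]
      field_simp
      ring
    have h2 := isOpen_ball.is_const_of_deriv_eq_zero (convex_ball (0 : ℂ) 1).isPreconnected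
      (fun q hq => (h1 q hq).differentiableAt.differentiableWithinAt)
      (fun q hq => (h1 q hq).deriv) hq (show (0 : ℂ) ∈ ball (0 : ℂ) 1 by simp)
    simp only [hG0, unitT_zero, neg_zero, Complex.exp_zero, mul_one] at h2
    rw [Complex.exp_neg] at h2
    field_simp at h2
    exact h2.symm
  · have hu : ∀ x : ℝ, |x| < 1 → (deriv unitT x).im = 0 := by
      intro x hx
      have h1 : HasDerivAt (fun y : ℝ => (unitT y).im) (deriv unitT x).im x := by
        have := (hasDerivAt_of_ball differentiableOn_unitT (hb x hx)).comp_ofReal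
        exact (imCLM.hasFDerivAt.comp_hasDerivAt x this)
      refine h1.unique ?_
      refine (hasDerivAt_const x (0 : ℝ)).congr_of_eventuallyEq ?_
      filter_upwards [(isOpen_lt continuous_abs continuous_const).mem_nhds hx] with y hy
      obtain ⟨r, -, h2⟩ := unitT_ofReal hy
      simp [h2]
    have h3 : ∀ x ∈ Set.Ioo (-1 : ℝ) 1, HasDerivAt (fun y : ℝ => (G y).im) 0 x := by
      intro x hx
      have hx' : |x| < 1 := abs_lt.2 hx
      have h1 : HasDerivAt (fun y : ℝ => (G y).im) (logDeriv unitT x).im x :=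
        imCLM.hasFDerivAt.comp_hasDerivAt x (hG x (hb x hx')).comp_ofReal
      refine h1.congr_deriv ?_
      obtain ⟨r, -, h2⟩ := unitT_ofReal hx'
      rw [logDeriv_apply, h2, div_ofReal_im, hu x hx', zero_div]
    have h4 := isOpen_Ioo.is_const_of_deriv_eq_zero isPreconnected_Ioo
      (fun q hq => (h3 q hq).differentiableAt.differentiableWithinAt)
      (fun q hq => (h3 q hq).deriv) (abs_lt.1 hx) (show (0 : ℝ) ∈ Set.Ioo (-1 : ℝ) 1 by simp)
    simpa [hG0] using h4

/-- A holomorphic logarithm of `haupt ∘ nome` which is real on the imaginary axis. -/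
lemma exists_log_haupt : ∃ Λ : ℂ → ℂ,
    (∀ τ : ℂ, 0 < τ.im → HasDerivAt Λ (-(2 * Real.pi * I * formA (nome τ))) τ) ∧
    (∀ τ : ℂ, 0 < τ.im → cexp (Λ τ) = haupt (nome τ)) ∧
    (Λ iThree).im = 0 ∧ (Λ rho).im = Real.pi := by
  obtain ⟨G, hG, hexp, hre⟩ := exists_log_unitT
  have him : ∀ (τ : ℂ) (x : ℝ), 0 < τ.im → nome τ = x → (G (nome τ)).im = 0 := by
    intro τ x hτ hx
    rw [hx]
    refine hre x ?_
    have := norm_nome_lt_one hτ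
    rwa [hx, norm_real] at this
  refine ⟨fun τ => -(2 * Real.pi * I * τ) + G (nome τ), fun τ hτ => ?_, fun τ hτ => ?_, ?_, ?_⟩
  · have h1 : HasDerivAt (fun τ : ℂ => -(2 * Real.pi * I * τ)) (-(2 * Real.pi * I)) τ := by
      simpa using ((hasDerivAt_id τ).const_mul (2 * Real.pi * I)).fun_neg
    refine (h1.add (hasDerivAt_comp_nome (hG _ (nome_mem_ball hτ)))).congr_deriv ?_
    rw [formA]; ring
  · rw [Complex.exp_add, hexp _ (nome_mem_ball hτ), haupt, Complex.exp_neg, nome]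
    field_simp
  · have h1 : nome iThree = ((Real.exp (-(2 * Real.pi * (√3 / 3))) : ℝ) : ℂ) := by
      rw [nome, ofReal_exp]; congr 1
      apply Complex.ext <;> simp [iThree]
    rw [add_im, him _ _ iThree_im_pos h1]
    simp [iThree]
  · have h1 : nome rho = ((-Real.exp (-(2 * Real.pi * (√3 / 6))) : ℝ) : ℂ) := by
      have : nome rho = cexp (-(2 * Real.pi * (√3 / 6) : ℝ)) * cexp (-(Real.pi * I)) := by
        rw [nome, ← Complex.exp_add]; congr 1
        apply Complex.ext
        · simp [rho]
        · simp [rho]; ring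
      rw [this, Complex.exp_neg (Real.pi * I), Complex.exp_pi_mul_I]
      push_cast
      norm_num
    rw [add_im, him _ _ rho_im_pos h1]
    simp [rho]
    ring

/-! ### The arc of radius `1/√3` -/

/-- The point `e^{iθ}/√3`. -/
def arc (θ : ℝ) : ℂ := cexp (I * θ) / (√3 : ℝ)

lemma sqrt_three_pos : 0 < √(3 : ℝ) := by positivity

lemma arc_im (θ : ℝ) : (arc θ).im = Real.sin θ / √3 := by
  rw [arc, div_ofReal_im, mul_comm, exp_ofReal_mul_I_im]

lemma arc_re (θ : ℝ) : (arc θ).re = Real.cos θ / √3 := by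
  rw [arc, div_ofReal_re, mul_comm, exp_ofReal_mul_I_re]

lemma three_mul_normSq_arc (θ : ℝ) : 3 * normSq (arc θ) = 1 := by
  rw [normSq_apply, arc_im, arc_re]
  have h1 := sqrt_three_sq
  have h2 := sqrt_three_pos
  field_simp
  nlinarith [Real.sin_sq_add_cos_sq θ]

lemma arc_im_pos {θ : ℝ} (h : θ ∈ Set.Ioo 0 Real.pi) : 0 < (arc θ).im := by
  rw [arc_im]; exact div_pos (Real.sin_pos_of_mem_Ioo h) sqrt_three_pos

lemma hasDerivAt_arc (θ : ℝ) : HasDerivAt arc (I * arc θ) θ := by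
  have h1 : HasDerivAt (fun x : ℝ => I * (x : ℂ)) I θ := by
    simpa using (ofRealCLM.hasDerivAt (x := θ)).const_mul I
  refine (h1.cexp.div_const _).congr_deriv ?_
  rw [arc]; ring

lemma arc_pi_div_two : arc (Real.pi / 2) = iThree := by
  have h1 := sqrt_three_sq
  have h2 := sqrt_three_pos
  apply Complex.ext
  · rw [arc_re]; simp [iThree]
  · rw [arc_im]; simp [iThree]; field_simp; linarith

lemma cos_five_pi_div_six : Real.cos (5 * Real.pi / 6) = -(√3 / 2) := by
  rw [show 5 * Real.pi / 6 = Real.pi - Real.pi / 6 by ring, Real.cos_pi_sub, Real.cos_pi_div_six]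

lemma sin_five_pi_div_six : Real.sin (5 * Real.pi / 6) = 1 / 2 := by
  rw [show 5 * Real.pi / 6 = Real.pi - Real.pi / 6 by ring, Real.sin_pi_sub, Real.sin_pi_div_six]

lemma arc_five_pi_div_six : arc (5 * Real.pi / 6) = rho := by
  have h1 := sqrt_three_sq
  have h2 := sqrt_three_pos
  apply Complex.ext
  · rw [arc_re, cos_five_pi_div_six]; simp [rho]; field_simp
  · rw [arc_im, sin_five_pi_div_six]; simp [rho]; field_simp; linarith

lemma abs_arc_re_lt {θ : ℝ} (h : θ ∈ Set.Ioo (Real.pi / 6) (5 * Real.pi / 6)) :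
    |(arc θ).re| < 1 / 2 := by
  have h1 := sqrt_three_sq
  have h2 := sqrt_three_pos
  have hpi := Real.pi_pos
  have h3 : Real.cos θ < √3 / 2 := by
    rw [← Real.cos_pi_div_six]
    exact Real.cos_lt_cos_of_nonneg_of_le_pi (by positivity) (by linarith [h.2]) h.1
  have h4 : -(√3 / 2) < Real.cos θ := by
    rw [← cos_five_pi_div_six]
    exact Real.cos_lt_cos_of_nonneg_of_le_pi (by linarith [h.1]) (by linarith) h.2
  rw [arc_re, abs_lt]
  constructor
  · rw [lt_div_iff₀ h2]; linarith
  · rw [div_lt_iff₀ h2]; linarith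

/-- The argument of the Hauptmodul along the arc. -/
lemma exists_arcAngle : ∃ Φ : ℝ → ℝ, (∀ θ ∈ Set.Ioo 0 Real.pi, ContinuousAt Φ θ) ∧
    (∀ θ ∈ Set.Ioo (Real.pi / 6) (5 * Real.pi / 6),
      HasDerivAt Φ (2 * Real.pi / √3 * ‖formA (nome (arc θ))‖) θ) ∧
    (∀ θ ∈ Set.Ioo 0 Real.pi, haupt (nome (arc θ)) = 27 * cexp (I * Φ θ)) ∧
    Φ (Real.pi / 2) = 0 ∧ Φ (5 * Real.pi / 6) = Real.pi := by
  obtain ⟨Λ, hΛ, hexp, hi, hρ⟩ := exists_log_haupt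
  have hd : ∀ θ ∈ Set.Ioo 0 Real.pi, HasDerivAt (fun x => Λ (arc x))
      (-(2 * Real.pi * I * formA (nome (arc θ))) * (I * arc θ)) θ := fun θ hθ =>
    (hΛ _ (arc_im_pos hθ)).comp_of_eq θ (hasDerivAt_arc θ) rfl
  have hdim : ∀ θ ∈ Set.Ioo 0 Real.pi, HasDerivAt (fun x => (Λ (arc x)).im)
      (-(2 * Real.pi * I * formA (nome (arc θ))) * (I * arc θ)).im θ := fun θ hθ =>
    imCLM.hasFDerivAt.comp_hasDerivAt θ (hd θ hθ)
  have hdre : ∀ θ ∈ Set.Ioo 0 Real.pi, HasDerivAt (fun x => (Λ (arc x)).re)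
      (-(2 * Real.pi * I * formA (nome (arc θ))) * (I * arc θ)).re θ := fun θ hθ =>
    reCLM.hasFDerivAt.comp_hasDerivAt θ (hd θ hθ)
  have hlog : ∀ τ : ℂ, 0 < τ.im → (Λ τ).re = Real.log ‖haupt (nome τ)‖ := by
    intro τ hτ
    rw [← hexp τ hτ, norm_exp, Real.log_exp]
  have hre : ∀ θ ∈ Set.Ioo 0 Real.pi, (Λ (arc θ)).re = Real.log 27 := by
    intro θ hθ
    rw [hlog _ (arc_im_pos hθ), norm_haupt_of_normSq (arc_im_pos hθ) (three_mul_normSq_arc θ)]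
  refine ⟨fun θ => (Λ (arc θ)).im, fun θ hθ => (hdim θ hθ).continuousAt, fun θ hθ => ?_,
    fun θ hθ => ?_, by simp only [arc_pi_div_two, hi], by simp only [arc_five_pi_div_six, hρ]⟩
  · have hpi := Real.pi_pos
    have hθ' : θ ∈ Set.Ioo 0 Real.pi := ⟨by linarith [hθ.1], by linarith [hθ.2]⟩
    refine (hdim θ hθ').congr_deriv ?_
    set X : ℂ := -(2 * Real.pi * I * formA (nome (arc θ))) * arc θ with hX
    have e1 : -(2 * Real.pi * I * formA (nome (arc θ))) * (I * arc θ) = I * X := by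
      rw [hX]; ring
    -- `|t|` is constant along the arc, so the tangential derivative of `Re Λ` vanishes.
    have hXim : X.im = 0 := by
      have h1 : (I * X).re = 0 := by
        rw [← e1]
        refine (hdre θ hθ').unique ((hasDerivAt_const θ (Real.log 27)).congr_of_eventuallyEq ?_)
        filter_upwards [isOpen_Ioo.mem_nhds hθ'] with x hx using hre x hx
      simpa using h1
    -- Moving radially outwards enters the fundamental domain, where `|t| ≥ 27`, so the radial
    -- derivative of `log |t|` is nonnegative. By the Cauchy–Riemann equations it is the derivative
    -- of the argument along the arc.
    have hXre : 0 ≤ X.re := by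
      have h1 : HasDerivAt (fun s : ℝ => (Λ ((s : ℂ) * arc θ)).re) X.re 1 := by
        have h2 : HasDerivAt (fun s : ℝ => (s : ℂ) * arc θ) (arc θ) 1 := by
          simpa using (ofRealCLM.hasDerivAt (x := (1 : ℝ))).mul_const (arc θ)
        have h3 := (hΛ _ (arc_im_pos hθ')).comp_of_eq 1 h2 (by simp)
        exact reCLM.hasFDerivAt.comp_hasDerivAt 1 h3
      have h4 := h1.tendsto_slope.mono_left (nhdsWithin_mono 1 (fun x (hx : 1 < x) => hx.ne') :
        𝓝[>] (1 : ℝ) ≤ 𝓝[≠] 1)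
      refine ge_of_tendsto h4 ?_
      have h5 : ∀ᶠ s : ℝ in 𝓝 1, |s * (arc θ).re| < 1 / 2 := by
        refine (isOpen_lt (continuous_abs.comp (continuous_id.mul continuous_const))
          continuous_const).mem_nhds ?_
        simpa using abs_arc_re_lt hθ
      filter_upwards [self_mem_nhdsWithin, h5.filter_mono nhdsWithin_le_nhds] with s hs1 hs2
      have hs1' : (1 : ℝ) < s := hs1
      have hmem : (s : ℂ) * arc θ ∈ fundDom := by
        refine ⟨?_, ?_, ?_⟩
        · rw [im_ofReal_mul]; exact mul_pos (by linarith) (arc_im_pos hθ')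
        · rw [re_ofReal_mul]; exact hs2.le
        · have := three_mul_normSq_arc θ
          rw [normSq_mul, normSq_ofReal]
          nlinarith
      rw [slope_def_field]
      refine div_nonneg ?_ (by linarith)
      simp only [ofReal_one, one_mul]
      rw [hre θ hθ', hlog _ hmem.1, sub_nonneg]
      exact Real.log_le_log (by norm_num) (norm_haupt_ge hmem)
    have hXn : ‖X‖ = X.re := by
      rw [← Complex.re_add_im X, hXim]
      simp [abs_of_nonneg hXre]
    have harc : ‖arc θ‖ = 1 / √3 := by
      rw [arc, norm_div, mul_comm, norm_exp_ofReal_mul_I, norm_real, Real.norm_eq_abs,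
        abs_of_pos sqrt_three_pos]
    rw [e1, show (I * X).im = X.re by simp, ← hXn, hX]
    simp only [norm_mul, norm_neg, norm_real, norm_I, harc, Real.norm_eq_abs, abs_of_pos hpi,
      norm_ofNat]
    ring
  · have h1 : Λ (arc θ) = Real.log 27 + I * (Λ (arc θ)).im := by
      rw [← hre θ hθ]
      nth_rewrite 1 [← Complex.re_add_im (Λ (arc θ))]
      ring
    rw [← hexp _ (arc_im_pos hθ), h1, Complex.exp_add, ← ofReal_exp, Real.exp_log (by norm_num)]
    simp

lemma formA_arc_not_eventually_zero {θ : ℝ} (h : θ ∈ Set.Ioo 0 Real.pi) :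
    ¬ ∀ᶠ x in 𝓝 θ, formA (nome (arc x)) = 0 := by
  intro hz
  have hd : HasDerivAt (fun x => nome (arc x)) (2 * Real.pi * I * nome (arc θ) * (I * arc θ)) θ :=
    (hasDerivAt_nome _).comp_of_eq θ (hasDerivAt_arc θ) rfl
  have hne : 2 * Real.pi * I * nome (arc θ) * (I * arc θ) ≠ 0 :=
    mul_ne_zero (mul_ne_zero two_pi_I_ne_zero (nome_ne_zero _))
      (mul_ne_zero I_ne_zero (ne_zero_of_im_pos (arc_im_pos h)))
  have ht : Tendsto (fun x => nome (arc x)) (𝓝[≠] θ) (𝓝[≠] (nome (arc θ))) :=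
    hd.tendsto_nhdsNE hne
  have hf : ∃ᶠ q in 𝓝[≠] (nome (arc θ)), formA q = 0 :=
    ht.frequently (hz.filter_mono nhdsWithin_le_nhds).frequently
  have h1 := (differentiableOn_formA.analyticOnNhd
    isOpen_ball).eqOn_zero_of_preconnected_of_frequently_eq_zero
    (convex_ball (0 : ℂ) 1).isPreconnected (nome_mem_ball (arc_im_pos h)) hf
  have h2 := h1 (show (0 : ℂ) ∈ ball (0 : ℂ) 1 by simp)
  rw [formA_zero] at h2
  exact one_ne_zero h2

lemma jInv_of_haupt {q : ℂ} {φ : ℝ} (h : haupt q = 27 * cexp (I * φ)) :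
    jInv q = ((54 + 54 * Real.cos φ : ℝ) : ℂ) := by
  rw [jInv, h]
  have h1 := Complex.exp_ne_zero (I * φ)
  have h2 : 729 / (27 * cexp (I * φ)) = 27 * cexp (-(I * φ)) := by
    rw [Complex.exp_neg]; field_simp; norm_num
  rw [h2]
  push_cast
  rw [Complex.cos]
  ring_nf

/-- Along the arc from `i/√3` to `ρ`, the argument of the Hauptmodul increases from `0` to `π`. -/
lemma exists_arcAngle_strictMono : ∃ Φ : ℝ → ℝ,
    ContinuousOn Φ (Set.Icc (Real.pi / 2) (5 * Real.pi / 6)) ∧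
    StrictMonoOn Φ (Set.Icc (Real.pi / 2) (5 * Real.pi / 6)) ∧
    (∀ θ ∈ Set.Ioo (Real.pi / 2) (5 * Real.pi / 6),
      HasDerivAt Φ (2 * Real.pi / √3 * ‖formA (nome (arc θ))‖) θ) ∧
    (∀ θ ∈ Set.Icc (Real.pi / 2) (5 * Real.pi / 6),
      jInv (nome (arc θ)) = ((54 + 54 * Real.cos (Φ θ) : ℝ) : ℂ)) ∧
    Φ (Real.pi / 2) = 0 ∧ Φ (5 * Real.pi / 6) = Real.pi := by
  obtain ⟨Φ, hc, hd, ht, h0, h1⟩ := exists_arcAngle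
  have hpi := Real.pi_pos
  have hsub : Set.Icc (Real.pi / 2) (5 * Real.pi / 6) ⊆ Set.Ioo 0 Real.pi := fun θ hθ =>
    ⟨by linarith [hθ.1], by linarith [hθ.2]⟩
  have hsub2 : Set.Ioo (Real.pi / 2) (5 * Real.pi / 6) ⊆
      Set.Ioo (Real.pi / 6) (5 * Real.pi / 6) := fun θ hθ => ⟨by linarith [hθ.1], hθ.2⟩
  have hj : ∀ θ ∈ Set.Icc (Real.pi / 2) (5 * Real.pi / 6),
      jInv (nome (arc θ)) = ((54 + 54 * Real.cos (Φ θ) : ℝ) : ℂ) := fun θ hθ =>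
    jInv_of_haupt (ht θ (hsub hθ))
  have hcont : ContinuousOn Φ (Set.Icc (Real.pi / 2) (5 * Real.pi / 6)) := fun θ hθ =>
    (hc θ (hsub hθ)).continuousWithinAt
  have hmono : MonotoneOn Φ (Set.Icc (Real.pi / 2) (5 * Real.pi / 6)) := by
    refine monotoneOn_of_deriv_nonneg (convex_Icc _ _) hcont ?_ ?_
    · rw [interior_Icc]
      exact fun θ hθ => (hd θ (hsub2 hθ)).differentiableAt.differentiableWithinAt
    · rw [interior_Icc]
      intro θ hθ
      rw [(hd θ (hsub2 hθ)).deriv]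
      positivity
  have hle : Real.pi / 2 ≤ 5 * Real.pi / 6 := by linarith
  -- If `Φ` reached `π` early, monotonicity would make it constant up to the endpoint and `A` would
  -- vanish on an arc, hence identically.
  have hlt : ∀ θ ∈ Set.Ioo (Real.pi / 2) (5 * Real.pi / 6), Φ θ < Real.pi := by
    intro θ hθ
    refine lt_of_le_of_ne (h1 ▸ hmono (Set.Ioo_subset_Icc_self hθ) (Set.right_mem_Icc.2 hle)
      hθ.2.le) fun heq => ?_
    have hc1 : ∀ x ∈ Set.Ioo θ (5 * Real.pi / 6), Φ x = Real.pi := by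
      intro x hx
      have hx' : x ∈ Set.Icc (Real.pi / 2) (5 * Real.pi / 6) := ⟨by linarith [hθ.1, hx.1], hx.2.le⟩
      refine le_antisymm (h1 ▸ hmono hx' (Set.right_mem_Icc.2 hle) hx.2.le) ?_
      rw [← heq]
      exact hmono (Set.Ioo_subset_Icc_self hθ) hx' hx.1.le
    have hc2 : ∀ x ∈ Set.Ioo θ (5 * Real.pi / 6), formA (nome (arc x)) = 0 := by
      intro x hx
      have hx' : x ∈ Set.Ioo (Real.pi / 2) (5 * Real.pi / 6) := ⟨by linarith [hθ.1, hx.1], hx.2⟩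
      have h2 : 2 * Real.pi / √3 * ‖formA (nome (arc x))‖ = 0 := by
        refine (hd x (hsub2 hx')).unique
          ((hasDerivAt_const x Real.pi).congr_of_eventuallyEq ?_)
        filter_upwards [isOpen_Ioo.mem_nhds hx] with y hy using hc1 y hy
      have h3 : 2 * Real.pi / √3 ≠ 0 := by have := sqrt_three_pos; positivity
      simpa [h3] using h2
    have hmid : (θ + 5 * Real.pi / 6) / 2 ∈ Set.Ioo θ (5 * Real.pi / 6) :=
      ⟨by linarith [hθ.2], by linarith [hθ.2]⟩
    refine formA_arc_not_eventually_zero (θ := (θ + 5 * Real.pi / 6) / 2)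
      ⟨by linarith [hmid.1, hθ.1], by linarith [hmid.2]⟩ ?_
    filter_upwards [isOpen_Ioo.mem_nhds hmid] with x hx using hc2 x hx
  refine ⟨Φ, hcont, ?_, fun θ hθ => hd θ (hsub2 hθ), hj, h0, h1⟩
  refine strictMonoOn_of_deriv_pos (convex_Icc _ _) hcont ?_
  rw [interior_Icc]
  intro θ hθ
  rw [(hd θ (hsub2 hθ)).deriv]
  have hθ' := Set.Ioo_subset_Icc_self hθ
  have h2 : 0 ≤ Φ θ := h0 ▸ hmono (Set.left_mem_Icc.2 hle) hθ' hθ.1.le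
  have h3 : -1 < Real.cos (Φ θ) := by
    rw [← Real.cos_pi]
    exact Real.cos_lt_cos_of_nonneg_of_le_pi h2 le_rfl (hlt θ hθ)
  have h4 : formA (nome (arc θ)) ≠ 0 := by
    refine formA_ne_zero (nome_mem_ball (arc_im_pos (hsub hθ'))) (nome_ne_zero _) ?_
    rw [hj θ hθ', ofReal_ne_zero]
    linarith
  have := sqrt_three_pos
  positivity

lemma exists_jInv_arc {θ : ℝ} (hθ : θ ∈ Set.Ioo (Real.pi / 2) (5 * Real.pi / 6)) :
    ∃ c : ℝ, 0 < c ∧ c < 108 ∧ jInv (nome (arc θ)) = c := by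
  obtain ⟨Φ, -, hm, -, hj, h0, h1⟩ := exists_arcAngle_strictMono
  have hθ' := Set.Ioo_subset_Icc_self hθ
  have hle : Real.pi / 2 ≤ 5 * Real.pi / 6 := by linarith [Real.pi_pos]
  have h2 : 0 < Φ θ := h0 ▸ hm (Set.left_mem_Icc.2 hle) hθ' hθ.1
  have h3 : Φ θ < Real.pi := h1 ▸ hm hθ' (Set.right_mem_Icc.2 hle) hθ.2
  refine ⟨_, ?_, ?_, hj θ hθ'⟩
  · have := Real.cos_lt_cos_of_nonneg_of_le_pi h2.le le_rfl h3
    rw [Real.cos_pi] at this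
    linarith
  · have := Real.cos_lt_cos_of_nonneg_of_le_pi le_rfl h3.le h2
    rw [Real.cos_zero] at this
    linarith

lemma exists_arc_eq {τ : ℂ} (him : 0 < τ.im) (hn : 3 * normSq τ = 1) (h1 : -(1 / 2) ≤ τ.re)
    (h2 : τ.re ≤ 0) : ∃ θ ∈ Set.Icc (Real.pi / 2) (5 * Real.pi / 6), arc θ = τ := by
  have hs := sqrt_three_sq
  have hs0 := sqrt_three_pos
  have hpi := Real.pi_pos
  rw [normSq_apply] at hn
  have hb1 : -1 ≤ √3 * τ.re := by nlinarith
  have hcos : Real.cos (Real.arccos (√3 * τ.re)) = √3 * τ.re :=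
    Real.cos_arccos hb1 (by nlinarith)
  refine ⟨Real.arccos (√3 * τ.re), ⟨?_, ?_⟩, ?_⟩
  · rw [← Real.arccos_zero]
    exact Real.arccos_le_arccos (by nlinarith)
  · rw [← Real.arccos_cos (x := 5 * Real.pi / 6) (by linarith) (by linarith), cos_five_pi_div_six]
    exact Real.arccos_le_arccos (by nlinarith)
  · apply Complex.ext
    · rw [arc_re, hcos]; field_simp
    · rw [arc_im, Real.sin_arccos, show 1 - (√3 * τ.re) ^ 2 = (√3 * τ.im) ^ 2 by
        rw [mul_pow, mul_pow, hs]; linarith, Real.sqrt_sq (by positivity)]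
      field_simp

/-- `x` is a root of `x² + (54 - c)x + 729`, whose discriminant is negative for `0 < c < 108`; the
roots are conjugate with product `27²`. -/
lemma norm_eq_of_add_div_real {x : ℂ} {c : ℝ} (h0 : x ≠ 0) (hc0 : 0 < c) (hc1 : c < 108)
    (h : x + 54 + 729 / x = c) : ‖x‖ = 27 := by
  have h1 : x * x + (54 - c) * x + 729 = 0 := by
    field_simp at h; linear_combination h
  have hre := congrArg re h1
  have him := congrArg im h1
  simp at hre him
  have h2 : x.im ≠ 0 := by
    intro h3
    rw [h3] at hre
    nlinarith [sq_nonneg (x.re + (54 - c) / 2)]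
  have h3 : 2 * x.re + (54 - c) = 0 := by
    apply mul_left_cancel₀ h2; linarith
  have h4 : ‖x‖ ^ 2 = 27 ^ 2 := by
    rw [← normSq_eq_norm_sq, normSq_apply]
    nlinarith
  exact (pow_left_inj₀ (norm_nonneg _) (by norm_num) two_ne_zero).1 h4

/-- The Hauptmodul takes its value at a point `z` of the open arc only at `z` and `-1/(3z)`
in the fundamental domain. -/
theorem eq_or_eq_of_jInv_eq {θ : ℝ} (hθ : θ ∈ Set.Ioo (Real.pi / 2) (5 * Real.pi / 6)) {τ : ℂ}
    (hτ : τ ∈ fundDom) (h : jInv (nome τ) = jInv (nome (arc θ))) :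
    τ = arc θ ∨ τ = fricke (arc θ) := by
  obtain ⟨c, hc0, hc1, hc⟩ := exists_jInv_arc hθ
  have hpi := Real.pi_pos
  have hz := arc_im_pos (θ := θ) ⟨by linarith [hθ.1], by linarith [hθ.2]⟩
  have hn1 : 3 * normSq τ = 1 := by
    by_contra hne
    have h1 := norm_haupt_gt hτ (lt_of_le_of_ne hτ.2.2 (Ne.symm hne))
    have h2 := norm_eq_of_add_div_real (haupt_ne_zero (nome_mem_ball hτ.1) (nome_ne_zero _)) hc0 hc1
      (show jInv (nome τ) = c by rw [h, hc])
    linarith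
  obtain ⟨Φ, -, hm, -, hj, h0, h1⟩ := exists_arcAngle_strictMono
  have hle : Real.pi / 2 ≤ 5 * Real.pi / 6 := by linarith
  have hθ' := Set.Ioo_subset_Icc_self hθ
  have hrange : ∀ x ∈ Set.Icc (Real.pi / 2) (5 * Real.pi / 6), Φ x ∈ Set.Icc 0 Real.pi :=
    fun x hx => ⟨h0 ▸ hm.monotoneOn (Set.left_mem_Icc.2 hle) hx hx.1,
      h1 ▸ hm.monotoneOn hx (Set.right_mem_Icc.2 hle) hx.2⟩
  have key : ∀ w : ℂ, 0 < w.im → 3 * normSq w = 1 → -(1 / 2) ≤ w.re → w.re ≤ 0 →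
      jInv (nome w) = jInv (nome (arc θ)) → w = arc θ := by
    intro w w1 w2 w3 w4 w5
    obtain ⟨x, hx, rfl⟩ := exists_arc_eq w1 w2 w3 w4
    rw [hj x hx, hj θ hθ', ofReal_inj] at w5
    have := Real.injOn_cos (hrange x hx) (hrange θ hθ') (by linarith)
    rw [hm.injOn hx hθ' this]
  have hre' := abs_le.1 hτ.2.1
  rcases le_or_gt τ.re 0 with h3 | h3
  · exact .inl (key τ hτ.1 hn1 hre'.1 h3 h)
  · have e := fricke_of_normSq hn1
    have h4 := key (fricke τ) (fricke_im_pos hτ.1) (by rw [e, normSq_neg, normSq_conj, hn1])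
      (by rw [e]; simp; linarith) (by rw [e]; simp; linarith)
      (by rw [jInv_fricke hτ.1, h])
    right
    rw [← h4, fricke_fricke (ne_zero_of_im_pos hτ.1)]

/-- The Hauptmodul separates the orbits of points of the open arc. -/
theorem orb_of_jInv_eq {θ : ℝ} (hθ : θ ∈ Set.Ioo (Real.pi / 2) (5 * Real.pi / 6)) {τ : ℂ}
    (hτ : 0 < τ.im) (h : jInv (nome τ) = jInv (nome (arc θ))) : Orb (arc θ) τ := by
  obtain ⟨τ', hO, hre, hn⟩ := exists_orb_mem_fd hτ
  refine Orb.trans ?_ (hO.symm hτ)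
  rcases eq_or_eq_of_jInv_eq hθ ⟨hO.im_pos hτ, hre, hn⟩ ((hO.jInv_eq hτ).trans h) with h1 | h1
  · rw [h1]; exact .refl
  · rw [h1]; exact Orb.refl.fricke

/-! ### Bounds for Euler's product -/

lemma tendsto_prod_eulerProd {q : ℂ} (hq : q ∈ ball (0 : ℂ) 1) :
    Tendsto (fun n : ℕ => ∏ i ∈ Finset.range n, ‖1 - q ^ (i + 1)‖) atTop (𝓝 ‖eulerProd q‖) := by
  have h := (ModularForm.multipliable_one_sub_pow (by simpa using hq)).hasProd.tendsto_prod_nat.norm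
  simpa only [norm_prod, eulerProd] using h

lemma sum_range_pow_succ_le {R : ℝ} (h0 : 0 ≤ R) (h1 : R < 1) (k n : ℕ) :
    ∑ i ∈ Finset.range n, R ^ (k + i + 1) ≤ R ^ (k + 1) / (1 - R) := by
  have h2 : ∑ i ∈ Finset.range n, R ^ (k + i + 1) = R ^ (k + 1) * ∑ i ∈ Finset.range n, R ^ i := by
    rw [Finset.mul_sum]
    exact Finset.sum_congr rfl fun i _ => by ring
  rw [h2, div_eq_mul_inv]
  refine mul_le_mul_of_nonneg_left ?_ (by positivity)
  rw [← tsum_geometric_of_lt_one h0 h1]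
  exact (summable_geometric_of_lt_one h0 h1).sum_le_tsum _ fun _ _ => by positivity

lemma norm_eulerProd_le {q : ℂ} {R : ℝ} (hq : ‖q‖ ≤ R) (hR : R < 1) :
    ‖eulerProd q‖ ≤ Real.exp (R / (1 - R)) := by
  have h0 : 0 ≤ R := (norm_nonneg _).trans hq
  refine le_of_tendsto (tendsto_prod_eulerProd (by simpa using hq.trans_lt hR))
    (Eventually.of_forall fun n => ?_)
  calc ∏ i ∈ Finset.range n, ‖1 - q ^ (i + 1)‖
      ≤ ∏ i ∈ Finset.range n, Real.exp (R ^ (0 + i + 1)) := by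
        refine Finset.prod_le_prod (fun _ _ => norm_nonneg _) fun i _ => ?_
        have h1 : ‖q ^ (i + 1)‖ ≤ R ^ (0 + i + 1) := by
          rw [norm_pow, zero_add]; gcongr
        have h2 := Real.add_one_le_exp (R ^ (0 + i + 1))
        have h3 := norm_sub_le (1 : ℂ) (q ^ (i + 1))
        rw [norm_one] at h3
        linarith
    _ = Real.exp (∑ i ∈ Finset.range n, R ^ (0 + i + 1)) := (Real.exp_sum _ _).symm
    _ ≤ _ := by
        have := sum_range_pow_succ_le h0 hR 0 n
        rw [zero_add, pow_one] at this
        exact Real.exp_le_exp.2 this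

lemma one_sub_sum_range_le_prod {x : ℕ → ℝ} (h0 : ∀ i, 0 ≤ x i) (h1 : ∀ i, x i ≤ 1) (n : ℕ) :
    1 - ∑ i ∈ Finset.range n, x i ≤ ∏ i ∈ Finset.range n, (1 - x i) := by
  induction n with
  | zero => simp
  | succ n ih =>
    rw [Finset.sum_range_succ, Finset.prod_range_succ]
    have h2 : ∏ i ∈ Finset.range n, (1 - x i) ≤ 1 :=
      Finset.prod_le_one (fun i _ => by linarith [h1 i]) fun i _ => by linarith [h0 i]
    nlinarith [h0 n]

/-- Three factors are kept exactly; the remaining ones are bounded by the inequality `∏(1 - xᵢ) ≥ 1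
- ∑xᵢ` and a geometric series. -/
lemma norm_eulerProd_ge {q : ℂ} {R : ℝ} (hq : ‖q‖ ≤ R) (hR : R < 1)
    (hR' : 0 ≤ 1 - R ^ 4 / (1 - R)) :
    (1 - R) * (1 - R ^ 2) * (1 - R ^ 3) * (1 - R ^ 4 / (1 - R)) ≤ ‖eulerProd q‖ := by
  have h0 : 0 ≤ R := (norm_nonneg _).trans hq
  have hle : ∀ i : ℕ, 1 - R ^ (i + 1) ≤ ‖1 - q ^ (i + 1)‖ := by
    intro i
    have h1 : ‖q ^ (i + 1)‖ ≤ R ^ (i + 1) := by rw [norm_pow]; gcongr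
    have h3 := norm_sub_norm_le (1 : ℂ) (q ^ (i + 1))
    rw [norm_one] at h3
    linarith
  have hpos : ∀ i : ℕ, 0 ≤ 1 - R ^ (i + 1) := fun i => by
    have := pow_le_one₀ (n := i + 1) h0 hR.le
    linarith
  refine ge_of_tendsto (tendsto_prod_eulerProd (by simpa using hq.trans_lt hR))
    (eventually_atTop.2 ⟨3, fun n hn => ?_⟩)
  obtain ⟨k, rfl⟩ := Nat.exists_eq_add_of_le hn
  rw [Finset.prod_range_add, Finset.prod_range_succ, Finset.prod_range_succ,
    Finset.prod_range_one]
  have h3 : 1 - R ^ 4 / (1 - R) ≤ ∏ i ∈ Finset.range k, ‖1 - q ^ (3 + i + 1)‖ := by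
    calc 1 - R ^ 4 / (1 - R) ≤ 1 - ∑ i ∈ Finset.range k, R ^ (3 + i + 1) := by
          have := sum_range_pow_succ_le h0 hR 3 k
          linarith
      _ ≤ ∏ i ∈ Finset.range k, (1 - R ^ (3 + i + 1)) :=
          one_sub_sum_range_le_prod (fun i => by positivity) (fun i => pow_le_one₀ h0 hR.le) k
      _ ≤ _ := Finset.prod_le_prod (fun i _ => hpos _) fun i _ => hle _
  have e0 := hle 0
  have e1 := hle 1
  have e2 := hle 2
  have p0 := hpos 0
  have p1 := hpos 1
  have p2 := hpos 2
  simp only [zero_add, pow_one, Nat.reduceAdd] at e0 e1 e2 p0 p1 p2 ⊢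
  gcongr

/-! ### An algebraic relation between the forms -/

/-- Squaring `AD = (t - 729/t)S` gives `A²D² = j(j - 108)S² = A³S(j - 108)`. Division by `A²` is
possible off the isolated zeros of `A`, and continuity covers these. -/
lemma formD_sq {q : ℂ} (hq : q ∈ ball (0 : ℂ) 1) (h0 : q ≠ 0) :
    formD q ^ 2 = formA q * formS q * (jInv q - 108) := by
  have hana : AnalyticOnNhd ℂ formA (ball 0 1) := differentiableOn_formA.analyticOnNhd isOpen_ball
  have hne : ∀ᶠ w in 𝓝[≠] q, formA w ≠ 0 := by
    by_contra hcon
    have h1 := hana.eqOn_zero_of_preconnected_of_frequently_eq_zero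
      (convex_ball (0 : ℂ) 1).isPreconnected hq (Filter.not_eventually.1 hcon |>.mono fun _ h => not_not.1 h)
    have h2 := h1 (show (0 : ℂ) ∈ ball (0 : ℂ) 1 by simp)
    rw [formA_zero] at h2
    exact one_ne_zero h2
  have hn := isOpen_ball.mem_nhds hq
  have cA := (differentiableOn_formA.differentiableAt hn).continuousAt
  have cD := (differentiableOn_formD.differentiableAt hn).continuousAt
  have cS := (differentiableOn_formS.differentiableAt hn).continuousAt
  have cj := (hasDerivAt_jInv hq h0).continuousAt
  have c1 : Tendsto (fun w => formD w ^ 2) (𝓝[≠] q) (𝓝 (formD q ^ 2)) :=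
    (cD.pow 2).tendsto.mono_left nhdsWithin_le_nhds
  have c2 : Tendsto (fun w => formA w * formS w * (jInv w - 108)) (𝓝[≠] q)
      (𝓝 (formA q * formS q * (jInv q - 108))) :=
    ((cA.mul cS).mul (cj.sub continuousAt_const)).tendsto.mono_left nhdsWithin_le_nhds
  refine tendsto_nhds_unique (c1.congr' ?_) c2
  filter_upwards [hne, mem_nhdsWithin_of_mem_nhds hn,
    mem_nhdsWithin_of_mem_nhds (isOpen_ne.mem_nhds h0)] with w hw hwb hw0
  have e1 := formA_mul_formD hwb hw0
  have e2 := jInv_mul_sub hwb hw0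
  have e3 := formA_pow_three hwb hw0
  apply mul_left_cancel₀ (pow_ne_zero 2 hw)
  have e4 : formA w ^ 2 * formD w ^ 2 = jInv w * (jInv w - 108) * formS w ^ 2 := by
    rw [e2, ← mul_pow, e1]; ring
  rw [e4]
  linear_combination (-(formS w * (jInv w - 108))) * e3

lemma norm_formS_sq {q : ℂ} (hq : q ∈ ball (0 : ℂ) 1) (h0 : q ≠ 0) :
    ‖formS q‖ ^ 2 = ‖haupt q‖ * (‖q‖ ^ 3 * ‖eulerProd (q ^ 3)‖ ^ 24) := by
  have h1 := eulerProd_ne_zero (pow_three_mem_ball hq)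
  rw [← norm_pow, ← norm_pow, ← norm_pow, ← norm_mul, ← norm_mul]
  congr 1
  rw [formS, haupt, unitS, unitT]
  field_simp

lemma norm_formS_eq (q : ℂ) :
    ‖formS q‖ = ‖q‖ * (‖eulerProd q‖ * ‖eulerProd (q ^ 3)‖) ^ 6 := by
  rw [formS, unitS, norm_mul, norm_pow, norm_mul]

lemma norm_haupt_eq (q : ℂ) :
    ‖haupt q‖ = (‖eulerProd q‖ / ‖eulerProd (q ^ 3)‖) ^ 12 / ‖q‖ := by
  rw [haupt, unitT, norm_div, norm_pow, norm_div]

/-- Given bounds on Euler's product at `q` and `q³`, a bound for `A³ = jS`. -/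
lemma norm_formA_pow_three_le {q : ℂ} (hq : q ∈ ball (0 : ℂ) 1) (h0 : q ≠ 0) :
    ‖formA q‖ ^ 3 ≤ ‖eulerProd q‖ ^ 18 / ‖eulerProd (q ^ 3)‖ ^ 6 + 54 * ‖formS q‖ +
      729 * (‖q‖ ^ 2 * ‖eulerProd (q ^ 3)‖ ^ 18 / ‖eulerProd q‖ ^ 6) := by
  have h1 : 0 < ‖eulerProd q‖ := norm_pos_iff.2 (eulerProd_ne_zero hq)
  have h3 : 0 < ‖eulerProd (q ^ 3)‖ := norm_pos_iff.2 (eulerProd_ne_zero (pow_three_mem_ball hq))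
  have h2 : 0 < ‖q‖ := norm_pos_iff.2 h0
  have hj : ‖jInv q‖ ≤ ‖haupt q‖ + 54 + 729 / ‖haupt q‖ := by
    rw [jInv]
    refine (norm_add_le _ _).trans ?_
    refine add_le_add ((norm_add_le _ _).trans ?_) (by rw [norm_div]; simp)
    simp
  rw [← norm_pow, formA_pow_three hq h0, norm_mul]
  refine (mul_le_mul_of_nonneg_right hj (norm_nonneg _)).trans (le_of_eq ?_)
  rw [norm_haupt_eq, norm_formS_eq]
  field_simp

/-! ### Numerical bounds for the exponential function -/

lemma exp_le_taylor {x : ℝ} (h0 : 0 ≤ x) (h1 : x ≤ 1) : Real.exp x ≤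
    1 + x + x ^ 2 / 2 + x ^ 3 / 6 + x ^ 4 / 24 + x ^ 5 / 120 + x ^ 6 * 7 / 4320 := by
  have := Real.exp_bound' h0 h1 (n := 6) (by norm_num)
  simp only [Finset.sum_range_succ, Finset.sum_range_zero, Nat.factorial] at this
  norm_num at this
  linarith

lemma taylor_le_exp {x : ℝ} (h0 : 0 ≤ x) :
    1 + x + x ^ 2 / 2 + x ^ 3 / 6 + x ^ 4 / 24 + x ^ 5 / 120 + x ^ 6 / 720 ≤ Real.exp x := by
  have := Real.sum_le_exp_of_nonneg h0 7
  simp only [Finset.sum_range_succ, Finset.sum_range_zero, Nat.factorial] at this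
  norm_num at this
  linarith

/-- The argument is cut into `n` pieces of length at most `1`, where the Taylor polynomial is sharp.
-/
lemma exp_le_of_taylor_pow {x y b : ℝ} (n : ℕ) (h0 : 0 ≤ y) (h1 : y ≤ 1)
    (hx : x ≤ n * y)
    (h : (1 + y + y ^ 2 / 2 + y ^ 3 / 6 + y ^ 4 / 24 + y ^ 5 / 120 + y ^ 6 * 7 / 4320) ^ n ≤ b) :
    Real.exp x ≤ b := by
  refine (Real.exp_le_exp.2 hx).trans ?_
  rw [Real.exp_nat_mul]
  exact (pow_le_pow_left₀ (Real.exp_nonneg _) (exp_le_taylor h0 h1) n).trans h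

lemma le_exp_of_taylor_pow {x y b : ℝ} (n : ℕ) (h0 : 0 ≤ y) (hx : n * y ≤ x)
    (h : b ≤ (1 + y + y ^ 2 / 2 + y ^ 3 / 6 + y ^ 4 / 24 + y ^ 5 / 120 + y ^ 6 / 720) ^ n) :
    b ≤ Real.exp x := by
  refine h.trans (le_trans ?_ (Real.exp_le_exp.2 hx))
  rw [Real.exp_nat_mul]
  exact pow_le_pow_left₀ (by positivity) (taylor_le_exp h0) n

lemma sqrt_three_gt : 1.73205 < √(3 : ℝ) := Real.lt_sqrt_of_sq_lt (by norm_num)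

lemma sqrt_three_lt : √(3 : ℝ) < 1.73206 := by
  rw [Real.sqrt_lt' (by norm_num)]; norm_num

lemma norm_nome_arc (θ : ℝ) :
    ‖nome (arc θ)‖ = Real.exp (-(2 * Real.pi / √3 * Real.sin θ)) := by
  rw [norm_nome, arc_im]; congr 2; ring

lemma two_pi_div_sqrt_three_lt : 2 * Real.pi / √3 < 3.6277 := by
  rw [div_lt_iff₀ sqrt_three_pos]
  nlinarith [sqrt_three_gt, Real.pi_lt_d4]

lemma lt_two_pi_div_sqrt_three : 3.6275 < 2 * Real.pi / √3 := by
  rw [lt_div_iff₀ sqrt_three_pos]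
  nlinarith [sqrt_three_lt, Real.pi_gt_d6]

lemma norm_nome_arc_ge (θ : ℝ) : 0.0265 ≤ ‖nome (arc θ)‖ := by
  rw [norm_nome_arc, Real.exp_neg, le_inv_comm₀ (by norm_num) (Real.exp_pos _)]
  refine exp_le_of_taylor_pow (y := 0.906925) 4 (by norm_num) (by norm_num) ?_
    (by norm_num)
  have h1 := two_pi_div_sqrt_three_lt
  have h2 := Real.sin_le_one θ
  have h3 := lt_two_pi_div_sqrt_three
  push_cast
  nlinarith

lemma sin_ge_half {θ : ℝ} (hθ : θ ∈ Set.Icc (Real.pi / 2) (5 * Real.pi / 6)) :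
    1 / 2 ≤ Real.sin θ := by
  rw [← sin_five_pi_div_six, ← Real.sin_pi_sub (5 * Real.pi / 6), ← Real.sin_pi_sub θ]
  have hpi := Real.pi_pos
  exact Real.sin_le_sin_of_le_of_le_pi_div_two (by linarith) (by linarith [hθ.1]) (by linarith [hθ.2])

lemma norm_nome_arc_le {θ : ℝ} (hθ : θ ∈ Set.Icc (Real.pi / 2) (5 * Real.pi / 6)) :
    ‖nome (arc θ)‖ ≤ 0.1631 := by
  rw [norm_nome_arc, Real.exp_neg, inv_le_comm₀ (Real.exp_pos _) (by norm_num)]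
  refine le_exp_of_taylor_pow (y := 0.906875) 2 (by norm_num) ?_ (by norm_num)
  have h1 := lt_two_pi_div_sqrt_three
  have h2 := sin_ge_half hθ
  push_cast
  nlinarith

/-- A lower bound for Euler's product on the disc of radius `R`. -/
def eulerLow (R : ℝ) : ℝ := (1 - R) * (1 - R ^ 2) * (1 - R ^ 3) * (1 - R ^ 4 / (1 - R))

lemma one_sub_div_nonneg {R : ℝ} (h0 : 0 ≤ R) (h1 : R ≤ 1 / 2) : 0 ≤ 1 - R ^ 4 / (1 - R) := by
  have h2 : R ^ 4 ≤ (1 / 2) ^ 4 := pow_le_pow_left₀ h0 h1 4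
  have h3 : R ^ 4 / (1 - R) ≤ 1 := (div_le_one (by linarith)).2 (by norm_num at h2; linarith)
  linarith

lemma eulerLow_nonneg {R : ℝ} (h0 : 0 ≤ R) (h1 : R ≤ 1 / 2) : 0 ≤ eulerLow R := by
  have h4 : ∀ n : ℕ, 0 ≤ 1 - R ^ n := fun n =>
    sub_nonneg.2 (pow_le_one₀ h0 (h1.trans (by norm_num)))
  exact mul_nonneg (mul_nonneg (mul_nonneg (by simpa using h4 1) (h4 2)) (h4 3))
    (one_sub_div_nonneg h0 h1)

lemma eulerLow_le {q : ℂ} {R : ℝ} (h : ‖q‖ ≤ R) (h1 : R ≤ 1 / 2) : eulerLow R ≤ ‖eulerProd q‖ :=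
  norm_eulerProd_ge h (h1.trans_lt (by norm_num)) (one_sub_div_nonneg ((norm_nonneg _).trans h) h1)

lemma eulerLow_cube_le {q : ℂ} {R : ℝ} (h : ‖q‖ ≤ R) (h1 : R ≤ 1 / 2) :
    eulerLow (R ^ 3) ≤ ‖eulerProd (q ^ 3)‖ := by
  have h0 : 0 ≤ R := (norm_nonneg _).trans h
  refine eulerLow_le (by rw [norm_pow]; gcongr) ?_
  exact (pow_le_of_le_one h0 (h1.trans (by norm_num)) (by norm_num)).trans h1

lemma norm_formS_ge {q : ℂ} {r R L : ℝ} (h1 : r ≤ ‖q‖) (h2 : ‖q‖ ≤ R) (hR : R ≤ 1 / 2)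
    (hL : L ≤ r * (eulerLow R * eulerLow (R ^ 3)) ^ 6) : L ≤ ‖formS q‖ := by
  have hR0 : 0 ≤ R := (norm_nonneg _).trans h2
  have hR3 : R ^ 3 ≤ 1 / 2 :=
    (pow_le_of_le_one hR0 (hR.trans (by norm_num)) (by norm_num)).trans hR
  have e1 := eulerLow_le h2 hR
  have e2 := eulerLow_cube_le h2 hR
  have k2 := eulerLow_nonneg hR0 hR
  have k4 := eulerLow_nonneg (pow_nonneg hR0 3) hR3
  rw [norm_formS_eq]
  refine hL.trans ?_
  gcongr

lemma norm_formS_le {q : ℂ} {R U V : ℝ} (h2 : ‖q‖ ≤ R) (hR : R < 1)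
    (hU : Real.exp (R / (1 - R) + R ^ 3 / (1 - R ^ 3)) ≤ U) (hV : R * U ^ 6 ≤ V) :
    ‖formS q‖ ≤ V := by
  have hR0 : 0 ≤ R := (norm_nonneg _).trans h2
  have e1 := norm_eulerProd_le h2 hR
  have e2 := norm_eulerProd_le (q := q ^ 3) (R := R ^ 3) (by rw [norm_pow]; gcongr)
    (pow_lt_one₀ hR0 hR (by norm_num))
  rw [norm_formS_eq]
  refine le_trans ?_ hV
  rw [Real.exp_add] at hU
  have : ‖eulerProd q‖ * ‖eulerProd (q ^ 3)‖ ≤ U := (mul_le_mul e1 e2 (norm_nonneg _)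
    (Real.exp_nonneg _)).trans hU
  gcongr

lemma norm_formS_arc_ge {θ : ℝ} (hθ : θ ∈ Set.Icc (Real.pi / 2) (5 * Real.pi / 6)) :
    0.0073 ≤ ‖formS (nome (arc θ))‖ :=
  norm_formS_ge (norm_nome_arc_ge θ) (norm_nome_arc_le hθ) (by norm_num)
    (by norm_num [eulerLow])

lemma norm_formS_arc_le {θ : ℝ} (hθ : θ ∈ Set.Icc (Real.pi / 2) (5 * Real.pi / 6)) :
    ‖formS (nome (arc θ))‖ ≤ 0.55 := by
  refine norm_formS_le (U := 1.2206) (norm_nome_arc_le hθ) (by norm_num) ?_ (by norm_num)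
  exact exp_le_of_taylor_pow (y := 0.19927) 1 (by norm_num) (by norm_num)
    (by norm_num) (by norm_num)

/-! ### A lower bound for the Hauptmodul on the arc -/

/-- Put `ψ = π - Φ`, so `j = 54 - 54 cos ψ ≥ (108/π²)ψ²`. Then `|A|³ = j|S|` bounds `|A|`, and hence
`-ψ'`, below by a multiple of `ψ^{2/3}`. So `χ = ψ^{1/3}` decreases at least linearly to its zero at
`5π/6`, and `j` is at least a multiple of the sixth power of the distance. -/
lemma jInv_arc_ge {θ c : ℝ} (hθ : θ ∈ Set.Ioo (Real.pi / 2) (5 * Real.pi / 6))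
    (hc : jInv (nome (arc θ)) = c) : (3 / 4 * (5 * Real.pi / 6 - θ)) ^ 6 ≤ c := by
  obtain ⟨Φ, hcont, hm, hd, hj, h0, h1⟩ := exists_arcAngle_strictMono
  have hpi := Real.pi_pos
  have hle : Real.pi / 2 ≤ 5 * Real.pi / 6 := by linarith
  have hψ : ∀ x ∈ Set.Ioo (Real.pi / 2) (5 * Real.pi / 6), 0 < Real.pi - Φ x ∧
      Real.pi - Φ x ≤ Real.pi := by
    intro x hx
    have a1 := hm (Set.Ioo_subset_Icc_self hx) (Set.right_mem_Icc.2 hle) hx.2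
    have a2 := hm (Set.left_mem_Icc.2 hle) (Set.Ioo_subset_Icc_self hx) hx.1
    rw [h1] at a1
    rw [h0] at a2
    constructor <;> linarith
  have hpi2 : Real.pi ^ 2 ≤ 9.8697 := by nlinarith [Real.pi_lt_d4]
  have hjlow : ∀ x ∈ Set.Ioo (Real.pi / 2) (5 * Real.pi / 6),
      108 / 9.8697 * (Real.pi - Φ x) ^ 2 ≤ 54 + 54 * Real.cos (Φ x) := by
    intro x hx
    obtain ⟨a1, a2⟩ := hψ x hx
    have a3 := Real.cos_le_one_sub_mul_cos_sq (x := Real.pi - Φ x) (by rw [abs_of_pos a1]; exact a2)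
    rw [Real.cos_pi_sub] at a3
    have a4 : 2 / 9.8697 ≤ 2 / Real.pi ^ 2 := by gcongr
    have a5 := mul_le_mul_of_nonneg_right a4 (sq_nonneg (Real.pi - Φ x))
    linarith
  set χ : ℝ → ℝ := fun x => (Real.pi - Φ x) ^ (1 / 3 : ℝ) with hχ
  have hχ3 : ∀ x ∈ Set.Ioo (Real.pi / 2) (5 * Real.pi / 6), 0 < χ x ∧
      χ x ^ 3 = Real.pi - Φ x := by
    intro x hx
    have a1 := (hψ x hx).1
    refine ⟨Real.rpow_pos_of_pos a1 _, ?_⟩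
    rw [hχ]
    simp only
    rw [← Real.rpow_natCast, ← Real.rpow_mul a1.le]
    norm_num
  have hχd : ∀ x ∈ Set.Ioo (Real.pi / 2) (5 * Real.pi / 6), HasDerivAt χ
      (-(2 * Real.pi / √3 * ‖formA (nome (arc x))‖) / (3 * χ x ^ 2)) x := by
    intro x hx
    have a1 := (hψ x hx).1
    have a2 := ((hd x hx).const_sub Real.pi).rpow_const (p := (1 / 3 : ℝ)) (.inl a1.ne')
    refine a2.congr_deriv ?_
    have a3 : (Real.pi - Φ x) ^ ((1 : ℝ) / 3 - 1) = (χ x ^ 2)⁻¹ := by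
      rw [hχ]
      simp only
      rw [← Real.rpow_natCast, ← Real.rpow_mul a1.le, ← Real.rpow_neg a1.le]
      norm_num
    rw [a3]
    have := (hχ3 x hx).1.ne'
    field_simp
  -- `0.43³` is just below `0.0073 · 108/9.8697`, where `9.8697` bounds `π²` and `0.0073` is the
  -- lower bound for `|S|` on the arc.
  have hA : ∀ x ∈ Set.Ioo (Real.pi / 2) (5 * Real.pi / 6),
      0.43 * χ x ^ 2 ≤ ‖formA (nome (arc x))‖ := by
    intro x hx
    have hx' := Set.Ioo_subset_Icc_self hx
    have a1 := hjlow x hx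
    have a2 := norm_formS_arc_ge hx'
    obtain ⟨a4, a5⟩ := hχ3 x hx
    refine le_of_pow_le_pow_left₀ (n := 3) (by norm_num) (norm_nonneg _) ?_
    have him := arc_im_pos (θ := x) ⟨by linarith [hx.1], by linarith [hx.2]⟩
    rw [← norm_pow, formA_pow_three (nome_mem_ball him) (nome_ne_zero _), hj x hx', norm_mul,
      norm_real, Real.norm_eq_abs]
    have a6 := le_abs_self (54 + 54 * Real.cos (Φ x))
    calc (0.43 * χ x ^ 2) ^ 3 = 0.43 ^ 3 * (Real.pi - Φ x) ^ 2 := by rw [← a5]; ring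
      _ ≤ (108 / 9.8697 * (Real.pi - Φ x) ^ 2) * 0.0073 := by
        nlinarith [sq_nonneg (Real.pi - Φ x)]
      _ ≤ _ := mul_le_mul (a1.trans a6) a2 (by norm_num) (abs_nonneg _)
  -- The slope `0.519` is `3.6275 · 0.43 / 3` rounded down, `3.6275` being a lower bound for
  -- `2π/√3`.
  have hanti : AntitoneOn (fun x => χ x + 0.519 * x) (Set.Icc θ (5 * Real.pi / 6)) := by
    have hsub : Set.Icc θ (5 * Real.pi / 6) ⊆ Set.Icc (Real.pi / 2) (5 * Real.pi / 6) :=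
      Set.Icc_subset_Icc_left hθ.1.le
    have hdd : ∀ x ∈ Set.Ioo θ (5 * Real.pi / 6), HasDerivAt (fun x => χ x + 0.519 * x)
        (-(2 * Real.pi / √3 * ‖formA (nome (arc x))‖) / (3 * χ x ^ 2) + 0.519) x := by
      intro x hx
      have := (hχd x ⟨hθ.1.trans hx.1, hx.2⟩).add ((hasDerivAt_id x).const_mul 0.519)
      simpa [Pi.add_def] using this
    refine antitoneOn_of_deriv_nonpos (convex_Icc _ _) ?_ ?_ ?_
    · refine ContinuousOn.add ?_ (by fun_prop)
      exact (continuousOn_const.sub (hcont.mono hsub)).rpow_const fun _ _ => .inr (by norm_num)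
    · rw [interior_Icc]
      exact fun x hx => (hdd x hx).differentiableAt.differentiableWithinAt
    · rw [interior_Icc]
      intro x hx
      rw [(hdd x hx).deriv]
      have hx' : x ∈ Set.Ioo (Real.pi / 2) (5 * Real.pi / 6) := ⟨hθ.1.trans hx.1, hx.2⟩
      have a1 := hA x hx'
      have a2 := (hχ3 x hx').1
      have a3 := lt_two_pi_div_sqrt_three
      have a4 : 0.519 ≤ (2 * Real.pi / √3 * ‖formA (nome (arc x))‖) / (3 * χ x ^ 2) := by
        rw [le_div_iff₀ (by positivity)]
        have a5 : 3.6275 * (0.43 * χ x ^ 2) ≤ 2 * Real.pi / √3 * ‖formA (nome (arc x))‖ := by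
          gcongr
        nlinarith [sq_nonneg (χ x)]
      rw [neg_div]
      linarith
  have hfin := hanti (Set.left_mem_Icc.2 hθ.2.le) (Set.right_mem_Icc.2 hθ.2.le) hθ.2.le
  have hend : χ (5 * Real.pi / 6) = 0 := by
    rw [hχ]; simp only [h1, sub_self]; norm_num
  simp only [hend, zero_add] at hfin
  have hlow : 0.519 * (5 * Real.pi / 6 - θ) ≤ χ θ := by linarith
  have hδ : 0 ≤ 5 * Real.pi / 6 - θ := by linarith [hθ.2]
  have hcc : c = 54 + 54 * Real.cos (Φ θ) := by
    have := hj θ (Set.Ioo_subset_Icc_self hθ)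
    rw [hc] at this
    exact_mod_cast this
  rw [hcc]
  refine le_trans ?_ (hjlow θ hθ)
  rw [← (hχ3 θ hθ).2, ← pow_mul]
  calc (3 / 4 * (5 * Real.pi / 6 - θ)) ^ 6 = (3 / 4) ^ 6 * (5 * Real.pi / 6 - θ) ^ 6 := by ring
    _ ≤ (108 / 9.8697 * 0.519 ^ 6) * (5 * Real.pi / 6 - θ) ^ 6 := by
      refine mul_le_mul_of_nonneg_right (by norm_num) (by positivity)
    _ = 108 / 9.8697 * (0.519 * (5 * Real.pi / 6 - θ)) ^ 6 := by ring
    _ ≤ _ := by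
      refine mul_le_mul_of_nonneg_left ?_ (by norm_num)
      exact pow_le_pow_left₀ (by positivity) hlow 6

/-! ### Bounds for the kernel -/

lemma exists_nonneg_pow_eq {x : ℝ} (hx : 0 ≤ x) {n : ℕ} (hn : n ≠ 0) : ∃ y : ℝ, 0 ≤ y ∧ y ^ n = x :=
  ⟨x ^ ((n : ℝ)⁻¹), Real.rpow_nonneg hx _, Real.rpow_inv_natCast_pow hx hn⟩

lemma norm_formA_le {q : ℂ} (hq : q ∈ ball (0 : ℂ) 1) (h0 : q ≠ 0) {M N : ℝ}
    (h1 : ‖jInv q‖ ≤ M ^ 6) (h2 : ‖formS q‖ ≤ N ^ 6) : ‖formA q‖ ≤ M ^ 2 * N ^ 2 := by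
  refine le_of_pow_le_pow_left₀ (n := 3) (by norm_num) (by positivity) ?_
  rw [← norm_pow, formA_pow_three hq h0, norm_mul]
  calc ‖jInv q‖ * ‖formS q‖ ≤ M ^ 6 * N ^ 6 := by gcongr
    _ = _ := by ring

/-- With sixth roots `M` of a bound for `|j|` and `N` of one for `|S|`, the relation `D² = AS(j -
108)` gives a monomial bound; `18² = 324`. -/
lemma norm_formD_le {q : ℂ} (hq : q ∈ ball (0 : ℂ) 1) (h0 : q ≠ 0) {M N : ℝ} (hM : 0 ≤ M)
    (h1 : ‖jInv q‖ ≤ M ^ 6) (h2 : ‖formS q‖ ≤ N ^ 6) (h3 : ‖jInv q - 108‖ ≤ 324) :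
    ‖formD q‖ ≤ 18 * M * N ^ 4 := by
  refine le_of_pow_le_pow_left₀ (n := 2) (by norm_num) (by positivity) ?_
  rw [← norm_pow, formD_sq hq h0, norm_mul, norm_mul]
  have := norm_formA_le hq h0 h1 h2
  calc ‖formA q‖ * ‖formS q‖ * ‖jInv q - 108‖ ≤ M ^ 2 * N ^ 2 * N ^ 6 * 324 := by gcongr
    _ = _ := by ring

lemma norm_formF (a b e : ℕ) (q : ℂ) :
    ‖formF a b e q‖ = ‖formA q‖ ^ a * ‖formD q‖ ^ b * ‖formS q‖ ^ e := by
  rw [formF, norm_mul, norm_mul, norm_pow, norm_pow, norm_pow]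

/-- The exponents at `w` and at `q` are complementary, so common bounds at both points give the same
product whatever the weight. -/
lemma norm_formF_mul_le {a b e : ℕ} (ha : a ≤ 2) (hb : b ≤ 1) (he : e ≤ 1) {w q : ℂ}
    {X Y Z : ℝ} (hX : ‖formA w‖ ≤ X ∧ ‖formA q‖ ≤ X) (hY : ‖formD w‖ ≤ Y ∧ ‖formD q‖ ≤ Y)
    (hZ : ‖formS w‖ ≤ Z ∧ ‖formS q‖ ≤ Z) :
    ‖formF a b e w‖ * ‖formF (2 - a) (1 - b) (1 - e) q‖ ≤ X ^ 2 * Y * Z := by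
  have hX0 : 0 ≤ X := (norm_nonneg _).trans hX.1
  have hY0 : 0 ≤ Y := (norm_nonneg _).trans hY.1
  have hZ0 : 0 ≤ Z := (norm_nonneg _).trans hZ.1
  obtain ⟨hX1, hX2⟩ := hX
  obtain ⟨hY1, hY2⟩ := hY
  obtain ⟨hZ1, hZ2⟩ := hZ
  rw [norm_formF, norm_formF]
  calc ‖formA w‖ ^ a * ‖formD w‖ ^ b * ‖formS w‖ ^ e *
        (‖formA q‖ ^ (2 - a) * ‖formD q‖ ^ (1 - b) * ‖formS q‖ ^ (1 - e))
      ≤ X ^ a * Y ^ b * Z ^ e * (X ^ (2 - a) * Y ^ (1 - b) * Z ^ (1 - e)) := by gcongr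
    _ = (X ^ (a + (2 - a))) * Y ^ (b + (1 - b)) * Z ^ (e + (1 - e)) := by
        rw [pow_add, pow_add, pow_add]; ring
    _ = _ := by
        rw [Nat.add_sub_cancel' ha, Nat.add_sub_cancel' hb, Nat.add_sub_cancel' he]; ring

/-- The kernel bound where the Hauptmodul is small. -/
lemma kernel_bound_small {a b e : ℕ} (ha : a ≤ 2) (hb : b ≤ 1) (he : e ≤ 1) {w q : ℂ}
    (hw : w ∈ ball (0 : ℂ) 1) (hw0 : w ≠ 0) (hq : q ∈ ball (0 : ℂ) 1) (hq0 : q ≠ 0) {c κ ω B : ℝ}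
    (hc : jInv w = c) (hc1 : c < 108) (hκ : 0 < κ) (hκc : κ ^ 6 ≤ c) (hω : 0 < ω) (hω1 : ω ≤ 1)
    (hjc : c * ω ≤ ‖jInv q - c‖) (hj : ‖jInv q‖ ≤ 216) (hS1 : ‖formS w‖ ≤ 1)
    (hSB : ‖formS q‖ ≤ B ^ 3) (hSS : ‖formS w‖ ^ 2 ≤ B * ‖formS q‖ ^ 2) (hB : 0 ≤ B) :
    ‖formF a b e w‖ * ‖formF (2 - a) (1 - b) (1 - e) q‖ ≤
      36 * B / (ω * κ) * (‖formS q‖ ^ 2 * ‖jInv q - c‖) := by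
  have hc0 : 0 < c := (by positivity : 0 < κ ^ 6).trans_le hκc
  have hcn : ‖jInv w‖ = c := by rw [hc, norm_real, Real.norm_eq_abs, abs_of_pos hc0]
  obtain ⟨M, hM0, hM⟩ := exists_nonneg_pow_eq (x := max c ‖jInv q‖) (by positivity)
    (n := 6) (by norm_num)
  obtain ⟨N, hN0, hN⟩ := exists_nonneg_pow_eq (x := max ‖formS w‖ ‖formS q‖) (by positivity)
    (n := 6) (by norm_num)
  have m1 : ‖jInv w‖ ≤ M ^ 6 := by rw [hM, hcn]; exact le_max_left _ _
  have m2 : ‖jInv q‖ ≤ M ^ 6 := by rw [hM]; exact le_max_right _ _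
  have n1 : ‖formS w‖ ≤ N ^ 6 := by rw [hN]; exact le_max_left _ _
  have n2 : ‖formS q‖ ≤ N ^ 6 := by rw [hN]; exact le_max_right _ _
  have d1 : ‖jInv w - 108‖ ≤ 324 := by
    refine (norm_sub_le _ _).trans ?_
    rw [hcn]; norm_num; linarith
  have d2 : ‖jInv q - 108‖ ≤ 324 := by
    refine (norm_sub_le _ _).trans ?_
    norm_num; linarith
  have key := norm_formF_mul_le (a := a) (b := b) (e := e) ha hb he
    ⟨norm_formA_le hw hw0 m1 n1, norm_formA_le hq hq0 m2 n2⟩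
    ⟨norm_formD_le hw hw0 hM0 m1 n1 d1, norm_formD_le hq hq0 hM0 m2 n2 d2⟩ ⟨n1, n2⟩
  -- `N^12` is to be compared with `|S(q)|²`; the spare factor `N²` is absorbed by `B` when `|S(q)|`
  -- dominates and is at most `1` otherwise.
  have hN14 : N ^ 14 ≤ B * ‖formS q‖ ^ 2 := by
    rcases le_total ‖formS w‖ ‖formS q‖ with h | h
    · rw [max_eq_right h] at hN
      have h2 : N ^ 2 ≤ B := by
        refine le_of_pow_le_pow_left₀ (n := 3) (by norm_num) hB ?_
        rw [← pow_mul, hN]; exact hSB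
      calc N ^ 14 = N ^ 2 * (N ^ 6) ^ 2 := by ring
        _ ≤ B * (N ^ 6) ^ 2 := by gcongr
        _ = _ := by rw [hN]
    · rw [max_eq_left h] at hN
      have h2 : N ≤ 1 := by
        refine le_of_pow_le_pow_left₀ (n := 6) (by norm_num) (by norm_num) ?_
        rw [hN]; simpa using hS1
      calc N ^ 14 = N ^ 2 * (N ^ 6) ^ 2 := by ring
        _ ≤ 1 * (N ^ 6) ^ 2 := by gcongr; exact pow_le_one₀ hN0 h2
        _ = ‖formS w‖ ^ 2 := by rw [hN, one_mul]
        _ ≤ _ := hSS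
  have hκM : κ ≤ M := by
    refine le_of_pow_le_pow_left₀ (n := 6) (by norm_num) hM0 ?_
    rw [hM]; exact hκc.trans (le_max_left _ _)
  have hMpos : 0 < M := hκ.trans_le hκM
  have hden : M ^ 6 * ω ≤ 2 * ‖jInv q - c‖ := by
    rcases le_total (2 * c) ‖jInv q‖ with h | h
    · have h1 : M ^ 6 = ‖jInv q‖ := by rw [hM]; exact max_eq_right (by linarith)
      have h2 := norm_sub_norm_le (jInv q) (c : ℂ)
      rw [norm_real, Real.norm_eq_abs, abs_of_pos hc0] at h2
      rw [h1]
      nlinarith [norm_nonneg (jInv q)]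
    · have h1 : M ^ 6 ≤ 2 * c := by rw [hM]; exact max_le (by linarith) h
      nlinarith
  -- The numerator carries `M⁵` against `M⁶` in the denominator, so only one factor `1/M ≤ 1/κ` is
  -- lost.
  have h5 : M ^ 5 ≤ 2 * ‖jInv q - c‖ / (ω * κ) := by
    rw [le_div_iff₀ (by positivity)]
    calc M ^ 5 * (ω * κ) ≤ M ^ 5 * (ω * M) := by gcongr
      _ = M ^ 6 * ω := by ring
      _ ≤ _ := hden
  calc _ ≤ (M ^ 2 * N ^ 2) ^ 2 * (18 * M * N ^ 4) * N ^ 6 := key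
    _ = 18 * M ^ 5 * N ^ 14 := by ring
    _ ≤ 18 * (2 * ‖jInv q - c‖ / (ω * κ)) * (B * ‖formS q‖ ^ 2) := by gcongr
    _ = _ := by ring

/-- The kernel bound where the Hauptmodul is large. -/
lemma kernel_bound_large {a b e : ℕ} (ha : a ≤ 2) (hb : b ≤ 1) (he : e ≤ 1) {w q : ℂ}
    (hw : w ∈ ball (0 : ℂ) 1) (hw0 : w ≠ 0) (hq : q ∈ ball (0 : ℂ) 1) (hq0 : q ≠ 0) {c s X : ℝ}
    (hc : jInv w = c) (hc0 : 0 < c) (hc1 : c < 108) (hj : 216 ≤ ‖jInv q‖) (hS1 : ‖formS w‖ ≤ 1)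
    (hs : 0 < s) (hs1 : s ≤ 1) (hSs : s ≤ ‖formS q‖) (hX : ‖formA q‖ ≤ X) (hX' : 1 ≤ 216 * s * X)
    (hX1 : 1 ≤ X) :
    ‖formF a b e w‖ * ‖formF (2 - a) (1 - b) (1 - e) q‖ ≤
      1476 * X / s * (‖formS q‖ ^ 2 * ‖jInv q - c‖) := by
  have hcn : ‖jInv w‖ = c := by rw [hc, norm_real, Real.norm_eq_abs, abs_of_pos hc0]
  set α := ‖formA q‖ with hα
  set S := ‖formS q‖ with hS
  have hS0 : 0 < S := hs.trans_le hSs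
  have hα3 : α ^ 3 = ‖jInv q‖ * S := by
    rw [hα, ← norm_pow, formA_pow_three hq hq0, norm_mul]
  have hα0 : 0 ≤ α := norm_nonneg _
  have hj0 : 0 < ‖jInv q‖ := by linarith
  -- This allows exponents of `α` below `4` to be dominated by `Xα³` even when `α < 1`.
  have hα3' : 1 ≤ X * α ^ 3 := by
    rw [hα3]
    calc 1 ≤ 216 * s * X := hX'
      _ ≤ ‖jInv q‖ * S * X := by gcongr
      _ = _ := by ring
  have hDq : ‖formD q‖ ≤ 1.23 * α ^ 2 := by
    refine le_of_pow_le_pow_left₀ (n := 2) (by norm_num) (by positivity) ?_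
    rw [← norm_pow, formD_sq hq hq0, norm_mul, norm_mul, ← hα, ← hS]
    have h1 : ‖jInv q - 108‖ ≤ 1.5 * ‖jInv q‖ := by
      refine (norm_sub_le _ _).trans ?_
      norm_num; linarith
    calc α * S * ‖jInv q - 108‖ ≤ α * S * (1.5 * ‖jInv q‖) := by gcongr
      _ = 1.5 * (α * (‖jInv q‖ * S)) := by ring
      _ = 1.5 * α ^ 4 := by rw [← hα3]; ring
      _ ≤ (1.23 * α ^ 2) ^ 2 := by nlinarith [pow_nonneg hα0 4]
  have hAw : ‖formA w‖ ≤ 5 := by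
    refine le_of_pow_le_pow_left₀ (n := 3) (by norm_num) (by norm_num) ?_
    rw [← norm_pow, formA_pow_three hw hw0, norm_mul, hcn]
    nlinarith [norm_nonneg (formS w)]
  have hDw : ‖formD w‖ ≤ 24 := by
    refine le_of_pow_le_pow_left₀ (n := 2) (by norm_num) (by norm_num) ?_
    rw [← norm_pow, formD_sq hw hw0, norm_mul, norm_mul]
    have h1 : ‖jInv w - 108‖ ≤ 108 := by
      rw [hc, ← ofReal_ofNat, ← ofReal_sub, norm_real, Real.norm_eq_abs, abs_le]
      constructor <;> linarith
    calc ‖formA w‖ * ‖formS w‖ * ‖jInv w - 108‖ ≤ 5 * 1 * 108 := by gcongr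
      _ ≤ _ := by norm_num
  -- `600 = 5² · 24`, the worst exponents being `a = 2`, `b = 1`.
  have hFw : ‖formF a b e w‖ ≤ 600 := by
    rw [norm_formF]
    calc ‖formA w‖ ^ a * ‖formD w‖ ^ b * ‖formS w‖ ^ e ≤ 5 ^ a * 24 ^ b * 1 ^ e := by gcongr
      _ ≤ 5 ^ 2 * 24 ^ 1 * 1 := by
        rw [one_pow]
        gcongr <;> norm_num
      _ = 600 := by norm_num
  have hFq : ‖formF (2 - a) (1 - b) (1 - e) q‖ ≤ 1.23 * (X * α ^ 3) * (S / s) := by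
    rw [norm_formF]
    have h1 : ‖formD q‖ ^ (1 - b) ≤ 1.23 * α ^ (2 * (1 - b)) := by
      calc ‖formD q‖ ^ (1 - b) ≤ (1.23 * α ^ 2) ^ (1 - b) := by gcongr
        _ = 1.23 ^ (1 - b) * α ^ (2 * (1 - b)) := by rw [mul_pow, ← pow_mul]
        _ ≤ 1.23 ^ 1 * α ^ (2 * (1 - b)) := by
          gcongr
          · norm_num
          · omega
        _ = _ := by rw [pow_one]
    have h2 : S ^ (1 - e) ≤ S / s := by
      rw [le_div_iff₀ hs]
      interval_cases e
      · simp; nlinarith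
      · simpa using hSs
    have h3 : α ^ (2 - a) * α ^ (2 * (1 - b)) ≤ X * α ^ 3 := by
      rw [← pow_add]
      rcases le_total 1 α with h | h
      · calc α ^ (2 - a + 2 * (1 - b)) ≤ α ^ 4 := pow_le_pow_right₀ h (by omega)
          _ = α * α ^ 3 := by ring
          _ ≤ _ := by gcongr
      · exact (pow_le_one₀ hα0 h).trans hα3'
    calc α ^ (2 - a) * ‖formD q‖ ^ (1 - b) * S ^ (1 - e)
        ≤ α ^ (2 - a) * (1.23 * α ^ (2 * (1 - b))) * (S / s) := by gcongr
      _ = 1.23 * (α ^ (2 - a) * α ^ (2 * (1 - b))) * (S / s) := by ring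
      _ ≤ _ := by gcongr
  have hden : ‖jInv q‖ ≤ 2 * ‖jInv q - c‖ := by
    have h2 := norm_sub_norm_le (jInv q) (c : ℂ)
    rw [norm_real, Real.norm_eq_abs, abs_of_pos hc0] at h2
    linarith
  calc _ ≤ 600 * (1.23 * (X * α ^ 3) * (S / s)) := by gcongr
    _ = 738 * X / s * (S ^ 2 * ‖jInv q‖) := by rw [hα3]; field_simp; norm_num
    _ ≤ 738 * X / s * (S ^ 2 * (2 * ‖jInv q - c‖)) := by gcongr
    _ = _ := by ring

/-- The norm of the kernel in terms of the quantity bounded above. -/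
lemma norm_kern_le {m ℓ : ℤ} {a b e : ℕ} {w q : ℂ} {c C : ℝ} (hq : q ∈ ball (0 : ℂ) 1) (hq0 : q ≠ 0)
    (hjc : jInv q ≠ c)
    (hC : ‖formF a b e w‖ * ‖formF (2 - a) (1 - b) (1 - e) q‖ ≤
      C * (‖formS q‖ ^ 2 * ‖jInv q - c‖)) :
    ‖baseForm ℓ a b e w * kern m ℓ a b e c q‖ ≤
      ‖q‖ ^ (-m - 1) * (‖formS w‖ / ‖formS q‖) ^ (2 * ℓ) * C := by
  have hS : 0 < ‖formS q‖ := norm_pos_iff.2 (formS_ne_zero hq hq0)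
  have hj : 0 < ‖jInv q - c‖ := norm_pos_iff.2 (sub_ne_zero.2 hjc)
  have hq1 : 0 < ‖q‖ := norm_pos_iff.2 hq0
  rw [baseForm, kern]
  simp only [norm_mul, norm_div, norm_zpow]
  have e1 : ‖formS q‖ ^ (2 * (-ℓ - 1)) = (‖formS q‖ ^ (2 * ℓ))⁻¹ / ‖formS q‖ ^ 2 := by
    rw [show 2 * (-ℓ - 1) = -(2 * ℓ) - ((2 : ℕ) : ℤ) by push_cast; ring, zpow_sub₀ hS.ne', zpow_neg,
      zpow_natCast]
  rw [e1, div_zpow]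
  have hp := zpow_pos hS (2 * ℓ)
  rw [show ‖formS w‖ ^ (2 * ℓ) * ‖formF a b e w‖ *
      (‖q‖ ^ (-m - 1) * ‖formF (2 - a) (1 - b) (1 - e) q‖ * ((‖formS q‖ ^ (2 * ℓ))⁻¹ /
        ‖formS q‖ ^ 2) / ‖jInv q - c‖) =
      ‖q‖ ^ (-m - 1) * (‖formS w‖ ^ (2 * ℓ) / ‖formS q‖ ^ (2 * ℓ)) *
      ((‖formF a b e w‖ * ‖formF (2 - a) (1 - b) (1 - e) q‖) / (‖formS q‖ ^ 2 * ‖jInv q - c‖)) by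
      field_simp]
  gcongr
  rwa [div_le_iff₀ (by positivity)]

/-! ### Distance of the Hauptmodul from its value on the arc -/

/-- The absolute value of the Blaschke factor of the upper half-plane with zero `a`. -/
def blaschke (a τ : ℂ) : ℝ := ‖τ - a‖ / ‖τ - (starRingEnd ℂ) a‖

lemma sub_conj_ne_zero {a τ : ℂ} (ha : 0 < a.im) (hτ : 0 < τ.im) : τ - (starRingEnd ℂ) a ≠ 0 := by
  intro h
  have := congrArg im h
  simp at this
  linarith

lemma blaschke_nonneg (a τ : ℂ) : 0 ≤ blaschke a τ := by unfold blaschke; positivity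

lemma blaschke_le_one {a τ : ℂ} (ha : 0 < a.im) (hτ : 0 < τ.im) : blaschke a τ ≤ 1 := by
  rw [blaschke, div_le_one (norm_pos_iff.2 (sub_conj_ne_zero ha hτ))]
  refine le_of_pow_le_pow_left₀ (n := 2) (by norm_num) (norm_nonneg _) ?_
  rw [← normSq_eq_norm_sq, ← normSq_eq_norm_sq, normSq_apply, normSq_apply]
  simp
  nlinarith [mul_pos ha hτ]

/-- For given heights the quotient is smallest when the real parts agree. Thus a gap between heights
alone keeps `τ` away from the orbit. -/
lemma le_blaschke {a τ : ℂ} (ha : 0 < a.im) (hτ : 0 < τ.im) :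
    |τ.im - a.im| / (τ.im + a.im) ≤ blaschke a τ := by
  rw [blaschke, div_le_div_iff₀ (by positivity) (norm_pos_iff.2 (sub_conj_ne_zero ha hτ))]
  refine le_of_pow_le_pow_left₀ (n := 2) (by norm_num) (by positivity) ?_
  rw [mul_pow, mul_pow, ← normSq_eq_norm_sq, ← normSq_eq_norm_sq, normSq_apply, normSq_apply, sq_abs]
  simp
  nlinarith [mul_pos ha hτ, mul_nonneg (mul_pos ha hτ).le (mul_self_nonneg (τ.re - a.re))]

lemma blaschke_add_real (a τ : ℂ) (x : ℝ) : blaschke (a + x) (τ + x) = blaschke a τ := by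
  simp [blaschke]

lemma blaschke_fricke {a τ : ℂ} (ha : 0 < a.im) (hτ : 0 < τ.im) :
    blaschke (fricke a) (fricke τ) = blaschke a τ := by
  have h1 := ne_zero_of_im_pos ha
  have h2 := ne_zero_of_im_pos hτ
  have h3 : (starRingEnd ℂ) a ≠ 0 := by simpa using h1
  have e1 : fricke τ - fricke a = (τ - a) / (3 * τ * a) := by
    unfold fricke; field_simp; ring
  have e2 : fricke τ - (starRingEnd ℂ) (fricke a) =
      (τ - (starRingEnd ℂ) a) / (3 * τ * (starRingEnd ℂ) a) := by
    have : (starRingEnd ℂ) (fricke a) = -1 / (3 * (starRingEnd ℂ) a) := by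
      simp [fricke, map_ofNat]
    rw [this, fricke]; field_simp; ring
  have h4 : 0 < ‖a‖ := norm_pos_iff.2 h1
  have h5 : 0 < ‖τ‖ := norm_pos_iff.2 h2
  rw [blaschke, e1, e2, blaschke, norm_div, norm_div, norm_mul (3 * τ) a,
    norm_mul (3 * τ), norm_conj, div_div_div_cancel_right₀]
  exact mul_ne_zero (norm_ne_zero_iff.2 (mul_ne_zero three_ne_zero h2)) h4.ne'

lemma exists_im_jInv_gt : ∃ Y : ℝ, ∀ τ : ℂ, Y ≤ τ.im → 216 ≤ ‖jInv (nome τ)‖ := by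
  have h1 : ContinuousAt jNum 0 :=
    (differentiableOn_jNum.differentiableAt (isOpen_ball.mem_nhds (by simp))).continuousAt
  have h2 : ∀ᶠ q in 𝓝 (0 : ℂ), 1 / 2 < ‖jNum q‖ := by
    refine (isOpen_lt continuous_const continuous_id).mem_nhds ?_ |> h1.norm.eventually
    simp [jNum_zero]; norm_num
  obtain ⟨δ, hδ, hb⟩ := Metric.eventually_nhds_iff_ball.1 h2
  set d := min δ (1 / 432) with hd
  have hd0 : 0 < d := by positivity
  refine ⟨max 1 (-Real.log d), fun τ hτ => ?_⟩
  have h3 := (le_max_left _ _).trans hτ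
  have h4 := (le_max_right _ _).trans hτ
  have hq : ‖nome τ‖ < d := by
    rw [norm_nome, ← Real.lt_log_iff_exp_lt hd0]
    nlinarith [Real.pi_gt_three]
  have h5 := hb _ (by simpa using hq.trans_le (min_le_left _ _))
  have h6 : 0 < ‖nome τ‖ := norm_pos_iff.2 (nome_ne_zero τ)
  rw [jInv_eq (nome_mem_ball (by linarith)) (nome_ne_zero τ), norm_div, le_div_iff₀ h6]
  have := hq.trans_le (min_le_right δ (1 / 432))
  linarith

lemma fricke_re (τ : ℂ) : (fricke τ).re = -τ.re / (3 * normSq τ) := by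
  rw [fricke, neg_div, one_div, neg_re, inv_re]
  simp [normSq_mul]
  rw [show 3 * 3 * normSq τ = 3 * (3 * normSq τ) by ring, mul_div_mul_left _ _ (by norm_num),
    neg_div]

lemma normSq_fricke {τ : ℂ} : 3 * normSq (fricke τ) = 1 / (3 * normSq τ) := by
  rw [fricke, normSq_div, normSq_neg, normSq_mul]
  simp
  rw [← mul_assoc]
  ring

/-- The closed digon bounded by `|Re τ| = 1/2` and `|Re (-1/(3τ))| = 1/2`, truncated at the
cusps. -/
def digon (Y : ℝ) : Set ℂ :=
  {τ | 0 < τ.im ∧ |τ.re| ≤ 1 / 2 ∧ 2 * |τ.re| ≤ 3 * normSq τ ∧ τ.im ≤ Y ∧ τ.im ≤ Y * (3 * normSq τ)}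

lemma abs_fricke_re (τ : ℂ) : |(fricke τ).re| = |τ.re| / (3 * normSq τ) := by
  rw [fricke_re, abs_div, abs_neg, abs_of_nonneg (mul_nonneg zero_le_three (normSq_nonneg τ))]

/-- The condition `2|Re τ| ≤ 3|τ|²` says `|Re Wτ| ≤ 1/2`, so the digon is covered by the fundamental
domain and its image under `W`. -/
lemma mem_fundDom_or_of_digon {Y : ℝ} {τ : ℂ} (h : τ ∈ digon Y) :
    τ ∈ fundDom ∨ fricke τ ∈ fundDom := by
  obtain ⟨h1, h2, h3, -, -⟩ := h
  have h5 := normSq_pos_of_im_pos h1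
  rcases le_or_gt 1 (3 * normSq τ) with h4 | h4
  · exact .inl ⟨h1, h2, h4⟩
  · refine .inr ⟨fricke_im_pos h1, ?_, ?_⟩
    · rw [abs_fricke_re, div_le_iff₀ (by positivity)]
      linarith
    · rw [normSq_fricke, le_div_iff₀ (by positivity)]
      linarith

lemma exists_im_ge_of_digon (Y : ℝ) : ∃ η > 0, ∀ τ ∈ digon Y, η ≤ τ.im := by
  have hs := sqrt_three_pos
  refine ⟨min (√3 / 6) (√3 / 6 / (3 * (1 / 4 + Y ^ 2))), by positivity, fun τ hτ => ?_⟩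
  rcases mem_fundDom_or_of_digon hτ with h | h
  · exact (min_le_left _ _).trans (im_ge_of_mem_fd h.1 h.2.1 h.2.2)
  · refine (min_le_right _ _).trans ?_
    have h1 := im_ge_of_mem_fd h.1 h.2.1 h.2.2
    have h2 : τ.im = (fricke τ).im / (3 * normSq (fricke τ)) := by
      rw [← fricke_im, fricke_fricke (ne_zero_of_im_pos hτ.1)]
    rw [h2]
    have h3 := normSq_pos_of_im_pos h.1
    have h5 : (fricke τ).im ≤ Y := by
      rw [fricke_im, div_le_iff₀ (by have := normSq_pos_of_im_pos hτ.1; positivity)]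
      exact hτ.2.2.2.2
    have h4 : normSq (fricke τ) ≤ 1 / 4 + Y ^ 2 := by
      rw [normSq_apply]
      nlinarith [abs_le.1 h.2.1, h.1]
    have h6 := h.1.le
    gcongr

lemma eq_or_eq_of_jInv_eq_of_digon {θ : ℝ} (hθ : θ ∈ Set.Ioo (Real.pi / 2) (5 * Real.pi / 6))
    {Y : ℝ} {τ : ℂ} (hτ : τ ∈ digon Y) (h : jInv (nome τ) = jInv (nome (arc θ))) :
    τ = arc θ ∨ τ = fricke (arc θ) := by
  have hz : arc θ ≠ 0 := by
    have := three_mul_normSq_arc θ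
    rintro h0
    simp [h0] at this
  rcases mem_fundDom_or_of_digon hτ with h1 | h1
  · exact eq_or_eq_of_jInv_eq hθ h1 h
  · have h2 := eq_or_eq_of_jInv_eq hθ h1 (by rw [jInv_fricke hτ.1, h])
    rw [← fricke_fricke (ne_zero_of_im_pos hτ.1)]
    rcases h2 with h2 | h2
    · right; rw [h2]
    · left; rw [h2, fricke_fricke hz]

/-- The function `j - j(z)` divided by its two zeros in the digon. -/
lemma exists_quotient_jInv {θ : ℝ} (hθ : θ ∈ Set.Ioo (Real.pi / 2) (5 * Real.pi / 6)) :
    ∃ H : ℂ → ℂ, DifferentiableOn ℂ H {τ | 0 < τ.im} ∧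
      (∀ τ : ℂ, 0 < τ.im → jInv (nome τ) - jInv (nome (arc θ)) =
        (τ - arc θ) * (τ - fricke (arc θ)) * H τ) ∧
      ∀ Y : ℝ, ∀ τ ∈ digon Y, H τ ≠ 0 := by
  obtain ⟨c, hc0, hc1, hc⟩ := exists_jInv_arc hθ
  have hpi := Real.pi_pos
  set z := arc θ with hz
  have hzi : 0 < z.im := arc_im_pos ⟨by linarith [hθ.1], by linarith [hθ.2]⟩
  have hWi : 0 < (fricke z).im := fricke_im_pos hzi
  have hzW : fricke z ≠ z := by
    rw [fricke_of_normSq (three_mul_normSq_arc θ)]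
    intro h
    have h1 := congrArg re h
    simp only [neg_re, conj_re] at h1
    have h2 : z.re < 0 := by
      rw [hz, arc_re]
      exact div_neg_of_neg_of_pos (Real.cos_neg_of_pi_div_two_lt_of_lt hθ.1 (by linarith [hθ.2]))
        sqrt_three_pos
    linarith
  -- Zeros of `j - c` are simple: `j ≠ 0, 108` makes both `A` and `t - 729/t` nonzero in `dj/dτ`.
  -- Hence `H` does not vanish at `z` or `Wz` either.
  have hne : ∀ τ : ℂ, 0 < τ.im → jInv (nome τ) = c → ∃ d : ℂ, d ≠ 0 ∧
      HasDerivAt (fun τ => jInv (nome τ) - c) d τ := by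
    intro τ hτ hj
    have h1 := (hasDerivAt_comp_nome (hasDerivAt_jInv (nome_mem_ball hτ) (nome_ne_zero τ))).sub_const
      (c : ℂ)
    refine ⟨_, ?_, h1⟩
    have hq := nome_mem_ball hτ
    have hq0 := nome_ne_zero τ
    have hj0 : jInv (nome τ) ≠ 0 := by rw [hj]; exact_mod_cast hc0.ne'
    have hj1 : jInv (nome τ) ≠ 108 := by rw [hj]; exact_mod_cast hc1.ne
    have h2 : haupt (nome τ) - 729 / haupt (nome τ) ≠ 0 := by
      intro h3
      have h4 := jInv_mul_sub hq hq0
      rw [h3] at h4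
      exact mul_ne_zero hj0 (sub_ne_zero.2 hj1) (by rw [h4]; simp)
    exact mul_ne_zero (div_ne_zero (neg_ne_zero.2 (mul_ne_zero (formA_ne_zero hq hq0 hj0) h2)) hq0)
      (mul_ne_zero two_pi_I_ne_zero hq0)
  set J : ℂ → ℂ := fun τ => jInv (nome τ) - c with hJ
  have hJd : DifferentiableOn ℂ J {τ | 0 < τ.im} := fun τ hτ =>
    ((hasDerivAt_comp_nome (hasDerivAt_jInv (nome_mem_ball hτ) (nome_ne_zero τ))).sub_const
      (c : ℂ)).differentiableAt.differentiableWithinAt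
  have hJz : J z = 0 := by simp [hJ, hc]
  have hJW : J (fricke z) = 0 := by simp [hJ, jInv_fricke hzi, hc]
  have hK : ∀ τ, J τ = (τ - z) * dslope J z τ := by
    intro τ
    have := sub_smul_dslope J z τ
    rw [hJz, sub_zero, smul_eq_mul] at this
    exact this.symm
  have hKW : dslope J z (fricke z) = 0 := by
    have := hK (fricke z)
    rw [hJW, eq_comm, mul_eq_zero] at this
    exact this.resolve_left (sub_ne_zero.2 hzW)
  have hH : ∀ τ, dslope J z τ = (τ - fricke z) * dslope (dslope J z) (fricke z) τ := by
    intro τ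
    have := sub_smul_dslope (dslope J z) (fricke z) τ
    rw [hKW, sub_zero, smul_eq_mul] at this
    exact this.symm
  have hKd : DifferentiableOn ℂ (dslope J z) {τ | 0 < τ.im} :=
    (differentiableOn_dslope (isOpen_im_pos.mem_nhds hzi)).2 hJd
  have hHd : DifferentiableOn ℂ (dslope (dslope J z) (fricke z)) {τ | 0 < τ.im} :=
    (differentiableOn_dslope (isOpen_im_pos.mem_nhds hWi)).2 hKd
  refine ⟨dslope (dslope J z) (fricke z), hHd, fun τ _ => ?_, fun Y τ hτ h0 => ?_⟩
  · have := hK τ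
    rw [hH τ, ← mul_assoc] at this
    rw [hc]
    exact this
  · have h1 : J τ = 0 := by rw [hK, hH, h0]; simp
    have h2 : jInv (nome τ) = jInv (nome z) := by
      rw [hc]; exact sub_eq_zero.1 h1
    have h3 := eq_or_eq_of_jInv_eq_of_digon hθ hτ h2
    obtain ⟨d, hd0, hd⟩ := hne τ hτ.1 (h2.trans hc)
    have hKτ : HasDerivAt (dslope J z) (deriv (dslope J z) τ) τ :=
      (hKd.differentiableAt (isOpen_im_pos.mem_nhds hτ.1)).hasDerivAt
    have hHτ : HasDerivAt (dslope (dslope J z) (fricke z))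
        (deriv (dslope (dslope J z) (fricke z)) τ) τ :=
      (hHd.differentiableAt (isOpen_im_pos.mem_nhds hτ.1)).hasDerivAt
    have e1 : HasDerivAt J (1 * dslope J z τ + (τ - z) * deriv (dslope J z) τ) τ := by
      have := ((hasDerivAt_id τ).sub_const z).mul hKτ
      exact this.congr_of_eventuallyEq (Eventually.of_forall hK)
    have e2 : HasDerivAt (dslope J z) (1 * dslope (dslope J z) (fricke z) τ +
        (τ - fricke z) * deriv (dslope (dslope J z) (fricke z)) τ) τ := by
      have := ((hasDerivAt_id τ).sub_const (fricke z)).mul hHτ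
      exact this.congr_of_eventuallyEq (Eventually.of_forall hH)
    have e3 := hd.unique e1
    have e4 := hKτ.unique e2
    rw [hH, h0] at e3
    rw [h0] at e4
    rcases h3 with h3 | h3
    · apply hd0
      rw [e3, h3, ← hz]
      simp
    · apply hd0
      rw [e3, e4, h3, ← hz]
      simp

/-- In the digon `j - c` has exactly the simple zeros `z` and `Wz`. Dividing the two Blaschke
factors by `j - c` leaves a holomorphic function. On the boundary the Blaschke factors are at most
`1` and `|j - c| ≥ c`, so the maximum principle bounds the quotient by `1/c` inside. -/
lemma mul_blaschke_le_of_fundDom {θ c : ℝ} (hθ : θ ∈ Set.Ioo (Real.pi / 2) (5 * Real.pi / 6))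
    (hc : jInv (nome (arc θ)) = c) {τ : ℂ} (hτ : τ ∈ fundDom) :
    c * (blaschke (arc θ) τ * blaschke (fricke (arc θ)) τ) ≤ ‖jInv (nome τ) - c‖ := by
  obtain ⟨c', hc0, hc1, hc'⟩ := exists_jInv_arc hθ
  obtain rfl : c' = c := by exact_mod_cast hc'.symm.trans hc
  have hpi := Real.pi_pos
  set z := arc θ with hz
  have hzi : 0 < z.im := arc_im_pos ⟨by linarith [hθ.1], by linarith [hθ.2]⟩
  have hWi : 0 < (fricke z).im := fricke_im_pos hzi
  have hle1 : ∀ w : ℂ, 0 < w.im → blaschke z w * blaschke (fricke z) w ≤ 1 := fun w hw =>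
    mul_le_one₀ (blaschke_le_one hzi hw) (blaschke_nonneg _ _) (blaschke_le_one hWi hw)
  -- On the sides of the digon `j` is real and nonpositive, directly on `|Re τ| = 1/2` and through
  -- `W` on the other two.
  have hneg : ∀ w : ℂ, 0 < w.im → (|w.re| = 1 / 2 ∨ 2 * |w.re| = 3 * normSq w) →
      c' ≤ ‖jInv (nome w) - c'‖ := by
    intro w hw h
    have h1 : ∃ r : ℝ, r ≤ 0 ∧ jInv (nome w) = r := by
      rcases h with h | h
      · exact jInv_nonpos_of_re hw h
      · rw [← jInv_fricke hw]
        refine jInv_nonpos_of_re (fricke_im_pos hw) ?_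
        rw [abs_fricke_re, ← h]
        have : 0 < |w.re| := by have := normSq_pos_of_im_pos hw; linarith
        field_simp
    obtain ⟨r, hr, h2⟩ := h1
    rw [h2, ← ofReal_sub, norm_real, Real.norm_eq_abs, abs_of_nonpos (by linarith)]
    linarith
  have hfin : ∀ w : ℂ, 0 < w.im → c' ≤ ‖jInv (nome w) - c'‖ →
      c' * (blaschke z w * blaschke (fricke z) w) ≤ ‖jInv (nome w) - c'‖ := fun w hw h =>
    (mul_le_of_le_one_right hc0.le (hle1 w hw)).trans h
  by_cases hre : |τ.re| = 1 / 2
  · exact hfin τ hτ.1 (hneg τ hτ.1 (.inl hre))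
  have hre' : |τ.re| < 1 / 2 := lt_of_le_of_ne hτ.2.1 hre
  obtain ⟨Y₁, hY₁⟩ := exists_im_jInv_gt
  set Y := max Y₁ (τ.im + 1) with hY
  have hYτ : τ.im < Y := by have := le_max_right Y₁ (τ.im + 1); linarith
  -- On the truncations near the cusps `|j| ≥ 216`, hence `|j - c| ≥ 108 > c`.
  have hbig : ∀ w : ℂ, 0 < w.im → (w.im = Y ∨ w.im = Y * (3 * normSq w)) →
      c' ≤ ‖jInv (nome w) - c'‖ := by
    intro w hw h
    have h1 : 216 ≤ ‖jInv (nome w)‖ := by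
      rcases h with h | h
      · exact hY₁ w (by rw [h]; exact le_max_left _ _)
      · rw [← jInv_fricke hw]
        refine hY₁ _ ?_
        have : (fricke w).im = Y := by
          rw [fricke_im, h]
          have := normSq_pos_of_im_pos hw
          field_simp
        rw [this]; exact le_max_left _ _
    have h2 := norm_sub_norm_le (jInv (nome w)) (c' : ℂ)
    rw [norm_real, Real.norm_eq_abs, abs_of_pos hc0] at h2
    linarith
  obtain ⟨H, hHd, hHJ, hH0⟩ := exists_quotient_jInv hθ
  obtain ⟨η, hη, hηY⟩ := exists_im_ge_of_digon Y
  set X : Set ℂ := {w | 0 < w.im ∧ |w.re| < 1 / 2 ∧ 2 * |w.re| < 3 * normSq w ∧ w.im < Y ∧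
    w.im < Y * (3 * normSq w)} with hX
  have cre : Continuous fun w : ℂ => |w.re| := continuous_abs.comp continuous_re
  have cn : Continuous fun w : ℂ => 3 * normSq w := continuous_const.mul continuous_normSq
  have hXo : IsOpen X := (isOpen_lt continuous_const continuous_im).inter
    ((isOpen_lt cre continuous_const).inter ((isOpen_lt (continuous_const.mul cre) cn).inter
      ((isOpen_lt continuous_im continuous_const).inter
        (isOpen_lt continuous_im (continuous_const.mul cn)))))
  have hXd : X ⊆ digon Y := fun w h => ⟨h.1, h.2.1.le, h.2.2.1.le, h.2.2.2.1.le, h.2.2.2.2.le⟩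
  have hclX : closure X ⊆ digon Y := by
    have h1 : closure X ⊆ {w | η ≤ w.im ∧ |w.re| ≤ 1 / 2 ∧ 2 * |w.re| ≤ 3 * normSq w ∧ w.im ≤ Y ∧
        w.im ≤ Y * (3 * normSq w)} := by
      refine closure_minimal (fun w h => ⟨hηY w (hXd h), (hXd h).2⟩) ?_
      exact (isClosed_le continuous_const continuous_im).inter
        ((isClosed_le cre continuous_const).inter ((isClosed_le (continuous_const.mul cre) cn).inter
          ((isClosed_le continuous_im continuous_const).inter
            (isClosed_le continuous_im (continuous_const.mul cn)))))
    exact fun w hw => ⟨hη.trans_le (h1 hw).1, (h1 hw).2⟩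
  have hXb : Bornology.IsBounded X := by
    refine (isBounded_iff_forall_norm_le).2 ⟨1 / 2 + Y, fun w h => ?_⟩
    refine (norm_le_abs_re_add_abs_im w).trans (add_le_add h.2.1.le ?_)
    rw [abs_of_pos h.1]; exact h.2.2.2.1.le
  set B : ℂ → ℂ := fun w => (H w * ((w - (starRingEnd ℂ) z) * (w - (starRingEnd ℂ) (fricke z))))⁻¹
    with hB
  have hBd : ∀ w ∈ digon Y, DifferentiableAt ℂ B w := by
    intro w hw
    have h1 := hHd.differentiableAt (isOpen_im_pos.mem_nhds hw.1)
    refine DifferentiableAt.inv (h1.mul (by fun_prop)) ?_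
    exact mul_ne_zero (hH0 Y w hw) (mul_ne_zero (sub_conj_ne_zero hzi hw.1)
      (sub_conj_ne_zero hWi hw.1))
  have hBn : ∀ w ∈ digon Y, ‖B w‖ * ‖jInv (nome w) - c'‖ =
      blaschke z w * blaschke (fricke z) w := by
    intro w hw
    have h1 := hHJ w hw.1
    rw [← hz, hc] at h1
    have h2 : 0 < ‖H w‖ := norm_pos_iff.2 (hH0 Y w hw)
    have h3 : 0 < ‖w - (starRingEnd ℂ) z‖ := norm_pos_iff.2 (sub_conj_ne_zero hzi hw.1)
    have h4 : 0 < ‖w - (starRingEnd ℂ) (fricke z)‖ := norm_pos_iff.2 (sub_conj_ne_zero hWi hw.1)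
    rw [h1, hB, blaschke, blaschke, norm_inv, norm_mul, norm_mul, norm_mul, norm_mul]
    field_simp
  have hdc : DiffContOnCl ℂ B X := ⟨fun w hw => (hBd w (hXd hw)).differentiableWithinAt,
    fun w hw => (hBd w (hclX hw)).continuousAt.continuousWithinAt⟩
  have hτX : τ ∈ X := by
    have h1 := hτ.2.2
    have h2 := hτ.1
    refine ⟨h2, hre', ?_, hYτ, ?_⟩
    · linarith
    · nlinarith
  have hmax := norm_le_of_forall_mem_frontier_norm_le hXb hdc (C := c'⁻¹) (fun w hw => by
    rw [hXo.frontier_eq] at hw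
    have hwd := hclX hw.1
    have hcw : c' ≤ ‖jInv (nome w) - c'‖ := by
      by_contra hcon
      refine hw.2 ⟨hwd.1, lt_of_le_of_ne hwd.2.1 fun h => ?_, lt_of_le_of_ne hwd.2.2.1 fun h => ?_,
        lt_of_le_of_ne hwd.2.2.2.1 fun h => ?_, lt_of_le_of_ne hwd.2.2.2.2 fun h => ?_⟩
      · exact hcon (hneg w hwd.1 (.inl h))
      · exact hcon (hneg w hwd.1 (.inr h))
      · exact hcon (hbig w hwd.1 (.inl h))
      · exact hcon (hbig w hwd.1 (.inr h))
    rw [← one_div, le_div_iff₀ hc0]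
    calc ‖B w‖ * c' ≤ ‖B w‖ * ‖jInv (nome w) - c'‖ := by gcongr
      _ = _ := hBn w hwd
      _ ≤ 1 := hle1 w hwd.1) (subset_closure hτX)
  rw [← hBn τ (hXd hτX)]
  calc c' * (‖B τ‖ * ‖jInv (nome τ) - c'‖) ≤ c' * (c'⁻¹ * ‖jInv (nome τ) - c'‖) := by gcongr
    _ = _ := by field_simp

/-- The Hauptmodul is far from its value at a point of the arc, in terms of the hyperbolic distance
from the orbit of that point. -/
theorem exists_mul_blaschke_le {θ c : ℝ} (hθ : θ ∈ Set.Ioo (Real.pi / 2) (5 * Real.pi / 6))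
    (hc : jInv (nome (arc θ)) = c) {τ : ℂ} (hτ : 0 < τ.im) : ∃ a b : ℂ, Orb (arc θ) a ∧
      Orb (arc θ) b ∧ c * (blaschke a τ * blaschke b τ) ≤ ‖jInv (nome τ) - c‖ := by
  obtain ⟨τ', hO, hre, hn⟩ := exists_orb_mem_fd hτ
  have hτ' := hO.im_pos hτ
  have hz : 0 < (arc θ).im :=
    arc_im_pos ⟨by linarith [hθ.1, Real.pi_pos], by linarith [hθ.2, Real.pi_pos]⟩
  have h := hO.symm hτ
  clear hO
  induction h with
  | refl => exact ⟨_, _, .refl, Orb.refl.fricke, mul_blaschke_le_of_fundDom hθ hc ⟨hτ', hre, hn⟩⟩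
  | @add_one w hw ih =>
    obtain ⟨a, b, ha, hb, h1⟩ := ih (hw.im_pos hτ')
    refine ⟨a + 1, b + 1, ha.add_one, hb.add_one, ?_⟩
    have e1 := blaschke_add_real a w 1
    have e2 := blaschke_add_real b w 1
    rw [ofReal_one] at e1 e2
    rwa [e1, e2, nome_add_one]
  | @sub_one w hw ih =>
    obtain ⟨a, b, ha, hb, h1⟩ := ih (hw.im_pos hτ')
    refine ⟨a - 1, b - 1, ha.sub_one, hb.sub_one, ?_⟩
    have e1 := blaschke_add_real (a - 1) (w - 1) 1
    have e2 := blaschke_add_real (b - 1) (w - 1) 1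
    simp only [ofReal_one, sub_add_cancel] at e1 e2
    rw [← e1, ← e2]
    rwa [show nome (w - 1) = nome w by rw [← nome_add_one (w - 1), sub_add_cancel]]
  | @fricke w hw ih =>
    have hwi := hw.im_pos hτ'
    obtain ⟨a, b, ha, hb, h1⟩ := ih hwi
    refine ⟨_, _, ha.fricke, hb.fricke, ?_⟩
    rwa [blaschke_fricke (ha.im_pos hz) hwi, blaschke_fricke (hb.im_pos hz) hwi, jInv_fricke hwi]

/-! ### Heights in the orbit of a point of the arc -/

/-- The quadratic form `u² - p u v + 3 v²` governing heights in the orbit of `e^{iθ}/√3`, where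
`p = -2√3 cos θ`. -/
def heightForm (p : ℝ) (u v : ℤ) : ℝ := u ^ 2 - p * u * v + 3 * v ^ 2

/-- `p = -2√3 cos θ`. -/
def arcParam (θ : ℝ) : ℝ := -(2 * √3 * Real.cos θ)

lemma arc_re_eq (θ : ℝ) : (arc θ).re = -(arcParam θ) / 6 := by
  have h := sqrt_three_sq
  have h' := sqrt_three_pos
  rw [arc_re, arcParam]; field_simp; linear_combination (-2 * Real.cos θ) * h

lemma normSq_linear_arc (θ x y : ℝ) :
    normSq ((x : ℂ) * arc θ + y) = x ^ 2 / 3 - arcParam θ * x * y / 3 + y ^ 2 := by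
  have h := three_mul_normSq_arc θ
  have h1 := arc_re_eq θ
  rw [normSq_apply] at h ⊢
  simp only [add_re, mul_re, ofReal_re, ofReal_im, zero_mul, sub_zero, add_im, mul_im, add_zero]
  rw [h1] at h ⊢
  linear_combination (x ^ 2 / 3) * h

/-- The two families of orbit points. -/
lemma orb_cases {θ : ℝ} (hz : 0 < (arc θ).im) {τ : ℂ} (h : Orb (arc θ) τ) : ∃ u v : ℤ,
    τ.im * heightForm (arcParam θ) u v = (arc θ).im ∧
    ((∃ a b : ℤ, a * u - 3 * b * v = 1 ∧ τ * (3 * v * arc θ + u) = a * arc θ + b) ∨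
      ∃ a b : ℤ, 3 * a * v - b * u = 1 ∧ τ * (3 * (u * arc θ + v)) = 3 * a * arc θ + b) := by
  obtain ⟨a, b, c, d, ⟨h1, h2⟩ | ⟨h1, h2⟩⟩ := h.exists_matrix hz
  · refine ⟨d, c, ?_, .inl ⟨a, b, h1, h2⟩⟩
    have h3 := im_mul_normSq (z := arc θ) (τ := τ) (a := a) (b := b) (c := 3 * c) (d := d)
      (by push_cast; exact h2)
    have h4 : (a : ℝ) * d - b * (3 * c) = 1 := by
      have : ((a * d - 3 * b * c : ℤ) : ℝ) = 1 := by rw [h1]; norm_num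
      push_cast at this; linarith
    rw [h4, one_mul, normSq_linear_arc] at h3
    rw [← h3, heightForm]; ring
  · refine ⟨c, d, ?_, .inr ⟨a, b, h1, h2⟩⟩
    have h3 := im_mul_normSq (z := arc θ) (τ := τ) (a := 3 * a) (b := b) (c := 3 * c) (d := 3 * d)
      (by push_cast; linear_combination h2)
    have h4 : (3 * a : ℝ) * (3 * d) - b * (3 * c) = 3 := by
      have : ((3 * a * d - b * c : ℤ) : ℝ) = 1 := by rw [h1]; norm_num
      push_cast at this; linarith
    rw [h4, normSq_linear_arc] at h3
    rw [heightForm]; linarith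

lemma coprime_of_orb {u v : ℤ} {P Q : ℤ → ℤ → Prop}
    (h : (∃ a b : ℤ, a * u - 3 * b * v = 1 ∧ P a b) ∨ ∃ a b : ℤ, 3 * a * v - b * u = 1 ∧ Q a b) :
    ∃ x y : ℤ, x * u + 3 * (y * v) = 1 := by
  rcases h with ⟨a, b, h, -⟩ | ⟨a, b, h, -⟩
  · exact ⟨a, -b, by linarith⟩
  · exact ⟨-b, a, by linarith⟩

/-- Write the form as `(u² - 3uv + 3v²) + (3 - p)uv`. The first part is a positive integer, which
settles `uv ≥ 1`. For `uv ≤ 0` the form is at least `u² + 3v² ≥ 4`. -/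
lemma heightForm_ge_of_ne_zero {p : ℝ} (h0 : 0 ≤ p) (h3 : p ≤ 3) {u v : ℤ} (hv : v ≠ 0)
    (hc : ∃ x y : ℤ, x * u + 3 * (y * v) = 1) : 4 - p ≤ heightForm p u v := by
  have hu : u ≠ 0 := by
    rintro rfl
    obtain ⟨x, y, h⟩ := hc
    omega
  have hv2 : 1 ≤ v * v := by
    rcases lt_or_gt_of_ne hv with h | h <;> nlinarith
  have hu2 : 1 ≤ u * u := by
    rcases lt_or_gt_of_ne hu with h | h <;> nlinarith
  have hN : 1 ≤ u * u - 3 * (u * v) + 3 * (v * v) := by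
    nlinarith [mul_self_nonneg (2 * u - 3 * v)]
  have hv2' : (1 : ℝ) ≤ v * v := by exact_mod_cast hv2
  have hu2' : (1 : ℝ) ≤ u * u := by exact_mod_cast hu2
  have hN' : (1 : ℝ) ≤ u * u - 3 * (u * v) + 3 * (v * v) := by exact_mod_cast hN
  rw [heightForm]
  rcases le_or_gt 1 (u * v) with h | h
  · have h' : (1 : ℝ) ≤ u * v := by exact_mod_cast h
    nlinarith [mul_nonneg (sub_nonneg.2 h3) (sub_nonneg.2 h')]
  · have h' : (u : ℝ) * v ≤ 0 := by exact_mod_cast Int.lt_add_one_iff.1 h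
    nlinarith [mul_nonneg h0 (neg_nonneg.2 h')]

lemma unit_of_coprime_zero {u : ℤ} (hc : ∃ x y : ℤ, x * u + 3 * (y * 0) = 1) : u = 1 ∨ u = -1 := by
  obtain ⟨x, y, h⟩ := hc
  exact Int.eq_one_or_neg_one_of_mul_eq_one (u := u) (v := x) (by linarith)

/-- For `uv > 0` the form is at least the integer `u² - 3uv + 3v²`. Below `6`, coprimality of `u`
and `3v` leaves only the value `1`, attained up to sign at `(1,0)`, `(1,1)`, `(2,1)`; the value `3`
would need `3 ∣ u`. -/
lemma heightForm_cases {p : ℝ} (h0 : 2.25 ≤ p) (h3 : p ≤ 3) {u v : ℤ}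
    (hc : ∃ x y : ℤ, x * u + 3 * (y * v) = 1) :
    (∃ s : ℤ, (s = 1 ∨ s = -1) ∧
      ((u = s * 1 ∧ v = s * 0) ∨ (u = s * 1 ∧ v = s * 1) ∨ (u = s * 2 ∧ v = s * 1))) ∨
      6 ≤ heightForm p u v := by
  rcases eq_or_ne v 0 with rfl | hv
  · exact .inl ⟨u, unit_of_coprime_zero hc, .inl ⟨by simp, by simp⟩⟩
  have hu : u ≠ 0 := by
    rintro rfl
    obtain ⟨x, y, h⟩ := hc
    omega
  have hv2 : 1 ≤ v * v := by
    rcases lt_or_gt_of_ne hv with h | h <;> nlinarith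
  have hu2 : 1 ≤ u * u := by
    rcases lt_or_gt_of_ne hu with h | h <;> nlinarith
  have hv2' : (1 : ℝ) ≤ v * v := by exact_mod_cast hv2
  have hu2' : (1 : ℝ) ≤ u * u := by exact_mod_cast hu2
  rcases lt_or_gt_of_ne (mul_ne_zero hu hv) with h | h
  · right
    have h' : (u : ℝ) * v ≤ -1 := by exact_mod_cast Int.le_sub_one_of_lt h
    rw [heightForm]
    nlinarith [mul_nonneg (by linarith : (0 : ℝ) ≤ p) (by linarith : (0 : ℝ) ≤ -1 - u * v)]
  · have h' : (0 : ℝ) < u * v := by exact_mod_cast h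
    rcases le_or_gt 6 (u * u - 3 * (u * v) + 3 * (v * v)) with hN | hN
    · right
      have hN' : (6 : ℝ) ≤ u * u - 3 * (u * v) + 3 * (v * v) := by exact_mod_cast hN
      rw [heightForm]
      nlinarith [mul_nonneg (sub_nonneg.2 h3) h'.le]
    · left
      -- From `4(u² - 3uv + 3v²) = (2u - 3v)² + 3v²`.
      have b1 : -2 ≤ v := by nlinarith [mul_self_nonneg (2 * u - 3 * v)]
      have b2 : v ≤ 2 := by nlinarith [mul_self_nonneg (2 * u - 3 * v)]
      have b3 : -4 ≤ 2 * u - 3 * v := by nlinarith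
      have b4 : 2 * u - 3 * v ≤ 4 := by nlinarith
      have b5 : -5 ≤ u := by linarith
      have b6 : u ≤ 5 := by linarith
      obtain ⟨x, y, hxy⟩ := hc
      interval_cases v <;> interval_cases u <;> first | omega | skip
      all_goals first
        | (refine ⟨1, .inl rfl, ?_⟩; omega)
        | (refine ⟨-1, .inr rfl, ?_⟩; omega)

/-! ### The points of the orbit with large height -/

/-- The four orbit points of a point `z` of the arc which follow `z` and `-1/(3z)` in height. -/
def lowPoint (z : ℂ) : Fin 4 → ℂ :=
  ![fricke (z + 1), fricke (fricke z - 1), fricke (fricke (z + 1) + 1),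
    fricke (fricke (fricke z - 1) - 1)]

lemma orb_lowPoint (z : ℂ) (i : Fin 4) : Orb z (lowPoint z i) := by
  fin_cases i
  · exact Orb.refl.add_one.fricke
  · exact Orb.refl.fricke.sub_one.fricke
  · exact Orb.refl.add_one.fricke.add_one.fricke
  · exact Orb.refl.fricke.sub_one.fricke.sub_one.fricke

lemma nome_eq_of_sub_int {τ w : ℂ} {n : ℤ} (h : τ = w + n) : nome τ = nome w := by
  rw [h, nome_add_int]

lemma nome_eq_of_linear {τ w A B : ℂ} {n : ℤ} (hA : A ≠ 0) (h : τ * A = B) (h' : (w + n) * A = B) :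
    nome τ = nome w :=
  nome_eq_of_sub_int (mul_right_cancel₀ hA (h.trans h'.symm))

lemma linear_int_ne_zero {z : ℂ} (hz : 0 < z.im) {c d : ℤ} (h : c ≠ 0 ∨ d ≠ 0) :
    (c : ℂ) * z + d ≠ 0 := by
  have := linear_ne_zero hz (c := c) (d := d) (by exact_mod_cast h)
  simpa using this

/-- `τ` is an orbit point of `z` with bottom row given by `(u, v)`. -/
def OrbRow (z τ : ℂ) (u v : ℤ) : Prop :=
  (∃ a b : ℤ, a * u - 3 * b * v = 1 ∧ τ * (3 * v * z + u) = a * z + b) ∨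
    ∃ a b : ℤ, 3 * a * v - b * u = 1 ∧ τ * (3 * (u * z + v)) = 3 * a * z + b

lemma OrbRow.of_sign {z τ : ℂ} {s u v : ℤ} (hs : s = 1 ∨ s = -1) (h : OrbRow z τ (s * u) (s * v)) :
    OrbRow z τ u v := by
  have hs2 : s * s = 1 := by rcases hs with rfl | rfl <;> norm_num
  have hs2' : (s : ℂ) * s = 1 := by exact_mod_cast hs2
  rcases h with ⟨a, b, h1, h2⟩ | ⟨a, b, h1, h2⟩
  · refine .inl ⟨s * a, s * b, by linear_combination h1, ?_⟩
    push_cast at h2 ⊢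
    linear_combination s * h2 - (τ * (3 * v * z + u)) * hs2'
  · refine .inr ⟨s * a, s * b, by linear_combination h1, ?_⟩
    push_cast at h2 ⊢
    linear_combination s * h2 - (τ * (3 * (u * z + v))) * hs2'

/-- A row `(u, v)` determines a matrix of either family up to a translation on the left, which the
nome ignores. Each row thus gives one nome per family; the same holds for the rows `(1, 1)` and `(2,
1)`. -/
lemma OrbRow.one_zero {z τ : ℂ} (hz : 0 < z.im) (h : OrbRow z τ 1 0) :
    nome τ = nome z ∨ nome τ = nome (fricke z) := by
  have hz0 := ne_zero_of_im_pos hz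
  rcases h with ⟨a, b, h1, h2⟩ | ⟨a, b, h1, h2⟩
  · left
    obtain rfl : a = 1 := by linarith
    exact nome_eq_of_sub_int (n := b) (by push_cast at h2; linear_combination h2)
  · right
    obtain rfl : b = -1 := by linarith
    refine nome_eq_of_linear (n := a) (A := 3 * z) (by simpa using hz0) (B := 3 * a * z - 1) ?_ ?_
    · push_cast at h2; linear_combination h2
    · rw [fricke]; field_simp; ring

lemma lowPoint_zero_mul {z : ℂ} (hz : 0 < z.im) : lowPoint z 0 * (3 * z + 3) = -1 := by
  have n2 : z + 1 ≠ 0 := by simpa using linear_int_ne_zero hz (c := 1) (d := 1) (by simp)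
  have : lowPoint z 0 = fricke (z + 1) := rfl
  rw [this, fricke, show 3 * z + 3 = 3 * (z + 1) by ring]; field_simp

lemma lowPoint_one_mul {z : ℂ} (hz : 0 < z.im) : lowPoint z 1 * (3 * z + 1) = z := by
  have hz0 := ne_zero_of_im_pos hz
  have n1 : 3 * z + 1 ≠ 0 := by simpa using linear_int_ne_zero hz (c := 3) (d := 1) (by simp)
  have h3 : fricke z - 1 = -(3 * z + 1) / (3 * z) := by rw [fricke]; field_simp; ring
  have : lowPoint z 1 = fricke (fricke z - 1) := rfl
  rw [this, h3, fricke]; field_simp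

lemma lowPoint_two_mul {z : ℂ} (hz : 0 < z.im) : lowPoint z 2 * (3 * z + 2) = -z - 1 := by
  have n2 : z + 1 ≠ 0 := by simpa using linear_int_ne_zero hz (c := 1) (d := 1) (by simp)
  have n3 : 3 * z + 2 ≠ 0 := by simpa using linear_int_ne_zero hz (c := 3) (d := 2) (by simp)
  have h3 : fricke (z + 1) + 1 = (3 * z + 2) / (3 * (z + 1)) := by rw [fricke]; field_simp; ring
  have : lowPoint z 2 = fricke (fricke (z + 1) + 1) := rfl
  rw [this, h3, fricke]; field_simp; ring

lemma lowPoint_three_mul {z : ℂ} (hz : 0 < z.im) : lowPoint z 3 * (6 * z + 3) = 3 * z + 1 := by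
  have n1 : 3 * z + 1 ≠ 0 := by simpa using linear_int_ne_zero hz (c := 3) (d := 1) (by simp)
  have n4 : 2 * z + 1 ≠ 0 := by simpa using linear_int_ne_zero hz (c := 2) (d := 1) (by simp)
  have h4 : fricke (fricke z - 1) - 1 = -(2 * z + 1) / (3 * z + 1) := by
    rw [eq_div_iff n1, sub_mul]
    have := lowPoint_one_mul hz
    rw [show lowPoint z 1 = fricke (fricke z - 1) from rfl] at this
    rw [this]; ring
  have : lowPoint z 3 = fricke (fricke (fricke z - 1) - 1) := rfl
  rw [this, h4, fricke, show 6 * z + 3 = 3 * (2 * z + 1) by ring]; field_simp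

lemma im_lowPoint_mul {θ : ℝ} (hz : 0 < (arc θ).im) (i : Fin 4) :
    (lowPoint (arc θ) i).im * (if i = 0 ∨ i = 1 then 4 - arcParam θ else 7 - 2 * arcParam θ) =
      (arc θ).im := by
  fin_cases i
  · have h := im_mul_normSq (a := 0) (b := -1) (c := 3) (d := 3) (z := arc θ)
      (τ := lowPoint (arc θ) 0)
      (by push_cast; linear_combination lowPoint_zero_mul hz)
    rw [normSq_linear_arc] at h
    simp
    linarith
  · have h := im_mul_normSq (a := 1) (b := 0) (c := 3) (d := 1) (z := arc θ)
      (τ := lowPoint (arc θ) 1)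
      (by push_cast; linear_combination lowPoint_one_mul hz)
    rw [normSq_linear_arc] at h
    simp
    linarith
  · have h := im_mul_normSq (a := -1) (b := -1) (c := 3) (d := 2) (z := arc θ)
      (τ := lowPoint (arc θ) 2)
      (by push_cast; linear_combination lowPoint_two_mul hz)
    rw [normSq_linear_arc] at h
    simp
    linarith
  · have h := im_mul_normSq (a := 3) (b := 1) (c := 6) (d := 3) (z := arc θ)
      (τ := lowPoint (arc θ) 3)
      (by push_cast; linear_combination lowPoint_three_mul hz)
    rw [normSq_linear_arc] at h
    simp
    linarith

lemma OrbRow.one_one {z τ : ℂ} (hz : 0 < z.im) (h : OrbRow z τ 1 1) :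
    nome τ = nome (lowPoint z 1) ∨ nome τ = nome (lowPoint z 0) := by
  have hz0 := ne_zero_of_im_pos hz
  have n1 : 3 * z + 1 ≠ 0 := by simpa using linear_int_ne_zero hz (c := 3) (d := 1) (by simp)
  have n2 : z + 1 ≠ 0 := by simpa using linear_int_ne_zero hz (c := 1) (d := 1) (by simp)
  have e1 := lowPoint_one_mul hz
  have e0 := lowPoint_zero_mul hz
  rcases h with ⟨a, b, h1, h2⟩ | ⟨a, b, h1, h2⟩
  · left
    obtain rfl : a = 1 + 3 * b := by linarith
    refine nome_eq_of_linear (n := b) n1 (B := (1 + 3 * b) * z + b) ?_ ?_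
    · push_cast at h2; linear_combination h2
    · linear_combination e1
  · right
    obtain rfl : b = 3 * a - 1 := by linarith
    refine nome_eq_of_linear (n := a) (mul_ne_zero three_ne_zero n2)
      (B := 3 * a * z + (3 * a - 1)) ?_ ?_
    · push_cast at h2; linear_combination h2
    · linear_combination e0

lemma OrbRow.two_one {z τ : ℂ} (hz : 0 < z.im) (h : OrbRow z τ 2 1) :
    nome τ = nome (lowPoint z 2) ∨ nome τ = nome (lowPoint z 3) := by
  have n3 : 3 * z + 2 ≠ 0 := by simpa using linear_int_ne_zero hz (c := 3) (d := 2) (by simp)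
  have n4 : 2 * z + 1 ≠ 0 := by simpa using linear_int_ne_zero hz (c := 2) (d := 1) (by simp)
  have e2 := lowPoint_two_mul hz
  have e3 := lowPoint_three_mul hz
  rcases h with ⟨a, b, h1, h2⟩ | ⟨a, b, h1, h2⟩
  · left
    obtain ⟨n, rfl, rfl⟩ : ∃ n, a = 3 * n - 1 ∧ b = 2 * n - 1 := ⟨(b + 1) / 2, by omega, by omega⟩
    refine nome_eq_of_linear (n := n) n3 (B := (3 * n - 1) * z + (2 * n - 1)) ?_ ?_
    · push_cast at h2; linear_combination h2
    · linear_combination e2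
  · right
    obtain ⟨n, rfl, rfl⟩ : ∃ n, a = 1 + 2 * n ∧ b = 1 + 3 * n := ⟨(a - 1) / 2, by omega, by omega⟩
    refine nome_eq_of_linear (n := n) (mul_ne_zero three_ne_zero n4)
      (B := 3 * (1 + 2 * n) * z + (1 + 3 * n)) ?_ ?_
    · push_cast at h2; linear_combination h2
    · linear_combination e3

lemma orb_row {θ : ℝ} (hz : 0 < (arc θ).im) {τ : ℂ} (h : Orb (arc θ) τ) : ∃ u v : ℤ,
    (∃ x y : ℤ, x * u + 3 * (y * v) = 1) ∧ τ.im * heightForm (arcParam θ) u v = (arc θ).im ∧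
    OrbRow (arc θ) τ u v := by
  obtain ⟨u, v, h1, h2⟩ := orb_cases hz h
  exact ⟨u, v, coprime_of_orb h2, h1, h2⟩

/-- Apart from translates of `z` and `-1/(3z)`, the orbit points have height at most
`Im z/(4 - p)`. -/
lemma nome_eq_or_im_le {θ : ℝ} (hz : 0 < (arc θ).im) (h0 : 0 ≤ arcParam θ) (h3 : arcParam θ ≤ 3)
    {τ : ℂ} (h : Orb (arc θ) τ) :
    ((nome τ = nome (arc θ) ∨ nome τ = nome (fricke (arc θ))) ∧ τ.im = (arc θ).im) ∨
      τ.im * (4 - arcParam θ) ≤ (arc θ).im := by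
  obtain ⟨u, v, hc, h1, h2⟩ := orb_row hz h
  rcases eq_or_ne v 0 with rfl | hv
  · left
    have hu := unit_of_coprime_zero hc
    refine ⟨OrbRow.one_zero hz (OrbRow.of_sign (s := u) hu (by simpa using h2)), ?_⟩
    rw [heightForm] at h1
    rcases hu with rfl | rfl <;> simpa using h1
  · right
    rw [← h1]
    exact mul_le_mul_of_nonneg_left (heightForm_ge_of_ne_zero h0 h3 hv hc) (h.im_pos hz).le

/-- Apart from translates of six points, the orbit points have height at most `Im z/6`. -/
lemma nome_eq_or_im_le_six {θ : ℝ} (hz : 0 < (arc θ).im) (h0 : 2.25 ≤ arcParam θ)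
    (h3 : arcParam θ ≤ 3) {τ : ℂ} (h : Orb (arc θ) τ) :
    ((nome τ = nome (arc θ) ∨ nome τ = nome (fricke (arc θ))) ∧ τ.im = (arc θ).im) ∨
    ((∃ i, nome τ = nome (lowPoint (arc θ) i)) ∧ (τ.im * (4 - arcParam θ) = (arc θ).im ∨
      τ.im * (7 - 2 * arcParam θ) = (arc θ).im)) ∨ τ.im * 6 ≤ (arc θ).im := by
  obtain ⟨u, v, hc, h1, h2⟩ := orb_row hz h
  rcases heightForm_cases h0 h3 hc with ⟨s, hs, h4⟩ | h4
  · have hs2 : (s : ℝ) * s = 1 := by rcases hs with rfl | rfl <;> norm_num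
    rcases h4 with ⟨rfl, rfl⟩ | ⟨rfl, rfl⟩ | ⟨rfl, rfl⟩
    · refine .inl ⟨OrbRow.one_zero hz (h2.of_sign hs), ?_⟩
      rw [heightForm] at h1
      push_cast at h1
      linear_combination h1 - τ.im * hs2
    · refine .inr (.inl ⟨?_, .inl ?_⟩)
      · rcases OrbRow.one_one hz (h2.of_sign hs) with h5 | h5 <;> exact ⟨_, h5⟩
      · rw [heightForm] at h1
        push_cast at h1
        linear_combination h1 - (τ.im * (4 - arcParam θ)) * hs2
    · refine .inr (.inl ⟨?_, .inr ?_⟩)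
      · rcases OrbRow.two_one hz (h2.of_sign hs) with h5 | h5 <;> exact ⟨_, h5⟩
      · rw [heightForm] at h1
        push_cast at h1
        linear_combination h1 - (τ.im * (7 - 2 * arcParam θ)) * hs2
  · refine .inr (.inr ?_)
    rw [← h1]
    exact mul_le_mul_of_nonneg_left h4 (h.im_pos hz).le

/-! ### Transformation of the base form along an orbit -/

lemma baseForm_fricke {ℓ : ℤ} {a b e : ℕ} (hpar : Even (a + b + e)) {τ : ℂ} (h : 0 < τ.im) :
    baseForm ℓ a b e (nome (fricke τ)) =
      ((√3 : ℝ) * τ) ^ (12 * ℓ + (2 * a + 4 * b + 6 * e : ℕ)) * baseForm ℓ a b e (nome τ) := by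
  have h0 : ((√3 : ℝ) : ℂ) * τ ≠ 0 := mul_ne_zero sqrt_three_ne_zero (ne_zero_of_im_pos h)
  rw [baseForm, baseForm, formS_zpow_fricke ℓ h, formF_fricke hpar h, zpow_add₀ h0, zpow_natCast]
  ring

/-- `|g(τ)| (Im τ)^{k/2}` is invariant for a form of weight `k`; the exponent here is `k/2`. -/
lemma Orb.norm_baseForm {ℓ : ℤ} {a b e : ℕ} (hpar : Even (a + b + e)) {z τ : ℂ} (hz : 0 < z.im)
    (h : Orb z τ) : ‖baseForm ℓ a b e (nome τ)‖ * τ.im ^ (6 * ℓ + (a + 2 * b + 3 * e : ℕ)) =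
      ‖baseForm ℓ a b e (nome z)‖ * z.im ^ (6 * ℓ + (a + 2 * b + 3 * e : ℕ)) := by
  refine h.apply_eq
    (g := fun τ => ‖baseForm ℓ a b e (nome τ)‖ * τ.im ^ (6 * ℓ + (a + 2 * b + 3 * e : ℕ)))
    (fun τ _ => by simp only [nome_add_one, add_im, one_im, add_zero]) (fun τ hτ => ?_) hz
  have h1 := normSq_pos_of_im_pos hτ
  have h2 : 0 < ‖((√3 : ℝ) : ℂ) * τ‖ :=
    norm_pos_iff.2 (mul_ne_zero sqrt_three_ne_zero (ne_zero_of_im_pos hτ))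
  have h3 : 3 * normSq τ = ‖((√3 : ℝ) : ℂ) * τ‖ ^ 2 := by
    rw [norm_mul, mul_pow, ← normSq_eq_norm_sq, ← normSq_eq_norm_sq, normSq_ofReal,
      Real.mul_self_sqrt (by norm_num)]
  simp only [baseForm_fricke hpar hτ, norm_mul, norm_zpow, fricke_im]
  rw [h3, div_zpow, ← norm_mul, ← zpow_natCast ‖((√3 : ℝ) : ℂ) * τ‖ 2, ← zpow_mul]
  have e1 : (12 * ℓ + (2 * a + 4 * b + 6 * e : ℕ) : ℤ) =
      ((2 : ℕ) : ℤ) * (6 * ℓ + (a + 2 * b + 3 * e : ℕ)) := by push_cast; ring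
  rw [e1]
  have := (zpow_pos h2 (((2 : ℕ) : ℤ) * (6 * ℓ + (a + 2 * b + 3 * e : ℕ)))).ne'
  field_simp

lemma Orb.norm_baseForm_div {ℓ : ℤ} {a b e : ℕ} (hpar : Even (a + b + e)) {z τ : ℂ} (hz : 0 < z.im)
    (h : Orb z τ) (h0 : jInv (nome z) ≠ 0) (h1 : jInv (nome z) ≠ 108) :
    ‖baseForm ℓ a b e (nome z) / baseForm ℓ a b e (nome τ)‖ =
      (τ.im / z.im) ^ (6 * ℓ + (a + 2 * b + 3 * e : ℕ)) := by
  have hτ := h.im_pos hz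
  have hj := h.jInv_eq hz
  rw [← hj] at h0 h1
  have h2 : 0 < ‖baseForm ℓ a b e (nome τ)‖ := norm_pos_iff.2
    (baseForm_ne_zero ℓ a b e (nome_mem_ball hτ) (nome_ne_zero _) h0 h1)
  have h3 := h.norm_baseForm (ℓ := ℓ) hpar hz
  have h4 := zpow_pos hz (6 * ℓ + (a + 2 * b + 3 * e : ℕ))
  generalize 6 * ℓ + ((a + 2 * b + 3 * e : ℕ) : ℤ) = n at h3 h4 ⊢
  rw [norm_div, div_zpow, div_eq_div_iff h2.ne' h4.ne', ← h3, mul_comm]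

/-! ### Basis elements as functions on the disc -/

/-- Weight `r` is realized by `1`, `A²`, `AD`, `AS`, `DS`, `A²DS`. The even number of factors fixes
the sign under `W`, and the order of vanishing at the cusp is `e = ε`. -/
lemma exists_exponents {r : ℤ} (hr : r ∈ ({0, 4, 6, 8, 10, 14} : Set ℤ)) : ∃ a b e : ℕ,
    a ≤ 2 ∧ b ≤ 1 ∧ e ≤ 1 ∧ Even (a + b + e) ∧ r = (2 * a + 4 * b + 6 * e : ℕ) ∧
      eps r = e := by
  simp only [Set.mem_insert_iff, Set.mem_singleton_iff] at hr
  rcases hr with rfl | rfl | rfl | rfl | rfl | rfl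
  · exact ⟨0, 0, 0, by decide⟩
  · exact ⟨2, 0, 0, by decide⟩
  · exact ⟨1, 1, 0, by decide⟩
  · exact ⟨1, 0, 1, by decide⟩
  · exact ⟨0, 1, 1, by decide⟩
  · exact ⟨2, 1, 1, by decide⟩

lemma coe_frickeMatrix_smul (z : ℍ) : ((frickeMatrix • z : ℍ) : ℂ) = fricke z := by
  have h := sqrt_three_ne_zero
  have h1 := sqrt_three_sq'
  have h2 := z.ne_zero
  rw [UpperHalfPlane.coe_specialLinearGroup_apply]
  simp [frickeMatrix, fricke]
  field_simp
  linear_combination h1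

lemma frickeMatrix_mem : frickeMatrix ∈ Gamma0Plus :=
  ⟨1, Subgroup.one_mem _, .inr (by simp)⟩

lemma IsBasisForm.exists_leading {ℓ r m : ℤ} {f : ℍ → ℂ} (hf : IsBasisForm ℓ r m f) {a b e : ℕ}
    (hr : r = (2 * a + 4 * b + 6 * e : ℕ)) (he : eps r = e) : ∃ h : ℂ → ℂ,
    DifferentiableOn ℂ h (ball 0 1) ∧ (∀ z : ℍ, f z = leading m ℓ e h (nome z)) ∧
    ∀ τ : ℂ, 0 < τ.im → leading m ℓ e h (nome (fricke τ)) =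
      ((√3 : ℝ) * τ) ^ (12 * ℓ + (2 * a + 4 * b + 6 * e : ℕ)) * leading m ℓ e h (nome τ) := by
  obtain ⟨c, hc⟩ := hf.2
  obtain ⟨h, hh, h1⟩ := exists_differentiableOn_of_hasSum hc
  have h2 : ∀ z : ℍ, f z = leading m ℓ e h (nome z) := by
    intro z
    have h3 := h1 z
    rw [he] at h3
    rw [leading]
    have h4 : q z = nome z := rfl
    rw [h4] at h3
    linear_combination h3
  refine ⟨h, hh, h2, fun τ hτ => ?_⟩
  have h3 := hf.1.modular _ frickeMatrix_mem ⟨τ, hτ⟩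
  rw [h2, h2, coe_frickeMatrix_smul, hr] at h3
  simpa [frickeMatrix] using h3

/-! ### The normalized basis element on the arc -/

lemma fricke_arc (θ : ℝ) : fricke (arc θ) = -(starRingEnd ℂ) (arc θ) :=
  fricke_of_normSq (three_mul_normSq_arc θ)

lemma fricke_arc_im (θ : ℝ) : (fricke (arc θ)).im = (arc θ).im := by simp [fricke_arc]

lemma fricke_arc_re (θ : ℝ) : (fricke (arc θ)).re = -(arc θ).re := by simp [fricke_arc]

lemma nome_zpow (τ : ℂ) (m : ℤ) : nome τ ^ m = cexp (m * (2 * Real.pi * I * τ)) := by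
  rw [nome, ← Complex.exp_int_mul]

lemma sqrt_three_mul_arc (θ : ℝ) : ((√3 : ℝ) : ℂ) * arc θ = cexp (I * θ) := by
  rw [arc, mul_div_cancel₀ _ sqrt_three_ne_zero]

lemma exp_mul_nome_zpow (m : ℤ) (τ : ℂ) :
    (Real.exp (-(2 * Real.pi * m * τ.im)) : ℂ) * nome τ ^ (-m) =
      cexp (-(2 * Real.pi * m * τ.re : ℝ) * I) := by
  rw [nome_zpow, ofReal_exp, ← Complex.exp_add]
  congr 1
  apply Complex.ext <;> simp <;> ring

lemma nome_arc_ne_nome_fricke {θ : ℝ} (hθ : θ ∈ Set.Ioo (Real.pi / 2) (5 * Real.pi / 6)) :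
    nome (arc θ) ≠ nome (fricke (arc θ)) := by
  intro h
  rw [nome, nome, Complex.exp_eq_exp_iff_exists_int] at h
  obtain ⟨n, hn⟩ := h
  have hpi := Real.pi_pos
  have h1 : arc θ = fricke (arc θ) + n := by
    apply mul_left_cancel₀ two_pi_I_ne_zero
    linear_combination hn
  have h2 := congrArg re h1
  rw [add_re, fricke_arc_re, intCast_re] at h2
  have h3 : (arc θ).re < 0 := by
    rw [arc_re]
    exact div_neg_of_neg_of_pos (Real.cos_neg_of_pi_div_two_lt_of_lt hθ.1 (by linarith [hθ.2]))
      sqrt_three_pos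
  have h4 := abs_lt.1 (abs_arc_re_lt (θ := θ) ⟨by linarith [hθ.1], hθ.2⟩)
  have h5 : (-1 : ℝ) < n := by linarith [h4.1]
  have h6 : (n : ℝ) < 0 := by linarith
  have h7 : -1 < n := by exact_mod_cast h5
  have h8 : n < 0 := by exact_mod_cast h6
  omega

/-- Since `√3 z = e^{iθ}`, the base form at `Wz` is `e^{ikθ}` times that at `z`. After normalization
the two residues become `e^{iα}` and `e^{-iα}` with `α` the phase. -/
lemma main_terms {k ℓ m : ℤ} {a b e : ℕ} (hpar : Even (a + b + e))
    (hk : k = 12 * ℓ + (2 * a + 4 * b + 6 * e : ℕ)) {θ : ℝ} (hz : 0 < (arc θ).im)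
    (h0 : baseForm ℓ a b e (nome (arc θ)) ≠ 0) :
    (Real.exp (-(2 * Real.pi * m * (arc θ).im)) : ℂ) * cexp (I * k * θ / 2) *
      (nome (arc θ) ^ (-m) * (baseForm ℓ a b e (nome (arc θ)) / baseForm ℓ a b e (nome (arc θ))) +
        nome (fricke (arc θ)) ^ (-m) *
          (baseForm ℓ a b e (nome (arc θ)) / baseForm ℓ a b e (nome (fricke (arc θ))))) =
      ((2 * Real.cos (phase k m θ) : ℝ) : ℂ) := by
  have e1 := exp_mul_nome_zpow m (arc θ)
  have e2 := exp_mul_nome_zpow m (fricke (arc θ))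
  rw [fricke_arc_im, fricke_arc_re] at e2
  have e3 : baseForm ℓ a b e (nome (arc θ)) / baseForm ℓ a b e (nome (fricke (arc θ))) =
      cexp (-(I * k * θ)) := by
    rw [baseForm_fricke hpar hz, ← hk, sqrt_three_mul_arc, ← Complex.exp_int_mul, Complex.exp_neg]
    have := Complex.exp_ne_zero (k * (I * θ))
    rw [show I * k * θ = k * (I * θ) by ring]
    field_simp
  rw [div_self h0, e3]
  have e4 : ∀ X E P₁ P₂ Y : ℂ, E * X * (P₁ * 1 + P₂ * Y) = X * (E * P₁) + X * Y * (E * P₂) := by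
    intros; ring
  rw [e4, e1, e2, ← Complex.exp_add, ← Complex.exp_add, ← Complex.exp_add]
  have hphase : phase k m θ = k * θ / 2 - 2 * Real.pi * m * (arc θ).re := by
    rw [phase, arc_re]; ring
  push_cast
  rw [Complex.cos, hphase]
  push_cast
  ring_nf

/-! ### The remainder on the arc -/

lemma normalized_eq {k m : ℤ} {f : ℍ → ℂ} {θ : ℝ} {F : ℂ → ℂ} (hf : ∀ z : ℍ, f z = F (nome z))
    (hθ : θ ∈ Set.Ioo 0 Real.pi) : normalized k m f θ =
      (Real.exp (-(2 * Real.pi * m * (arc θ).im)) : ℂ) * cexp (I * k * θ / 2) *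
        F (nome (arc θ)) := by
  rw [normalized, hf, coe_arcPoint (Real.sin_pos_of_mem_Ioo hθ), ← arc, arc_im]
  congr 5
  ring

lemma exp_neg_eq_norm_nome_zpow (m : ℤ) (τ : ℂ) :
    Real.exp (-(2 * Real.pi * m * τ.im)) = ‖nome τ‖ ^ m := by
  rw [norm_nome, ← Real.rpow_intCast, ← Real.exp_mul]; congr 1; ring

/-- The normalized basis element differs from `2 cos` by the residues at the further preimages `Z`
and a contour integral. -/
lemma norm_normalized_sub_le {k ℓ r m : ℤ} {a b e : ℕ} (ha : a ≤ 2) (hb : b ≤ 1) (he : e ≤ 1)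
    (hpar : Even (a + b + e)) (hr : r = (2 * a + 4 * b + 6 * e : ℕ)) (her : eps r = e)
    (hk : k = 12 * ℓ + r) {f : ℍ → ℂ} (hf : IsBasisForm ℓ r m f) (hN : 1 ≤ m + 2 * ℓ + 2 + e)
    {θ c R K : ℝ} (hθ : θ ∈ Set.Ioo (Real.pi / 2) (5 * Real.pi / 6))
    (hc0 : 0 < c) (hc1 : c < 108) (hc : jInv (nome (arc θ)) = c) (hR : ‖nome (arc θ)‖ < R)
    (hR1 : R < 1) {Z : Finset ℂ}
    (hZ : ∀ q ∈ Z, q ≠ nome (arc θ) ∧ q ≠ nome (fricke (arc θ)) ∧ q ≠ 0 ∧ ‖q‖ < R ∧ jInv q = c)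
    (hZ' : ∀ q, q ≠ 0 → ‖q‖ ≤ R → jInv q = c →
      q = nome (arc θ) ∨ q = nome (fricke (arc θ)) ∨ q ∈ Z)
    (hK : ∀ q, ‖q‖ = R →
      ‖baseForm ℓ a b e (nome (arc θ)) * kern m ℓ a b e c q‖ ≤ R ^ (-m - 1) * K) :
    ‖normalized k m f θ - ((2 * Real.cos (phase k m θ) : ℝ) : ℂ)‖ ≤
      ∑ p ∈ Z, (‖nome (arc θ)‖ / ‖p‖) ^ m *
        ‖baseForm ℓ a b e (nome (arc θ)) / baseForm ℓ a b e p‖ +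
      (‖nome (arc θ)‖ / R) ^ m * K := by
  classical
  have hpi := Real.pi_pos
  have hθ' : θ ∈ Set.Ioo 0 Real.pi := ⟨by linarith [hθ.1], by linarith [hθ.2]⟩
  have hz := arc_im_pos hθ'
  have hR0 : 0 < R := (norm_nonneg _).trans_lt hR
  obtain ⟨h, hh, h1, hW⟩ := hf.exists_leading hr her
  set w := nome (arc θ) with hw
  set w' := nome (fricke (arc θ)) with hw'
  have hw0 : w ≠ 0 := nome_ne_zero _
  have hw1 : w ∈ ball (0 : ℂ) 1 := nome_mem_ball hz
  have hj0 : jInv w ≠ 0 := by rw [hc]; exact_mod_cast hc0.ne'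
  have hj1 : jInv w ≠ 108 := by rw [hc]; exact_mod_cast hc1.ne
  have hww' : w ≠ w' := nome_arc_ne_nome_fricke hθ
  have hn' : ‖w'‖ = ‖w‖ := by rw [hw, hw', norm_nome, norm_nome, fricke_arc_im]
  have hj' : jInv w' = jInv w := jInv_fricke hz
  have hmem : w ∉ insert w' Z := by
    simp only [Finset.mem_insert, not_or]
    exact ⟨hww', fun h => (hZ _ h).1 rfl⟩
  have hmem' : w' ∉ Z := fun h => (hZ _ h).2.1 rfl
  have key := leading_eq_sum_add_integral ha hb he hpar hN hh hW hw1 hw0 hj0 hj1 hR0 hR1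
    (Z := insert w (insert w' Z)) (fun q hq => ?_) (fun q h0 h1 h2 => ?_)
  · rw [Finset.sum_insert hmem, Finset.sum_insert hmem', hc] at key
    have hbase := baseForm_ne_zero ℓ a b e hw1 hw0 hj0 hj1
    have main := main_terms (m := m) hpar (hr ▸ hk) hz hbase
    rw [normalized_eq h1 hθ', key, ← main, ← add_assoc, add_assoc (_ + _) _ _,
      mul_add, add_sub_cancel_left, norm_mul, norm_mul, norm_real,
      Real.norm_of_nonneg (Real.exp_pos _).le, exp_neg_eq_norm_nome_zpow, ← hw,
      show I * (k : ℂ) * θ / 2 = ((k * θ / 2 : ℝ) : ℂ) * I by push_cast; ring, norm_exp_ofReal_mul_I,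
      mul_one]
    calc _ ≤ ‖w‖ ^ m * (‖∑ p ∈ Z, p ^ (-m) * (baseForm ℓ a b e w / baseForm ℓ a b e p)‖ +
          ‖(2 * Real.pi * I : ℂ)⁻¹ * ∮ q in C(0, R), baseForm ℓ a b e w * kern m ℓ a b e c q‖) := by
            gcongr; exact norm_add_le _ _
      _ ≤ ‖w‖ ^ m * (∑ p ∈ Z, ‖p‖ ^ (-m) * ‖baseForm ℓ a b e w / baseForm ℓ a b e p‖ +
          R * (R ^ (-m - 1) * K)) := by
            gcongr
            · refine (norm_sum_le _ _).trans_eq (Finset.sum_congr rfl fun p _ => ?_)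
              rw [norm_mul, norm_zpow]
            · exact circleIntegral.norm_two_pi_i_inv_smul_integral_le_of_norm_le_const hR0.le
                (fun q hq => hK q (by simpa using hq))
      _ = _ := by
            have e1 : R * (R ^ (-m - 1) * K) = (R ^ m)⁻¹ * K := by
              rw [zpow_sub_one₀ hR0.ne', zpow_neg]; field_simp
            rw [mul_add, e1, Finset.mul_sum, div_zpow]
            congr 1
            · refine Finset.sum_congr rfl fun p _ => ?_
              rw [div_zpow, zpow_neg]; ring
            · ring
  · simp only [Finset.mem_insert] at hq
    rcases hq with rfl | rfl | hq
    · exact ⟨hw0, hR, rfl⟩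
    · exact ⟨nome_ne_zero _, hn' ▸ hR, hj'⟩
    · obtain ⟨-, -, h3, h4, h5⟩ := hZ q hq
      exact ⟨h3, h4, h5.trans hc.symm⟩
  · simp only [Finset.mem_insert]
    exact hZ' q h0 h1 (h2.trans hc)

/-! ### Numerical bounds on the arc -/

lemma cos_pi_sub_mem : Real.cos (Real.pi - 23 / 10) ∈ Set.Icc (0.6554 : ℝ) 0.6676 := by
  have h1 := Real.pi_gt_d4
  have h2 := Real.pi_lt_d4
  -- The angle is halved so that the fourth-order error of the cosine bound is small enough.
  set x := (Real.pi - 23 / 10) / 2 with hx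
  have hx0 : 0.42075 ≤ x := by rw [hx]; linarith
  have hx1 : x ≤ 0.4208 := by rw [hx]; linarith
  have h3 := abs_le.1 (Real.cos_bound (x := x) (by rw [abs_of_nonneg] <;> linarith))
  rw [abs_of_nonneg (by linarith)] at h3
  have h4 : x ^ 2 ≤ 0.4208 ^ 2 := by gcongr
  have h5 : 0.42075 ^ 2 ≤ x ^ 2 := by gcongr
  have h6 : x ^ 4 ≤ 0.4208 ^ 4 := by gcongr
  have h7 : 0.9098 ≤ Real.cos x := by norm_num at h4 h6; linarith [h3.1]
  have h8 : Real.cos x ≤ 0.91313 := by norm_num at h5 h6; linarith [h3.2]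
  rw [show Real.pi - 23 / 10 = 2 * x by rw [hx]; ring, Real.cos_two_mul]
  constructor <;> nlinarith

lemma arcParam_le {θ : ℝ} (h0 : Real.pi / 2 ≤ θ) (h1 : θ ≤ 23 / 10) :
    0 ≤ arcParam θ ∧ arcParam θ ≤ 2.313 := by
  have hpi := Real.pi_gt_d4
  have h2 : Real.cos (Real.pi - θ) ≤ Real.cos (Real.pi - 23 / 10) :=
    Real.cos_le_cos_of_nonneg_of_le_pi (by linarith) (by linarith) (by linarith)
  have h3 : 0 ≤ Real.cos (Real.pi - θ) := Real.cos_nonneg_of_mem_Icc ⟨by linarith, by linarith⟩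
  have h4 := cos_pi_sub_mem.2
  have h5 := sqrt_three_lt
  have h6 := sqrt_three_pos
  rw [arcParam, show -(2 * √3 * Real.cos θ) = 2 * √3 * Real.cos (Real.pi - θ) by
    rw [Real.cos_pi_sub]; ring]
  exact ⟨by positivity, by nlinarith⟩

lemma le_arcParam {θ : ℝ} (h0 : 23 / 10 ≤ θ) (h1 : θ ≤ Real.pi) : 2.27 ≤ arcParam θ := by
  have hpi := Real.pi_lt_d4
  have h2 : Real.cos (Real.pi - 23 / 10) ≤ Real.cos (Real.pi - θ) :=
    Real.cos_le_cos_of_nonneg_of_le_pi (by linarith) (by linarith) (by linarith)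
  have h4 := cos_pi_sub_mem.1
  have h5 := sqrt_three_gt
  rw [arcParam, show -(2 * √3 * Real.cos θ) = 2 * √3 * Real.cos (Real.pi - θ) by
    rw [Real.cos_pi_sub]; ring]
  nlinarith

lemma im_arc_sq (θ : ℝ) : 36 * (arc θ).im ^ 2 = 12 - arcParam θ ^ 2 := by
  have h := three_mul_normSq_arc θ
  rw [normSq_apply, arc_re_eq] at h
  linarith

lemma le_im_of_norm_nome_le {τ : ℂ} {R A : ℝ} (h : ‖nome τ‖ ≤ R)
    (hA : R ≤ Real.exp (-(2 * Real.pi * A))) : A ≤ τ.im := by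
  have h1 := h.trans hA
  rw [norm_nome, Real.exp_le_exp] at h1
  nlinarith [Real.pi_pos]

lemma im_le_of_le_norm_nome {τ : ℂ} {R A : ℝ} (h : R ≤ ‖nome τ‖)
    (hA : Real.exp (-(2 * Real.pi * A)) ≤ R) : τ.im ≤ A := by
  have h1 := hA.trans h
  rw [norm_nome, Real.exp_le_exp] at h1
  nlinarith [Real.pi_pos]

/-- Both Blaschke factors are bounded below through heights alone, so it suffices that the height of
`τ` avoids all heights in the orbit. -/
lemma le_norm_jInv_sub {θ c β : ℝ} {q : ℂ} (hθ : θ ∈ Set.Ioo (Real.pi / 2) (5 * Real.pi / 6))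
    (hc0 : 0 ≤ c) (hc : jInv (nome (arc θ)) = c) (hβ : 0 ≤ β) (hq0 : q ≠ 0) (hq1 : ‖q‖ < 1)
    (h : ∀ τ a : ℂ, nome τ = q → Orb (arc θ) a → β * (τ.im + a.im) ≤ |τ.im - a.im|) :
    c * β ^ 2 ≤ ‖jInv q - c‖ := by
  obtain ⟨τ, hτ, rfl⟩ := exists_nome_eq hq0 hq1
  obtain ⟨a, b, ha, hb, hab⟩ := exists_mul_blaschke_le hθ hc hτ
  have hpi := Real.pi_pos
  have hz := arc_im_pos (θ := θ) ⟨by linarith [hθ.1], by linarith [hθ.2]⟩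
  have key : ∀ a, Orb (arc θ) a → β ≤ blaschke a τ := fun a ha => by
    have ha' := ha.im_pos hz
    refine le_trans ?_ (le_blaschke ha' hτ)
    rw [le_div_iff₀ (by positivity)]
    exact h τ a rfl ha
  refine le_trans ?_ hab
  rw [sq]
  gcongr
  · exact blaschke_nonneg _ _
  · exact key a ha
  · exact key b hb

/-- A power `t ^ (2ℓ)` is absorbed by `x ^ m` once `m` is large compared with `|ℓ|`. -/
lemma zpow_mul_zpow_le {t x : ℝ} {ℓ m : ℤ} {N u v : ℕ} (ht : 0 < t) (hx : 0 < x) (hx1 : x ≤ 1)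
    (hu : t ^ 2 * x ^ u ≤ 1) (hv : x ^ v ≤ t ^ 2) (hm : 0 ≤ ℓ → N + u * ℓ ≤ m)
    (hm' : ℓ ≤ 0 → N - v * ℓ ≤ m) : t ^ (2 * ℓ) * x ^ m ≤ x ^ N := by
  obtain ⟨n, rfl | rfl⟩ := ℓ.eq_nat_or_neg
  · have h1 : x ^ m ≤ x ^ (N + u * n) := by
      rw [← zpow_natCast]
      exact zpow_le_zpow_right_of_le_one₀ hx hx1 (by push_cast; exact hm (by positivity))
    calc t ^ (2 * (n : ℤ)) * x ^ m ≤ t ^ (2 * n) * x ^ (N + u * n) := by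
          rw [show (2 * (n : ℤ)) = ((2 * n : ℕ) : ℤ) by push_cast; rfl, zpow_natCast]
          gcongr
      _ = (t ^ 2 * x ^ u) ^ n * x ^ N := by ring
      _ ≤ 1 ^ n * x ^ N := by gcongr
      _ = _ := by simp
  · have h1 : x ^ m ≤ x ^ (N + v * n) := by
      rw [← zpow_natCast]
      refine zpow_le_zpow_right_of_le_one₀ hx hx1 ?_
      have := hm' (by simp)
      push_cast; linarith
    rw [show 2 * -(n : ℤ) = -((2 * n : ℕ) : ℤ) by push_cast; ring, zpow_neg, zpow_natCast,
      inv_mul_le_iff₀ (by positivity)]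
    calc x ^ m ≤ x ^ (N + v * n) := h1
      _ = (x ^ v) ^ n * x ^ N := by ring
      _ ≤ (t ^ 2) ^ n * x ^ N := by gcongr
      _ = _ := by ring

/-! ### Bounds on the circle of radius `17/100` and the upper part of the arc -/

/-- The circle `|q| = 0.17` is the horizontal line at height about `0.282`. -/
lemma exp_two_pi_upper : Real.exp (-(2 * Real.pi * 0.2822)) ≤ 0.17 ∧
    0.17 ≤ Real.exp (-(2 * Real.pi * 0.2818)) := by
  have h1 := Real.pi_gt_d6
  have h2 := Real.pi_lt_d6
  rw [Real.exp_neg, Real.exp_neg, inv_le_comm₀ (Real.exp_pos _) (by norm_num),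
    le_inv_comm₀ (by norm_num) (Real.exp_pos _)]
  constructor
  · refine le_exp_of_taylor_pow (y := 0.8865) 2 (by norm_num) ?_ (by norm_num)
    push_cast; linarith
  · refine exp_le_of_taylor_pow (y := 0.8854) 2 (by norm_num) (by norm_num) ?_ (by norm_num)
    push_cast; linarith

lemma le_im_arc_upper {θ : ℝ} (h0 : Real.pi / 2 ≤ θ) (h1 : θ ≤ 23 / 10) : 0.4297 ≤ (arc θ).im := by
  have hpi := Real.pi_gt_d2
  obtain ⟨h2, h3⟩ := arcParam_le h0 h1
  have h4 := im_arc_sq θ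
  have h5 := arc_im_pos (θ := θ) ⟨by linarith, by linarith⟩
  nlinarith

lemma norm_nome_arc_upper_le {θ : ℝ} (h0 : Real.pi / 2 ≤ θ) (h1 : θ ≤ 23 / 10) :
    ‖nome (arc θ)‖ ≤ 0.0673 := by
  have h2 := le_im_arc_upper h0 h1
  have hpi := Real.pi_gt_d4
  rw [norm_nome, Real.exp_neg, inv_le_comm₀ (Real.exp_pos _) (by norm_num)]
  refine le_exp_of_taylor_pow (y := 0.8998) 3 (by norm_num) ?_ (by norm_num)
  push_cast
  nlinarith

/-- The next height after `y = Im z` is at most `y/(4 - p)`. With `36y² = 12 - p²` and `p ≤ 2.313`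
this is below `0.256`, leaving a gap around `0.282`. -/
lemma orb_upper {θ : ℝ} (h0 : Real.pi / 2 ≤ θ) (h1 : θ ≤ 23 / 10) {a : ℂ} (h : Orb (arc θ) a) :
    ((nome a = nome (arc θ) ∨ nome a = nome (fricke (arc θ))) ∧ 0.4297 ≤ a.im) ∨
      a.im ≤ 0.256 := by
  have hpi := Real.pi_gt_d2
  obtain ⟨h2, h3⟩ := arcParam_le h0 h1
  have h4 := im_arc_sq θ
  have h5 := arc_im_pos (θ := θ) ⟨by linarith, by linarith⟩
  rcases nome_eq_or_im_le h5 h2 (by linarith) h with ⟨h6, h7⟩ | h6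
  · exact .inl ⟨h6, h7 ▸ le_im_arc_upper h0 h1⟩
  · right
    by_contra! h7
    have h8 : 0.256 * (4 - arcParam θ) < (arc θ).im := by nlinarith
    have h9 : (0.256 * (4 - arcParam θ)) ^ 2 < (arc θ).im ^ 2 :=
      pow_lt_pow_left₀ h8 (by nlinarith) (by norm_num)
    nlinarith

lemma norm_formS_upper {q : ℂ} (hq : ‖q‖ = 0.17) : 0.0436 ≤ ‖formS q‖ ∧ ‖formS q‖ ≤ 0.6 := by
  constructor
  · exact norm_formS_ge (r := 0.17) (R := 0.17) hq.ge hq.le (by norm_num) (by norm_num [eulerLow])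
  · refine norm_formS_le (R := 0.17) (U := 1.2335) hq.le (by norm_num) ?_ (by norm_num)
    exact exp_le_of_taylor_pow (y := 0.20976) 1 (by norm_num) (by norm_num)
      (by norm_num) (by norm_num)

lemma norm_formA_le_of_bounds {q : ℂ} (hq : q ∈ ball (0 : ℂ) 1) (h0 : q ≠ 0)
    {R l l₃ u u₃ V X : ℝ} (hR : ‖q‖ ≤ R) (hl0 : 0 < l) (hl₃0 : 0 < l₃) (hl : l ≤ ‖eulerProd q‖)
    (hl₃ : l₃ ≤ ‖eulerProd (q ^ 3)‖) (hu : ‖eulerProd q‖ ≤ u) (hu₃ : ‖eulerProd (q ^ 3)‖ ≤ u₃)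
    (hV : ‖formS q‖ ≤ V) (hX : 0 ≤ X)
    (h : u ^ 18 / l₃ ^ 6 + 54 * V + 729 * (R ^ 2 * u₃ ^ 18 / l ^ 6) ≤ X ^ 3) : ‖formA q‖ ≤ X := by
  refine le_of_pow_le_pow_left₀ (n := 3) (by norm_num) hX ((norm_formA_pow_three_le hq h0).trans ?_)
  refine le_trans ?_ h
  have : 0 ≤ R := (norm_nonneg _).trans hR
  gcongr

lemma norm_formA_upper {q : ℂ} (hq : ‖q‖ = 0.17) : ‖formA q‖ ≤ 6 := by
  have hq3 : ‖q ^ 3‖ ≤ 0.17 ^ 3 := by rw [norm_pow, hq]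
  refine norm_formA_le_of_bounds (R := 0.17) (l := 0.8) (l₃ := 0.99) (u := 1.2275) (u₃ := 1.006)
    (by simp [hq]; norm_num) (by rintro rfl; norm_num at hq) hq.le (by norm_num) (by norm_num)
    (le_trans (by norm_num [eulerLow]) (eulerLow_le hq.le (by norm_num)))
    (le_trans (by norm_num [eulerLow]) (eulerLow_le hq3 (by norm_num)))
    ((norm_eulerProd_le hq.le (by norm_num)).trans ?_)
    ((norm_eulerProd_le hq3 (by norm_num)).trans ?_) (norm_formS_upper hq).2 (by norm_num)
    (by norm_num)
  · exact exp_le_of_taylor_pow (y := 0.20482) 1 (by norm_num) (by norm_num)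
      (by norm_num) (by norm_num)
  · exact exp_le_of_taylor_pow (y := 0.00494) 1 (by norm_num) (by norm_num)
      (by norm_num) (by norm_num)

lemma norm_jInv_sub_upper {θ c : ℝ} (hθ : θ ∈ Set.Ioo (Real.pi / 2) (5 * Real.pi / 6))
    (h1 : θ ≤ 23 / 10) (hc0 : 0 ≤ c) (hc : jInv (nome (arc θ)) = c) {q : ℂ} (hq : ‖q‖ = 0.17) :
    c * 0.047 ^ 2 ≤ ‖jInv q - c‖ := by
  -- `0.047` is slightly less than `(0.2818 - 0.256)/(0.2818 + 0.256)`, the tighter side of the gap.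
  refine le_norm_jInv_sub hθ hc0 hc (by norm_num) (by rintro rfl; norm_num at hq)
    (by rw [hq]; norm_num) fun τ a hτ ha => ?_
  rw [← hτ] at hq
  have h2 := le_im_of_norm_nome_le hq.le exp_two_pi_upper.2
  have h3 := im_le_of_le_norm_nome hq.ge exp_two_pi_upper.1
  rcases orb_upper hθ.1.le h1 ha with ⟨-, h4⟩ | h4
  · rw [abs_of_nonpos (by linarith)]; linarith
  · rw [abs_of_nonneg (by linarith)]; linarith

lemma kernel_bound_upper {θ c : ℝ} (hθ : θ ∈ Set.Ioo (Real.pi / 2) (5 * Real.pi / 6))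
    (h1 : θ ≤ 23 / 10) (hc0 : 0 < c) (hc1 : c < 108) (hc : jInv (nome (arc θ)) = c) {q : ℂ}
    (hq : ‖q‖ = 0.17) {a b e : ℕ} (ha : a ≤ 2) (hb : b ≤ 1) (he : e ≤ 1) :
    ‖formF a b e (nome (arc θ))‖ * ‖formF (2 - a) (1 - b) (1 - e) q‖ ≤
      12000000 * (‖formS q‖ ^ 2 * ‖jInv q - c‖) := by
  have hpi := Real.pi_gt_d4
  have hz := arc_im_pos (θ := θ) ⟨by linarith [hθ.1], by linarith [hθ.2]⟩
  have hq1 : q ∈ ball (0 : ℂ) 1 := by simp [hq]; norm_num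
  have hq0 : q ≠ 0 := by rintro rfl; norm_num at hq
  have hS := norm_formS_arc_le (Set.Ioo_subset_Icc_self hθ)
  obtain ⟨hS1, hS2⟩ := norm_formS_upper hq
  rcases le_total ‖jInv q‖ 216 with hj | hj
  -- `0.238` comes from `(3/4)(5π/6 - 23/10)` and `B = 160` from `(0.55/0.0436)²`; then `36B/(ωκ)`
  -- stays below `12000000`.
  · refine (kernel_bound_small (κ := 0.238) (ω := 0.047 ^ 2) (B := 160) ha hb he (nome_mem_ball hz)
      (nome_ne_zero _) hq1 hq0 hc hc1 (by norm_num) ?_ (by norm_num) (by norm_num)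
      (norm_jInv_sub_upper hθ h1 hc0.le hc hq) hj (by linarith) (by linarith) ?_
      (by norm_num)).trans ?_
    · refine le_trans ?_ (jInv_arc_ge hθ hc)
      gcongr
      linarith
    · calc ‖formS (nome (arc θ))‖ ^ 2 ≤ 0.55 ^ 2 := by gcongr
        _ ≤ 160 * 0.0436 ^ 2 := by norm_num
        _ ≤ _ := by gcongr
    · gcongr; norm_num
  · refine (kernel_bound_large (s := 0.0436) (X := 6) ha hb he (nome_mem_ball hz) (nome_ne_zero _)
      hq1 hq0 hc hc0 hc1 hj (by linarith) (by norm_num) (by norm_num) hS1 (norm_formA_upper hq)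
      (by norm_num) (by norm_num)).trans ?_
    gcongr; norm_num

/-- On the upper part of the arc the remainder is a contour integral, smaller than `1`. -/
theorem norm_normalized_sub_le_upper {k ℓ r m : ℤ} (hr : r ∈ ({0, 4, 6, 8, 10, 14} : Set ℤ))
    (hk : k = 12 * ℓ + r) {f : ℍ → ℂ} (hf : IsBasisForm ℓ r m f)
    (hm : 9 * |ℓ| - 2 * ℓ + 18 ≤ m) {θ : ℝ} (h0 : Real.pi / 2 < θ) (h1 : θ ≤ 23 / 10) :
    ‖normalized k m f θ - ((2 * Real.cos (phase k m θ) : ℝ) : ℂ)‖ ≤ 1 := by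
  have hpi := Real.pi_gt_d4
  have hθ : θ ∈ Set.Ioo (Real.pi / 2) (5 * Real.pi / 6) := ⟨h0, by linarith⟩
  obtain ⟨c, hc0, hc1, hc⟩ := exists_jInv_arc hθ
  obtain ⟨a, b, e, ha, hb, he, hpar, hr', her⟩ := exists_exponents hr
  have hw := norm_nome_arc_upper_le h0.le h1
  have hw0 : 0 < ‖nome (arc θ)‖ := norm_pos_iff.2 (nome_ne_zero _)
  have hab := abs_nonneg ℓ
  have hab1 := le_abs_self ℓ
  have hab2 := neg_abs_le ℓ
  have hx0 : 0 < ‖nome (arc θ)‖ / 0.17 := by positivity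
  have hx1 : ‖nome (arc θ)‖ / 0.17 ≤ 0.396 := by
    rw [div_le_iff₀ (by norm_num)]; linarith
  set x := ‖nome (arc θ)‖ / 0.17 with hx
  have hSl := norm_formS_arc_ge (Set.Ioo_subset_Icc_self hθ)
  have hSu := norm_formS_arc_le (Set.Ioo_subset_Icc_self hθ)
  -- `K` is chosen so that `x^m K = 12000000 x^18`; the remaining decay `x^{m-18}` pays for the
  -- power `2ℓ` of the ratio of values of `S`.
  have key := norm_normalized_sub_le (R := 0.17) (Z := ∅) (K := 12000000 * (x ^ 18 / x ^ m))
    ha hb he hpar hr' her hk hf (by linarith) hθ hc0 hc1 hc (by linarith) (by norm_num) (by simp)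
    (fun q hq0 hq1 hq => ?_) (fun q hq => ?_)
  · refine key.trans ?_
    rw [Finset.sum_empty, zero_add, ← hx]
    have := zpow_pos hx0 m
    calc x ^ m * (12000000 * (x ^ 18 / x ^ m)) = 12000000 * x ^ 18 := by field_simp
      _ ≤ 12000000 * 0.396 ^ 18 := by gcongr
      _ ≤ 1 := by norm_num
  · have hq2 : ‖q‖ < 1 := hq1.trans_lt (by norm_num)
    obtain ⟨τ, hτ, rfl⟩ := exists_nome_eq hq0 hq2
    have h2 := le_im_of_norm_nome_le hq1 exp_two_pi_upper.2
    rcases orb_upper h0.le h1 (orb_of_jInv_eq hθ hτ (hq.trans hc.symm)) with ⟨h3, -⟩ | h3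
    · simpa using h3
    · linarith
  · have hq1 : q ∈ ball (0 : ℂ) 1 := by simp [hq]; norm_num
    have hq0 : q ≠ 0 := by rintro rfl; norm_num at hq
    have hj : jInv q ≠ c := by
      have h2 := norm_jInv_sub_upper hθ h1 hc0.le hc hq
      rw [← sub_ne_zero, ← norm_pos_iff]
      exact lt_of_lt_of_le (by positivity) h2
    refine (norm_kern_le hq1 hq0 hj (kernel_bound_upper hθ h1 hc0 hc1 hc hq ha hb he)).trans ?_
    obtain ⟨hS1, hS2⟩ := norm_formS_upper hq
    rw [hq, mul_assoc, mul_comm (_ ^ (2 * ℓ))]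
    gcongr
    rw [le_div_iff₀ (zpow_pos hx0 m)]
    have ht1 : ‖formS (nome (arc θ))‖ / ‖formS q‖ ≤ 0.55 / 0.0436 := by gcongr
    have ht2 : 0.0073 / 0.6 ≤ ‖formS (nome (arc θ))‖ / ‖formS q‖ := by gcongr
    -- `9|ℓ| - 2ℓ` is `7ℓ` for `ℓ ≥ 0` and `-11ℓ` for `ℓ ≤ 0`.
    refine zpow_mul_zpow_le (u := 7) (v := 11) (by linarith) hx0 (by linarith) ?_ ?_
      (fun h => ?_) (fun h => ?_)
    · calc _ ≤ (0.55 / 0.0436 : ℝ) ^ 2 * 0.396 ^ 7 := by gcongr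
        _ ≤ 1 := by norm_num
    · calc x ^ 11 ≤ 0.396 ^ 11 := by gcongr
        _ ≤ (0.0073 / 0.6) ^ 2 := by norm_num
        _ ≤ _ := by gcongr
    · rw [abs_of_nonneg h] at hm
      push_cast; linarith
    · rw [abs_of_nonpos h] at hm
      push_cast; linarith

/-! ### Bounds on the circle of radius `45/100` and the lower part of the arc -/

lemma exp_two_pi_lower : Real.exp (-(2 * Real.pi * 0.1272)) ≤ 0.45 ∧
    0.45 ≤ Real.exp (-(2 * Real.pi * 0.127)) := by
  have h1 := Real.pi_gt_d6
  have h2 := Real.pi_lt_d6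
  rw [Real.exp_neg, Real.exp_neg, inv_le_comm₀ (Real.exp_pos _) (by norm_num),
    le_inv_comm₀ (by norm_num) (Real.exp_pos _)]
  constructor
  · refine le_exp_of_taylor_pow (y := 0.7992) 1 (by norm_num) ?_ (by norm_num)
    push_cast; linarith
  · refine exp_le_of_taylor_pow (y := 0.798) 1 (by norm_num) (by norm_num) ?_ (by norm_num)
    push_cast; linarith

lemma arcParam_lt_three {θ : ℝ} (hθ : θ ∈ Set.Ioo (Real.pi / 2) (5 * Real.pi / 6)) :
    arcParam θ < 3 := by
  have h := abs_arc_re_lt (θ := θ) ⟨by linarith [hθ.1, Real.pi_pos], hθ.2⟩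
  rw [arc_re_eq, abs_lt] at h
  linarith [h.1]

lemma im_arc_lower_le {θ : ℝ} (h0 : 23 / 10 ≤ θ) (h1 : θ < Real.pi) : (arc θ).im ≤ 0.4362 := by
  have h3 := le_arcParam h0 h1.le
  have h4 := im_arc_sq θ
  have h5 := arc_im_pos (θ := θ) ⟨by linarith, h1⟩
  nlinarith

lemma norm_formS_arc_lower_ge {θ : ℝ} (h0 : 23 / 10 ≤ θ) (h1 : θ ≤ 5 * Real.pi / 6) :
    0.0176 ≤ ‖formS (nome (arc θ))‖ := by
  have hpi := Real.pi_lt_d4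
  have hpi' := Real.pi_pos
  have h2 := im_arc_lower_le h0 (by linarith)
  have h3 : 0.0645 ≤ ‖nome (arc θ)‖ := by
    rw [norm_nome, Real.exp_neg, le_inv_comm₀ (by norm_num) (Real.exp_pos _)]
    refine exp_le_of_taylor_pow (y := 0.91359) 3 (by norm_num) (by norm_num) ?_ (by norm_num)
    push_cast
    nlinarith
  exact norm_formS_ge h3 (norm_nome_arc_le ⟨by linarith, h1⟩) (by norm_num) (by norm_num [eulerLow])

lemma le_im_lowPoint {θ : ℝ} (hz : 0 < (arc θ).im) (h0 : 2.27 ≤ arcParam θ) (h1 : arcParam θ < 3)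
    {h : ℝ} (hh : h * (4 - arcParam θ) = (arc θ).im ∨ h * (7 - 2 * arcParam θ) = (arc θ).im) :
    0.175 ≤ h ∧ h < (arc θ).im := by
  have h4 := im_arc_sq θ
  have h5 : 0.175 * (7 - 2 * arcParam θ) ≤ (arc θ).im := by
    refine le_of_pow_le_pow_left₀ (n := 2) (by norm_num) hz.le ?_
    nlinarith
  have hh0 : 0 < h := by
    rcases hh with hh | hh
    · exact pos_of_mul_pos_left (hh ▸ hz) (by linarith)
    · exact pos_of_mul_pos_left (hh ▸ hz) (by linarith)
  rcases hh with hh | hh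
  · constructor <;> nlinarith
  · constructor <;> nlinarith

/-- Six nomes belong to heights at least `0.175`; every other height is at most `y/6`. The circle
`|q| = 0.45`, at height about `0.127`, separates the two groups. -/
lemma orb_lower {θ : ℝ} (hz : 0 < (arc θ).im) (h0 : 2.27 ≤ arcParam θ) (h1 : arcParam θ < 3)
    (hy : (arc θ).im ≤ 0.4362) {a : ℂ} (h : Orb (arc θ) a) :
    ((nome a = nome (arc θ) ∨ nome a = nome (fricke (arc θ)) ∨
      ∃ i, nome a = nome (lowPoint (arc θ) i)) ∧ 0.175 ≤ a.im) ∨ a.im ≤ 0.0727 := by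
  rcases nome_eq_or_im_le_six hz (by linarith) h1.le h with ⟨h6, h7⟩ | ⟨h6, h7⟩ | h6
  · refine .inl ⟨by tauto, ?_⟩
    have h4 := im_arc_sq θ
    nlinarith
  · exact .inl ⟨by tauto, (le_im_lowPoint hz h0 h1 h7).1⟩
  · right; linarith

lemma norm_formS_lower {q : ℂ} (hq : ‖q‖ = 0.45) : 0.0006 ≤ ‖formS q‖ ∧ ‖formS q‖ ≤ 112 := by
  constructor
  · exact norm_formS_ge (r := 0.45) (R := 0.45) hq.ge hq.le (by norm_num) (by norm_num [eulerLow])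
  · refine norm_formS_le (R := 0.45) (U := 2.506) hq.le (by norm_num) ?_ (by norm_num)
    exact exp_le_of_taylor_pow (y := 0.459225) 2 (by norm_num) (by norm_num)
      (by norm_num) (by norm_num)

lemma norm_formA_lower {q : ℂ} (hq : ‖q‖ = 0.45) : ‖formA q‖ ≤ 180 := by
  have hq3 : ‖q ^ 3‖ ≤ 0.45 ^ 3 := by rw [norm_pow, hq]
  refine norm_formA_le_of_bounds (R := 0.45) (l := 0.365) (l₃ := 0.9) (u := 2.267) (u₃ := 1.106)
    (by simp [hq]; norm_num) (by rintro rfl; norm_num at hq) hq.le (by norm_num) (by norm_num)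
    (le_trans (by norm_num [eulerLow]) (eulerLow_le hq.le (by norm_num)))
    (le_trans (by norm_num [eulerLow]) (eulerLow_le hq3 (by norm_num)))
    ((norm_eulerProd_le hq.le (by norm_num)).trans ?_)
    ((norm_eulerProd_le hq3 (by norm_num)).trans ?_) (norm_formS_lower hq).2 (by norm_num)
    (by norm_num)
  · exact exp_le_of_taylor_pow (y := 0.4091) 2 (by norm_num) (by norm_num)
      (by norm_num) (by norm_num)
  · exact exp_le_of_taylor_pow (y := 0.1003) 1 (by norm_num) (by norm_num)
      (by norm_num) (by norm_num)

/-- From `jt = (t + 27)²`, a value `|t| < 2.5` would force `|j| > 216`. With `|t|` bounded below,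
`S² = t q³ ∏(1 - q^{3n})^24` improves greatly on the bound valid on the whole circle. -/
lemma norm_formS_sq_ge_of_norm_jInv_le {q : ℂ} (hq : ‖q‖ = 0.45) (hj : ‖jInv q‖ ≤ 216) :
    0.018 ≤ ‖formS q‖ ^ 2 := by
  have hq1 : q ∈ ball (0 : ℂ) 1 := by simp [hq]; norm_num
  have hq0 : q ≠ 0 := by rintro rfl; norm_num at hq
  have hq3 : ‖q ^ 3‖ ≤ 0.45 ^ 3 := by rw [norm_pow, hq]
  have ht0 := haupt_ne_zero hq1 hq0
  have ht : 2.5 ≤ ‖haupt q‖ := by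
    by_contra! h
    have h1 : jInv q * haupt q = (haupt q + 27) ^ 2 := by rw [jInv]; field_simp; ring
    have h2 := congrArg norm h1
    rw [norm_mul, norm_pow] at h2
    have h3 : 27 - ‖haupt q‖ ≤ ‖haupt q + 27‖ := by
      have := norm_sub_le (haupt q + 27) (haupt q)
      rw [add_sub_cancel_left, Complex.norm_ofNat] at this
      linarith
    have h4 := norm_nonneg (haupt q)
    nlinarith
  have he : 0.9 ≤ ‖eulerProd (q ^ 3)‖ :=
    le_trans (by norm_num [eulerLow]) (eulerLow_le hq3 (by norm_num))
  rw [norm_formS_sq hq1 hq0, hq]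
  calc (0.018 : ℝ) ≤ 2.5 * (0.45 ^ 3 * 0.9 ^ 24) := by norm_num
    _ ≤ _ := by gcongr

lemma norm_jInv_sub_lower {θ c : ℝ} (hθ : θ ∈ Set.Ioo (Real.pi / 2) (5 * Real.pi / 6))
    (h1 : 23 / 10 ≤ θ) (hc0 : 0 ≤ c) (hc : jInv (nome (arc θ)) = c) {q : ℂ} (hq : ‖q‖ = 0.45) :
    c * 0.15 ^ 2 ≤ ‖jInv q - c‖ := by
  have hpi := Real.pi_pos
  have hz := arc_im_pos (θ := θ) ⟨by linarith [hθ.1], by linarith [hθ.2]⟩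
  refine le_norm_jInv_sub hθ hc0 hc (by norm_num) (by rintro rfl; norm_num at hq)
    (by rw [hq]; norm_num) fun τ a hτ ha => ?_
  rw [← hτ] at hq
  have h2 := le_im_of_norm_nome_le hq.le exp_two_pi_lower.2
  have h3 := im_le_of_le_norm_nome hq.ge exp_two_pi_lower.1
  have ha' := ha.im_pos hz
  rcases orb_lower hz (le_arcParam h1 (by linarith [hθ.2])) (arcParam_lt_three hθ)
    (im_arc_lower_le h1 (by linarith [hθ.2])) ha with ⟨-, h4⟩ | h4
  · rw [abs_of_nonpos (by linarith)]; linarith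
  · rw [abs_of_nonneg (by linarith)]; linarith

lemma kernel_bound_lower {θ c : ℝ} (hθ : θ ∈ Set.Ioo (Real.pi / 2) (5 * Real.pi / 6))
    (h1 : 23 / 10 ≤ θ) {m : ℤ} (hm : 23 ≤ m) (hθm : θ ≤ 5 * Real.pi / 6 - 12 / (25 * (m : ℝ)))
    (hc0 : 0 < c) (hc1 : c < 108) (hc : jInv (nome (arc θ)) = c) {q : ℂ}
    (hq : ‖q‖ = 0.45) {a b e : ℕ} (ha : a ≤ 2) (hb : b ≤ 1) (he : e ≤ 1) :
    ‖formF a b e (nome (arc θ))‖ * ‖formF (2 - a) (1 - b) (1 - e) q‖ ≤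
      20000000 * m * (‖formS q‖ ^ 2 * ‖jInv q - c‖) := by
  have hpi := Real.pi_gt_d4
  have hz := arc_im_pos (θ := θ) ⟨by linarith [hθ.1], by linarith [hθ.2]⟩
  have hq1 : q ∈ ball (0 : ℂ) 1 := by simp [hq]; norm_num
  have hq0 : q ≠ 0 := by rintro rfl; norm_num at hq
  have hS := norm_formS_arc_le (Set.Ioo_subset_Icc_self hθ)
  obtain ⟨hS1, hS2⟩ := norm_formS_lower hq
  have hm' : (23 : ℝ) ≤ m := by exact_mod_cast hm
  rcases le_total ‖jInv q‖ 216 with hj | hj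
  -- The distance `0.48/m` from `5π/6` gives `κ = (3/4)(0.48/m)`, the source of the factor `m`; `B =
  -- 17` exceeds `0.55²/0.018`.
  · refine (kernel_bound_small (κ := 0.36 / m) (ω := 0.15 ^ 2) (B := 17) ha hb he (nome_mem_ball hz)
      (nome_ne_zero _) hq1 hq0 hc hc1 (by positivity) ?_ (by norm_num) (by norm_num)
      (norm_jInv_sub_lower hθ h1 hc0.le hc hq) hj (by linarith) (by linarith) ?_
      (by norm_num)).trans ?_
    · refine le_trans ?_ (jInv_arc_ge hθ hc)
      gcongr
      have : 12 / (25 * (m : ℝ)) = 0.48 / m := by field_simp; norm_num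
      have h3 : 0.36 / (m : ℝ) = 3 / 4 * (0.48 / m) := by ring
      linarith
    · calc ‖formS (nome (arc θ))‖ ^ 2 ≤ 0.55 ^ 2 := by gcongr
        _ ≤ 17 * 0.018 := by norm_num
        _ ≤ _ := by gcongr; exact norm_formS_sq_ge_of_norm_jInv_le hq hj
    · gcongr
      rw [show 36 * 17 / (0.15 ^ 2 * (0.36 / (m : ℝ))) = 36 * 17 / (0.15 ^ 2 * 0.36) * m by field_simp]
      gcongr
      norm_num
  · refine (kernel_bound_large (s := 0.0006) (X := 180) ha hb he (nome_mem_ball hz) (nome_ne_zero _)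
      hq1 hq0 hc hc0 hc1 hj (by linarith) (by norm_num) (by norm_num) hS1 (norm_formA_lower hq)
      (by norm_num) (by norm_num)).trans ?_
    gcongr
    calc (1476 * 180 / 0.0006 : ℝ) ≤ 20000000 * 23 := by norm_num
      _ ≤ _ := by gcongr

/-- The linear factor `m` costs little against the geometric decay. -/
lemma intCast_mul_zpow_le {x : ℝ} (hx : 0 < x) {m : ℤ} (hm : 23 ≤ m) :
    m * x ^ m ≤ 30 * (30 / 31) ^ 23 * (31 / 30 * x) ^ m := by
  obtain ⟨n, rfl⟩ : ∃ n : ℕ, m = 23 + n := ⟨(m - 23).toNat, by omega⟩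
  -- Bernoulli: `23 + n ≤ 30(1 + n/30) ≤ 30(31/30)^n`.
  have h1 := one_add_mul_le_pow (a := (1 / 30 : ℝ)) (by norm_num) n
  rw [show ((23 : ℤ) + n) = ((23 + n : ℕ) : ℤ) by push_cast; rfl, zpow_natCast, zpow_natCast, mul_pow,
    ← mul_assoc]
  gcongr
  rw [pow_add]
  push_cast
  norm_num at h1 ⊢
  linarith

/-! ### The further residues on the lower part of the arc -/

lemma three_sub_arcParam (θ : ℝ) : 3 - arcParam θ =
    3 * (1 - Real.cos (5 * Real.pi / 6 - θ)) + √3 * Real.sin (5 * Real.pi / 6 - θ) := by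
  have h := sqrt_three_sq
  rw [Real.cos_sub, Real.sin_sub, cos_five_pi_div_six, sin_five_pi_div_six, arcParam]
  linear_combination (-(1 / 2) * Real.sin θ) * h

/-- Near `5π/6` the quantity `3 - p` is at least about `√3 δ` with `δ = 5π/6 - θ ≥ 0.48/m`, and `√3
· 0.48 ≈ 0.831`. Away from `5π/6` the constant bound holds. -/
lemma three_sub_arcParam_ge {θ : ℝ} (h0 : 23 / 10 ≤ θ) {m : ℤ} (hm : 23 ≤ m)
    (hθm : θ ≤ 5 * Real.pi / 6 - 12 / (25 * (m : ℝ))) :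
    0.05 ≤ 3 - arcParam θ ∨ 0.831 ≤ m * (3 - arcParam θ) := by
  have hpi := Real.pi_lt_d4
  have hm' : (23 : ℝ) ≤ m := by exact_mod_cast hm
  set δ := 5 * Real.pi / 6 - θ with hδ
  have h1 : 12 / (25 * (m : ℝ)) ≤ δ := by rw [hδ]; linarith
  have hδ0 : 0 < δ := lt_of_lt_of_le (by positivity) h1
  have hδ1 : δ ≤ 0.32 := by rw [hδ]; linarith
  have hs := Real.sin_gt_sub_cube hδ0
  have hE : √3 * Real.sin δ ≤ 3 - arcParam θ := by
    rw [three_sub_arcParam, ← hδ]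
    linarith [Real.cos_le_one δ]
  have h3 := sqrt_three_gt
  have h4 : 0.48 ≤ m * δ := by
    rw [div_le_iff₀ (by positivity)] at h1
    linarith
  rcases le_total δ 0.03 with h | h
  · right
    have h5 : 0.9997 * δ ≤ Real.sin δ := by nlinarith [mul_pos hδ0 hδ0]
    have h6 : 1.7315 * δ ≤ 3 - arcParam θ := by nlinarith
    nlinarith
  · left
    have h5 : 0.97 * δ ≤ Real.sin δ := by nlinarith [mul_pos hδ0 hδ0]
    nlinarith

/-- The exponential decay of a residue at relative height `1 / (1 + E)`. -/
lemma residue_bound {m n : ℤ} {y h E : ℝ} (hE : 0 ≤ E) (hy : 1.8137 ≤ 2 * Real.pi * y)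
    (hh : h * (1 + E) = y) (hm : 0 ≤ m) (hn : 3 * |n| ≤ m) :
    Real.exp (-(2 * Real.pi * m * (y - h))) * (h / y) ^ n ≤
      Real.exp (-(m * (E * (1.8137 / (1 + E) - 1 / 3)))) := by
  have hpi := Real.pi_pos
  have hy0 : 0 < y := by
    by_contra! h
    nlinarith
  have h1 : h / y = (1 + E)⁻¹ := by
    have : h ≠ 0 := by rintro rfl; simp at hh; linarith
    rw [← hh]; field_simp
  have hm' : (0 : ℝ) ≤ m := by exact_mod_cast hm
  have hn' : 3 * |(n : ℝ)| ≤ m := by exact_mod_cast hn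
  -- `log(1 + E) ≤ E` together with `|n| ≤ m/3` bounds the power of the height ratio by an
  -- exponential linear in `mE`.
  have h2 : (h / y) ^ n ≤ Real.exp (m * E / 3) := by
    rw [h1, inv_zpow', ← Real.rpow_intCast, Real.rpow_def_of_pos (by linarith)]
    refine Real.exp_le_exp.2 ?_
    have h3 : Real.log (1 + E) ≤ E := by linarith [Real.log_le_sub_one_of_pos (x := 1 + E) (by linarith)]
    have h4 : 0 ≤ Real.log (1 + E) := Real.log_nonneg (by linarith)
    have h5 : ((-n : ℤ) : ℝ) ≤ |(n : ℝ)| := by push_cast; exact neg_le_abs _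
    calc Real.log (1 + E) * ((-n : ℤ) : ℝ) ≤ Real.log (1 + E) * |(n : ℝ)| := by gcongr
      _ ≤ E * (m / 3) := by gcongr; linarith
      _ = _ := by ring
  calc _ ≤ Real.exp (-(2 * Real.pi * m * (y - h))) * Real.exp (m * E / 3) := by gcongr
    _ ≤ _ := by
      rw [← Real.exp_add, Real.exp_le_exp]
      have h6 : y - h = y * (E / (1 + E)) := by rw [← hh]; field_simp; ring
      have h7 : 1.8137 * (m * (E / (1 + E))) ≤ 2 * Real.pi * y * (m * (E / (1 + E))) := by gcongr
      rw [h6]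
      have h8 : m * (E * (1.8137 / (1 + E) - 1 / 3)) = 1.8137 * (m * (E / (1 + E))) - m * E / 3 := by
        field_simp
      rw [h8]
      linarith

/-- `E = 3 - p` belongs to the points of relative height `1/(4 - p)` and `2E` to those of relative
height `1/(7 - 2p)`. The worst case is small `E`, where `mE ≥ 0.831`. -/
lemma decay_bound {E m : ℝ} (hE0 : 0 ≤ E) (hE1 : E ≤ 0.75) (hm : 23 ≤ m)
    (h : 0.05 ≤ E ∨ 0.831 ≤ m * E) :
    1.158 ≤ m * (E * (1.8137 / (1 + E) - 1 / 3)) ∧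
      2.18 ≤ m * (2 * E * (1.8137 / (1 + 2 * E) - 1 / 3)) := by
  rcases le_total E 0.05 with h1 | h1
  · have h2 : 0.831 ≤ m * E := by
      rcases h with h | h
      · nlinarith
      · exact h
    constructor
    · have h3 : 1.8137 / 1.05 ≤ 1.8137 / (1 + E) := by gcongr; linarith
      norm_num at h3
      nlinarith
    · have h3 : 1.8137 / 1.1 ≤ 1.8137 / (1 + 2 * E) := by gcongr; linarith
      norm_num at h3
      nlinarith
  · constructor
    · have h3 : 0.0696 ≤ E * (1.8137 / (1 + E) - 1 / 3) := by
        rw [show E * (1.8137 / (1 + E) - 1 / 3) = E * (1.8137 - (1 + E) / 3) / (1 + E) by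
          field_simp, le_div_iff₀ (by linarith)]
        nlinarith
      nlinarith
    · have h3 : 0.13 ≤ 2 * E * (1.8137 / (1 + 2 * E) - 1 / 3) := by
        rw [show 2 * E * (1.8137 / (1 + 2 * E) - 1 / 3) =
          2 * E * (1.8137 - (1 + 2 * E) / 3) / (1 + 2 * E) by field_simp,
          le_div_iff₀ (by linarith)]
        nlinarith
      nlinarith

lemma sum_image_le_sum {ι α : Type*} [Fintype ι] [DecidableEq α] (g : ι → α) {φ : α → ℝ}
    (hφ : ∀ x, 0 ≤ φ x) : ∑ x ∈ Finset.univ.image g, φ x ≤ ∑ i, φ (g i) := by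
  rw [Finset.sum_comp φ g]
  refine Finset.sum_le_sum (N := ℝ) fun x hx => ?_
  obtain ⟨i, hi, rfl⟩ := Finset.mem_image.1 hx
  rw [nsmul_eq_mul]
  refine le_mul_of_one_le_left (hφ _) ?_
  exact_mod_cast Finset.card_pos.2 ⟨i, by simp⟩

lemma lowPoint_residue_le {ℓ m : ℤ} {a b e : ℕ} (ha : a ≤ 2) (hb : b ≤ 1) (he : e ≤ 1)
    (hpar : Even (a + b + e)) (hm : 18 * |ℓ| + 23 ≤ m) {θ c : ℝ}
    (hθ : θ ∈ Set.Ioo (Real.pi / 2) (5 * Real.pi / 6)) (h0 : 23 / 10 ≤ θ)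
    (hθm : θ ≤ 5 * Real.pi / 6 - 12 / (25 * (m : ℝ))) (hc0 : 0 < c) (hc1 : c < 108)
    (hc : jInv (nome (arc θ)) = c) (i : Fin 4) :
    (‖nome (arc θ)‖ / ‖nome (lowPoint (arc θ) i)‖) ^ m *
      ‖baseForm ℓ a b e (nome (arc θ)) / baseForm ℓ a b e (nome (lowPoint (arc θ) i))‖ ≤
      if i = 0 ∨ i = 1 then 0.3142 else 0.1131 := by
  have hpi := Real.pi_pos
  have hz := arc_im_pos (θ := θ) ⟨by linarith [hθ.1], by linarith [hθ.2]⟩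
  have hab := abs_nonneg ℓ
  have hm1 : 23 ≤ m := by linarith
  have hm' : (23 : ℝ) ≤ m := by exact_mod_cast hm1
  have hp0 := le_arcParam h0 (by linarith [hθ.2])
  have hp1 := arcParam_lt_three hθ
  obtain ⟨d1, d2⟩ := decay_bound (E := 3 - arcParam θ) (by linarith) (by linarith) hm'
    (three_sub_arcParam_ge h0 hm1 hθm)
  rw [(orb_lowPoint (arc θ) i).norm_baseForm_div hpar hz (by rw [hc]; exact_mod_cast hc0.ne')
    (by rw [hc]; exact_mod_cast hc1.ne), div_zpow, ← exp_neg_eq_norm_nome_zpow,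
    ← exp_neg_eq_norm_nome_zpow, ← Real.exp_sub,
    show -(2 * Real.pi * m * (arc θ).im) - -(2 * Real.pi * m * (lowPoint (arc θ) i).im) =
      -(2 * Real.pi * m * ((arc θ).im - (lowPoint (arc θ) i).im)) by ring]
  have hy : 1.8137 ≤ 2 * Real.pi * (arc θ).im := by
    have h1 := lt_two_pi_div_sqrt_three
    have h2 := sin_ge_half (Set.Ioo_subset_Icc_self hθ)
    rw [arc_im, show 2 * Real.pi * (Real.sin θ / √3) = 2 * Real.pi / √3 * Real.sin θ by ring]
    nlinarith
  -- Half the weight is at most `6|ℓ| + 7` in absolute value, and `3(6|ℓ| + 7) ≤ 18|ℓ| + 23`.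
  have hn : 3 * |6 * ℓ + ((a + 2 * b + 3 * e : ℕ) : ℤ)| ≤ m := by
    have h1 : |6 * ℓ + ((a + 2 * b + 3 * e : ℕ) : ℤ)| ≤ |6 * ℓ| + |((a + 2 * b + 3 * e : ℕ) : ℤ)| :=
      abs_add_le _ _
    rw [abs_mul, Nat.abs_cast] at h1
    push_cast at h1 ⊢
    norm_num at h1
    omega
  have hi := im_lowPoint_mul hz i
  generalize 6 * ℓ + ((a + 2 * b + 3 * e : ℕ) : ℤ) = n at hn ⊢
  split_ifs at hi ⊢ with h
  · refine (residue_bound (E := 3 - arcParam θ) (by linarith) hy (by linarith) (by linarith)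
      hn).trans ((Real.exp_le_exp.2 (neg_le_neg d1)).trans ?_)
    rw [Real.exp_neg, inv_le_comm₀ (Real.exp_pos _) (by norm_num)]
    exact le_exp_of_taylor_pow (y := 0.579) 2 (by norm_num) (by norm_num) (by norm_num)
  · refine (residue_bound (E := 2 * (3 - arcParam θ)) (by linarith) hy (by linarith) (by linarith)
      hn).trans ((Real.exp_le_exp.2 (neg_le_neg d2)).trans ?_)
    rw [Real.exp_neg, inv_le_comm₀ (Real.exp_pos _) (by norm_num)]
    exact le_exp_of_taylor_pow (y := 0.545) 4 (by norm_num) (by norm_num) (by norm_num)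

lemma norm_nome_lt_norm_nome {τ τ' : ℂ} : ‖nome τ‖ < ‖nome τ'‖ ↔ τ'.im < τ.im := by
  rw [norm_nome, norm_nome, Real.exp_lt_exp]
  constructor <;> intro h <;> nlinarith [Real.pi_pos]

/-- On the lower part of the arc four further residues enter the remainder. -/
theorem norm_normalized_sub_le_lower {k ℓ r m : ℤ} (hr : r ∈ ({0, 4, 6, 8, 10, 14} : Set ℤ))
    (hk : k = 12 * ℓ + r) {f : ℍ → ℂ} (hf : IsBasisForm ℓ r m f)
    (hm : 18 * |ℓ| + 23 ≤ m) {θ : ℝ} (h0 : 23 / 10 ≤ θ)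
    (hθm : θ ≤ 5 * Real.pi / 6 - 12 / (25 * (m : ℝ))) :
    ‖normalized k m f θ - ((2 * Real.cos (phase k m θ) : ℝ) : ℂ)‖ ≤ 0.95 := by
  classical
  have hpi := Real.pi_lt_d4
  have hab := abs_nonneg ℓ
  have hab1 := le_abs_self ℓ
  have hab2 := neg_abs_le ℓ
  have hm1 : 23 ≤ m := by linarith
  have hm' : (23 : ℝ) ≤ m := by exact_mod_cast hm1
  have hθ : θ ∈ Set.Ioo (Real.pi / 2) (5 * Real.pi / 6) := by
    have : 0 < 12 / (25 * (m : ℝ)) := by positivity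
    exact ⟨by linarith, by linarith⟩
  have hz := arc_im_pos (θ := θ) ⟨by linarith [hθ.1], by linarith [hθ.2]⟩
  obtain ⟨c, hc0, hc1, hc⟩ := exists_jInv_arc hθ
  obtain ⟨a, b, e, ha, hb, he, hpar, hr', her⟩ := exists_exponents hr
  have hp0 := le_arcParam h0 (by linarith [hθ.2])
  have hp1 := arcParam_lt_three hθ
  have hw := norm_nome_arc_le (Set.Ioo_subset_Icc_self hθ)
  have hw0 : 0 < ‖nome (arc θ)‖ := norm_pos_iff.2 (nome_ne_zero _)
  have hx0 : 0 < ‖nome (arc θ)‖ / 0.45 := by positivity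
  have hx1 : ‖nome (arc θ)‖ / 0.45 ≤ 0.3625 := by
    rw [div_le_iff₀ (by norm_num)]; linarith
  set x := ‖nome (arc θ)‖ / 0.45 with hx
  have hSl := norm_formS_arc_lower_ge h0 hθ.2.le
  have hSu := norm_formS_arc_le (Set.Ioo_subset_Icc_self hθ)
  have hx0' : 0 < 31 / 30 * x := by positivity
  have hx1' : 31 / 30 * x ≤ 0.3746 := by linarith
  have hlow : ∀ i, 0.175 ≤ (lowPoint (arc θ) i).im ∧ (lowPoint (arc θ) i).im < (arc θ).im := by
    intro i
    have hi := im_lowPoint_mul hz i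
    refine le_im_lowPoint hz hp0 hp1 ?_
    split_ifs at hi
    · exact .inl hi
    · exact .inr hi
  have key := norm_normalized_sub_le (R := 0.45)
    (Z := Finset.univ.image fun i => nome (lowPoint (arc θ) i))
    (K := 20000000 * m * ((31 / 30 * x) ^ 23 / (31 / 30 * x) ^ m))
    ha hb he hpar hr' her hk hf (by linarith) hθ hc0 hc1 hc (by linarith) (by norm_num)
    (fun q hq => ?_) (fun q hq0 hq1 hq => ?_) (fun q hq => ?_)
  · refine key.trans ?_
    rw [← hx]
    have h1 := sum_image_le_sum (fun i => nome (lowPoint (arc θ) i))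
      (φ := fun p => (‖nome (arc θ)‖ / ‖p‖) ^ m *
        ‖baseForm ℓ a b e (nome (arc θ)) / baseForm ℓ a b e p‖) (fun p => by positivity)
    have h2 := Finset.sum_le_sum fun i (_ : i ∈ Finset.univ) =>
      lowPoint_residue_le ha hb he hpar hm hθ h0 hθm hc0 hc1 hc i
    -- Two residues below `e^{-1.158}` and two below `e^{-2.18}`, rounded up.
    have h3 : ∑ i : Fin 4, (if i = 0 ∨ i = 1 then 0.3142 else 0.1131 : ℝ) = 0.8546 := by
      simp [Fin.sum_univ_four]; norm_num
    have h4 := zpow_pos hx0' m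
    have h5 : x ^ m * (20000000 * m * ((31 / 30 * x) ^ 23 / (31 / 30 * x) ^ m)) ≤ 0.09 := by
      calc x ^ m * (20000000 * m * ((31 / 30 * x) ^ 23 / (31 / 30 * x) ^ m))
          = m * x ^ m * (20000000 * ((31 / 30 * x) ^ 23 / (31 / 30 * x) ^ m)) := by ring
        _ ≤ 30 * (30 / 31) ^ 23 * (31 / 30 * x) ^ m *
            (20000000 * ((31 / 30 * x) ^ 23 / (31 / 30 * x) ^ m)) := by
          gcongr ?_ * _
          exact intCast_mul_zpow_le hx0 hm1
        _ = 30 * (30 / 31) ^ 23 * 20000000 * (31 / 30 * x) ^ 23 := by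
          generalize (31 / 30 * x) ^ m = P at h4 ⊢
          field_simp
        _ ≤ 30 * (30 / 31) ^ 23 * 20000000 * 0.3746 ^ 23 := by gcongr
        _ ≤ 0.09 := by norm_num
    linarith
  · obtain ⟨i, -, rfl⟩ := Finset.mem_image.1 hq
    obtain ⟨h1, h2⟩ := hlow i
    have h3 := norm_nome_lt_norm_nome.2 h2
    refine ⟨fun h => h3.ne' (congrArg norm h), fun h => ?_, nome_ne_zero _, ?_, ?_⟩
    · have h4 := congrArg norm h
      rw [norm_nome (fricke _), fricke_arc_im, ← norm_nome] at h4
      exact h3.ne' h4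
    · by_contra! h4
      have := im_le_of_le_norm_nome h4 exp_two_pi_lower.1
      linarith
    · exact ((orb_lowPoint _ i).jInv_eq hz).trans hc
  · have hq2 : ‖q‖ < 1 := hq1.trans_lt (by norm_num)
    obtain ⟨τ, hτ, rfl⟩ := exists_nome_eq hq0 hq2
    have h2 := le_im_of_norm_nome_le hq1 exp_two_pi_lower.2
    rcases orb_lower hz hp0 hp1 (im_arc_lower_le h0 (by linarith [hθ.2]))
      (orb_of_jInv_eq hθ hτ (hq.trans hc.symm)) with ⟨h3, -⟩ | h3
    · rcases h3 with h3 | h3 | ⟨i, h3⟩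
      · exact .inl h3
      · exact .inr (.inl h3)
      · exact .inr (.inr (Finset.mem_image.2 ⟨i, Finset.mem_univ _, h3.symm⟩))
    · linarith
  · have hq1 : q ∈ ball (0 : ℂ) 1 := by simp [hq]; norm_num
    have hq0 : q ≠ 0 := by rintro rfl; norm_num at hq
    have hj : jInv q ≠ c := by
      have h2 := norm_jInv_sub_lower hθ h0 hc0.le hc hq
      rw [← sub_ne_zero, ← norm_pos_iff]
      exact lt_of_lt_of_le (by positivity) h2
    refine (norm_kern_le hq1 hq0 hj
      (kernel_bound_lower hθ h0 hm1 hθm hc0 hc1 hc hq ha hb he)).trans ?_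
    obtain ⟨hS1, hS2⟩ := norm_formS_lower hq
    rw [hq, mul_assoc, mul_comm (_ ^ (2 * ℓ))]
    gcongr
    rw [le_div_iff₀ (zpow_pos hx0' m)]
    have ht1 : ‖formS (nome (arc θ))‖ / ‖formS q‖ ≤ 0.55 / 0.0006 := by gcongr
    have ht2 : 0.0176 / 112 ≤ ‖formS (nome (arc θ))‖ / ‖formS q‖ := by gcongr
    -- The factor `31/30` that absorbs `m` has been put into the base, and `u = v = 18` matches the
    -- term `18|ℓ|`.
    refine zpow_mul_zpow_le (u := 18) (v := 18) (by linarith) hx0' (by linarith) ?_ ?_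
      (fun h => ?_) (fun h => ?_)
    · calc _ ≤ (0.55 / 0.0006 : ℝ) ^ 2 * 0.3746 ^ 18 := by gcongr
        _ ≤ 1 := by norm_num
    · calc (31 / 30 * x) ^ 18 ≤ 0.3746 ^ 18 := by gcongr
        _ ≤ (0.0176 / 112) ^ 2 := by norm_num
        _ ≤ _ := by gcongr
    · rw [abs_of_nonneg h] at hm
      push_cast; linarith
    · rw [abs_of_nonpos h] at hm
      push_cast; linarith

/-! ### The endpoint of the upper part -/

lemma continuousOn_normalized {k ℓ r m : ℤ} {f : ℍ → ℂ} (hf : IsBasisForm ℓ r m f) :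
    ContinuousOn (normalized k m f) (Set.Ioo 0 Real.pi) := by
  have h1 : ContinuousOn arcPoint (Set.Ioo 0 Real.pi) := by
    rw [UpperHalfPlane.isEmbedding_coe.continuousOn_iff]
    refine ContinuousOn.congr (f := arc) ?_ fun θ hθ => coe_arcPoint (Real.sin_pos_of_mem_Ioo hθ)
    unfold arc
    fun_prop
  have h2 : ContinuousOn (fun θ => f (arcPoint θ)) (Set.Ioo 0 Real.pi) :=
    hf.1.holo.continuous.comp_continuousOn h1
  unfold normalized
  refine ContinuousOn.mul ?_ h2
  fun_prop

/-- At `θ = π/2` the points `z` and `Wz` coincide and `c = 108`, so the residue formula does not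
apply; the bound passes to the limit by continuity. -/
lemma norm_normalized_sub_le_upper_closed {k ℓ r m : ℤ}
    (hr : r ∈ ({0, 4, 6, 8, 10, 14} : Set ℤ)) (hk : k = 12 * ℓ + r) {f : ℍ → ℂ}
    (hf : IsBasisForm ℓ r m f) (hm : 9 * |ℓ| - 2 * ℓ + 18 ≤ m) {θ : ℝ} (h0 : Real.pi / 2 ≤ θ)
    (h1 : θ ≤ 23 / 10) :
    ‖normalized k m f θ - ((2 * Real.cos (phase k m θ) : ℝ) : ℂ)‖ ≤ 1 := by
  have hpi := Real.pi_gt_d2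
  have hpi' := Real.pi_lt_d2
  rcases h0.lt_or_eq with h | rfl
  · exact norm_normalized_sub_le_upper hr hk hf hm h h1
  have hphase : Continuous (phase k m) := by unfold phase; fun_prop
  have hc : ContinuousAt
      (fun θ => ‖normalized k m f θ - ((2 * Real.cos (phase k m θ) : ℝ) : ℂ)‖) (Real.pi / 2) := by
    refine ContinuousAt.norm (ContinuousAt.sub ?_ (by fun_prop))
    exact (continuousOn_normalized hf).continuousAt
      (Ioo_mem_nhds (by linarith) (by linarith))
  refine le_of_tendsto (hc.tendsto.mono_left (nhdsWithin_le_nhds (s := Set.Ioi (Real.pi / 2)))) ?_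
  filter_upwards [Ioo_mem_nhdsGT (show Real.pi / 2 < 23 / 10 by linarith)] with t ht
  exact norm_normalized_sub_le_upper hr hk hf hm ht.1 ht.2.le

end

end FrickeThree

theorem proposition2p4 (k ℓ r m : ℤ) (hr : r ∈ ({0, 4, 6, 8, 10, 14} : Set ℤ))
    (hk : k = 12 * ℓ + r) (f : UpperHalfPlane → ℂ) (hf : FrickeThree.IsBasisForm ℓ r m f) :
    (9 * |ℓ| - 2 * ℓ + 18 ≤ m →
      ∀ θ ∈ Set.Icc (Real.pi / 2) (23 / 10),
        ‖FrickeThree.normalized k m f θ - ((2 * Real.cos (FrickeThree.phase k m θ) : ℝ) : ℂ)‖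
          < 1.9674) ∧
    (18 * |ℓ| + 23 ≤ m →
      ∀ θ ∈ Set.Icc (23 / 10) (5 * Real.pi / 6 - 12 / (25 * (m : ℝ))),
        ‖FrickeThree.normalized k m f θ - ((2 * Real.cos (FrickeThree.phase k m θ) : ℝ) : ℂ)‖
          < 0.99728) := by
  refine ⟨fun hm θ hθ => ?_, fun hm θ hθ => ?_⟩
  · refine (FrickeThree.norm_normalized_sub_le_upper_closed hr hk hf hm hθ.1 hθ.2).trans_lt ?_
    norm_num
  · refine (FrickeThree.norm_normalized_sub_le_lower hr hk hf hm hθ.1 hθ.2).trans_lt ?_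
    norm_num
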